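/- Let $n\ge 1$, let $\mathbb B_n$ be the open unit ball of $\mathbb C^n$ with normalized volume measure $dv$, and let $\rho$ be a positive continuous integrable function on $[0,1)$ with $\int_0^1x^{2n-1}\rho(x)\,dx=1$; write $\rho(z)=\rho(|z|)$ for $z\in\mathbb B_n$. For $k\ge 0$ let $r_k\in[0,1)$ be determined by $\int_{r_k}^1\rho(x)\,dx=2^{-k}$. Assume that $\rho\in S^*$, that is, $$\inf_{k\ge 0}\frac{1-r_k}{1-r_{k+1}}>1,$$ and there is a constant $C>0$ with $\rho^*(r):=\frac1{1-r}\int_r^1\rho(t)\,dt\le C\rho(r)$ for all $r\in(0,1)$. Let $A^2_\rho$ be the Hilbert space of holomorphic functions $f$ on $\mathbb B_n$ with $\int_{\mathbb B_n}|f|^2\rho\,dv<\infty$, with the inner product $\langle f,g\rangle=\int_{\mathbb B_n} f\bar g\rho\,dv$; let $K_\rho(z,w)$ be its reproducing kernel, $K_z=K_\rho(\cdot,z)$ and $k_z=K_z/\|K_z\|$. For $z\in\mathbb B_n$ put $k(z)=k$ if $r_k\le|z|<r_{k+1}$, and $k(z)=0$ if $|z|<r_0$. Put $$d\lambda_\rho(z)=\frac{2^{k(z)}\rho(z)\,dv(z)}{(1-|z|)^n}.$$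 For $\alpha>0$ let $E(z,\alpha)=\{w\in\mathbb B_n:\beta(z,w)<\alpha\}$, where $\beta(z,w)=\frac12\log\frac{1+|\varphi_z(w)|}{1-|\varphi_z(w)|}$ is the Bergman metric and $\varphi_z$ is the Möbius involution of $\mathbb B_n$ that interchanges $0$ and $z$. For a finite positive Borel measure $\mu$ on $\mathbb B_n$ let $T_\mu$ be the Toeplitz operator $T_\mu f(z)=\int_{\mathbb B_n}K_\rho(z,w)f(w)\,d\mu(w)$, let $\widetilde{T_\mu}(z)=\langle T_\mu k_z,k_z\rangle=\int_{\mathbb B_n}|k_z|^2\,d\mu$ be its Berezin transform (the last integral defines it also when $T_\mu$ is unbounded), and put $$\widehat\mu_\alpha(z)=\frac{2^{k(z)}\mu(E(z,\alpha))}{(1-|z|)^n}.$$ Then there is $\alpha_0>0$, depending only on $n$ and $\rho$, such that for every finite positive Borel measure $\mu$ on $\mathbb B_n$ and every $1<p<\infty$ the following are equivalent: (a) $T_\mu$ is a bounded operator on $A^2_\rho$ (the integrals defining $T_\mu f$ converging absolutely for every $f\in A^2_\rho$) and belongs to the Schatten class $\mathcal S_p$; (b) $\widetilde{T_\mu}\in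 L^p(\mathbb B_n,d\lambda_\rho)$; (c) $\widehat\mu_\alpha\in L^p(\mathbb B_n,d\lambda_\rho)$ for every $\alpha\in(0,\alpha_0)$; (c') $\widehat\mu_\alpha\in L^p(\mathbb B_n,d\lambda_\rho)$ for some $\alpha\in(0,\alpha_0)$. -/

import Mathlib

open MeasureTheory Metric Set Filter Topology
open scoped ENNReal ComplexConjugate

noncomputable section

/-- The space `ℂⁿ` with its Hermitian norm. -/
abbrev Cn (n : ℕ) : Type := EuclideanSpace ℂ (Fin n)

/-- The normalized volume measure `dv` of the unit ball. -/
def ballVolume (n : ℕ) : Measure (Cn n) :=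
  (volume (ball (0 : Cn n) 1))⁻¹ • volume.restrict (ball (0 : Cn n) 1)

/-- A weight: a positive continuous integrable function on `[0,1)` with
`∫₀¹ x^(2n-1) ρ(x) dx = 1`. -/
structure BergmanWeight (n : ℕ) where
  /-- the function; only its values on `[0,1)` matter -/
  toFun : ℝ → ℝ
  continuousOn : ContinuousOn toFun (Ico 0 1)
  pos : ∀ x ∈ Ico (0 : ℝ) 1, 0 < toFun x
  integrableOn : IntegrableOn toFun (Ico 0 1)
  normalized : ∫ x in (0 : ℝ)..1, x ^ (2 * n - 1) * toFun x = 1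

instance (n : ℕ) : CoeFun (BergmanWeight n) (fun _ => ℝ → ℝ) := ⟨BergmanWeight.toFun⟩

namespace BergmanWeight

variable {n : ℕ} (ρ : BergmanWeight n)

/-- The measure `ρ(|z|) dv(z)` on the unit ball. -/
def measure : Measure (Cn n) :=
  (ballVolume n).withDensity (fun z => ENNReal.ofReal (ρ ‖z‖))

/-- Holomorphic functions on the ball (set to `0` off the ball) that are square integrable
against `ρ dv`. -/
def submodule : Submodule ℂ (Cn n → ℂ) where
  carrier := {f | DifferentiableOn ℂ f (ball 0 1) ∧ (∀ z ∉ ball (0 : Cn n) 1, f z = 0) ∧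
    MemLp f 2 ρ.measure}
  zero_mem' := ⟨differentiableOn_const 0, fun _ _ => rfl, MemLp.zero⟩
  add_mem' := fun {f g} hf hg => ⟨hf.1.add hg.1,
    fun z hz => by simp [hf.2.1 z hz, hg.2.1 z hz], hf.2.2.add hg.2.2⟩
  smul_mem' := fun c f hf => ⟨hf.1.const_smul c,
    fun z hz => by simp [hf.2.1 z hz], hf.2.2.const_smul c⟩

/-- The integral `∫_r^1 ρ`. -/
def tail (r : ℝ) : ℝ := ∫ x in r..1, ρ x

/-- The radius `r_k ∈ [0,1)` determined by `∫_{r_k}^1 ρ = 2^{-k}`. -/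
def radius (k : ℕ) : ℝ := sInf {r | r ∈ Ico (0 : ℝ) 1 ∧ ρ.tail r = (1 / 2) ^ k}

theorem intervalIntegrable {a b : ℝ} (ha : a ∈ Icc (0 : ℝ) 1) (hb : b ∈ Icc (0 : ℝ) 1) :
    IntervalIntegrable ρ volume a b := by
  have h1 : IntegrableOn ρ (Icc 0 1) := (integrableOn_Icc_iff_integrableOn_Ico).2 ρ.integrableOn
  exact (h1.mono_set (uIcc_subset_Icc ha hb)).intervalIntegrable

theorem existsUnique_radius (k : ℕ) :
    ∃! r, r ∈ Ico (0 : ℝ) 1 ∧ ρ.tail r = (1 / 2) ^ k := by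
  have hI {a b : ℝ} (ha : a ∈ Icc (0 : ℝ) 1) (hb : b ∈ Icc (0 : ℝ) 1) :=
    ρ.intervalIntegrable ha hb
  have m0 : (0 : ℝ) ∈ Icc (0 : ℝ) 1 := by simp
  have m1 : (1 : ℝ) ∈ Icc (0 : ℝ) 1 := by simp
  have h0 : 1 ≤ ρ.tail 0 := by
    rw [← ρ.normalized]
    refine intervalIntegral.integral_mono_on_of_le_Ioo zero_le_one ?_ (hI m0 m1) ?_
    · exact (hI m0 m1).continuousOn_mul (by fun_prop)
    · intro x hx
      have := ρ.pos x ⟨hx.1.le, hx.2⟩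
      have h2 : x ^ (2 * n - 1) ≤ 1 := pow_le_one₀ hx.1.le hx.2.le
      nlinarith
  have hanti : ∀ a ∈ Ico (0 : ℝ) 1, ∀ b ∈ Ico (0 : ℝ) 1, a < b → ρ.tail b < ρ.tail a := by
    intro a ha b hb hab
    have ma : a ∈ Icc (0 : ℝ) 1 := ⟨ha.1, ha.2.le⟩
    have mb : b ∈ Icc (0 : ℝ) 1 := ⟨hb.1, hb.2.le⟩
    have h1 : ρ.tail a = (∫ x in a..b, ρ x) + ρ.tail b :=
      (intervalIntegral.integral_add_adjacent_intervals (hI ma mb) (hI mb m1)).symm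
    have h2 : 0 < ∫ x in a..b, ρ x :=
      intervalIntegral.intervalIntegral_pos_of_pos_on (hI ma mb)
        (fun x hx => ρ.pos x ⟨ha.1.trans hx.1.le, hx.2.trans hb.2⟩) hab
    linarith
  have hcont : ContinuousOn ρ.tail (Icc 0 1) := by
    have h1 : ContinuousOn (fun r => ∫ x in (1 : ℝ)..r, ρ x) (uIcc 0 1) :=
      intervalIntegral.continuousOn_primitive_interval'
        (hI m0 m1) (by simp)
    rw [uIcc_of_le zero_le_one] at h1
    refine h1.neg.congr fun r _ => ?_
    rw [tail, intervalIntegral.integral_symm]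
    rfl
  have hk : (0 : ℝ) < (1 / 2) ^ k := by positivity
  have hk1 : ((1 : ℝ) / 2) ^ k ≤ 1 := pow_le_one₀ (by norm_num) (by norm_num)
  have h1 : ρ.tail 1 = 0 := by simp [tail]
  obtain ⟨r, hr, hrk⟩ := intermediate_value_Icc' zero_le_one hcont
    (show ((1 : ℝ) / 2) ^ k ∈ Icc (ρ.tail 1) (ρ.tail 0) from ⟨by rw [h1]; exact hk.le, hk1.trans h0⟩)
  have hr1 : r ≠ 1 := by
    rintro rfl
    rw [h1] at hrk
    exact hk.ne hrk
  refine ⟨r, ⟨⟨hr.1, lt_of_le_of_ne hr.2 hr1⟩, hrk⟩, ?_⟩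
  rintro s ⟨hs, hsk⟩
  by_contra hne
  rcases lt_or_gt_of_ne hne with h | h
  · exact absurd (hanti s hs r ⟨hr.1, lt_of_le_of_ne hr.2 hr1⟩ h) (by rw [hsk, hrk]; exact lt_irrefl _)
  · exact absurd (hanti r ⟨hr.1, lt_of_le_of_ne hr.2 hr1⟩ s hs h) (by rw [hsk, hrk]; exact lt_irrefl _)

theorem radius_spec (k : ℕ) : ρ.radius k ∈ Ico (0 : ℝ) 1 ∧ ρ.tail (ρ.radius k) = (1 / 2) ^ k := by
  obtain ⟨r, hr, huniq⟩ := ρ.existsUnique_radius k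
  have : {r | r ∈ Ico (0 : ℝ) 1 ∧ ρ.tail r = (1 / 2) ^ k} = {r} := by
    ext s
    exact ⟨fun h => huniq s h, fun h => by rw [mem_singleton_iff.1 h]; exact hr⟩
  rw [radius, this, csInf_singleton]
  exact hr

/-- On each smaller ball the volume is dominated by `ρ dv`. -/
theorem exists_restrict_le {r : ℝ} (h0 : 0 ≤ r) (h1 : r < 1) : ∃ C : ℝ≥0∞, C ≠ ∞ ∧
    (volume : Measure (Cn n)).restrict (closedBall 0 r) ≤ C • ρ.measure := by
  obtain ⟨x, hx, hmin⟩ := isCompact_Icc.exists_isMinOn (nonempty_Icc.2 h0)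
    (ρ.continuousOn.mono (Icc_subset_Ico_right h1))
  have hc : 0 < ρ x := ρ.pos x ⟨hx.1, hx.2.trans_lt h1⟩
  have hV0 : volume (ball (0 : Cn n) 1) ≠ 0 := (measure_ball_pos _ _ one_pos).ne'
  have hV1 : volume (ball (0 : Cn n) 1) ≠ ∞ := measure_ball_lt_top.ne
  have hc0 : ENNReal.ofReal (ρ x) ≠ 0 := by simpa using hc
  refine ⟨volume (ball (0 : Cn n) 1) * (ENNReal.ofReal (ρ x))⁻¹,
    ENNReal.mul_ne_top hV1 (ENNReal.inv_ne_top.2 hc0), Measure.le_iff.2 fun s hs => ?_⟩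
  rw [Measure.restrict_apply hs, Measure.smul_apply, measure, withDensity_apply _ hs]
  have hsub : s ∩ closedBall (0 : Cn n) r ⊆ ball 0 1 :=
    inter_subset_right.trans (closedBall_subset_ball h1)
  have hms : MeasurableSet (s ∩ closedBall (0 : Cn n) r) := hs.inter measurableSet_closedBall
  have key : ENNReal.ofReal (ρ x) *
      ((volume (ball (0 : Cn n) 1))⁻¹ * volume (s ∩ closedBall (0 : Cn n) r)) ≤
      ∫⁻ z in s, ENNReal.ofReal (ρ ‖z‖) ∂(ballVolume n) := by
    calc _ = ∫⁻ z in s ∩ closedBall (0 : Cn n) r, ENNReal.ofReal (ρ x) ∂(ballVolume n) := by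
          rw [setLIntegral_const, ballVolume, Measure.smul_apply, Measure.restrict_apply hms,
            inter_eq_left.2 hsub, smul_eq_mul]
      _ ≤ ∫⁻ z in s ∩ closedBall (0 : Cn n) r, ENNReal.ofReal (ρ ‖z‖) ∂(ballVolume n) := by
          refine setLIntegral_mono' hms fun z hz => ENNReal.ofReal_le_ofReal ?_
          exact hmin ⟨norm_nonneg z, by simpa using hz.2⟩
      _ ≤ _ := lintegral_mono_set inter_subset_left
  rw [smul_eq_mul]
  refine le_trans (le_of_eq ?_) (mul_le_mul_right key _)
  set V := volume (ball (0 : Cn n) 1)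
  set c := ENNReal.ofReal (ρ x)
  have : V * c⁻¹ * (c * (V⁻¹ * volume (s ∩ closedBall (0 : Cn n) r))) =
      (V * V⁻¹) * (c * c⁻¹) * volume (s ∩ closedBall (0 : Cn n) r) := by ring
  rw [this, ENNReal.mul_inv_cancel hV0 hV1, ENNReal.mul_inv_cancel hc0 ENNReal.ofReal_ne_top]
  simp

end BergmanWeight

/-- Multiplication by a unimodular number preserves the volume. -/
theorem measurePreserving_unit_smul {n : ℕ} (c : ℂ) (hc : ‖c‖ = 1) :
    MeasurePreserving (fun w : Cn n => c • w) volume volume := by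
  have hc0 : c ≠ 0 := by rintro rfl; simp at hc
  let e : Cn n ≃ₗᵢ[ℝ] Cn n :=
    { toLinearEquiv := (LinearEquiv.smulOfNeZero ℂ (Cn n) c hc0).restrictScalars ℝ
      norm_map' := fun w => by
        change ‖c • w‖ = ‖w‖
        rw [norm_smul, hc, one_mul] }
  exact e.measurePreserving

/-- The sub-mean value inequality over Euclidean balls for holomorphic functions. -/
theorem enorm_mul_volume_le {n : ℕ} {g : Cn n → ℂ} {U : Set (Cn n)}
    (hg : DifferentiableOn ℂ g U) (hgm : Measurable g) {z : Cn n} {s : ℝ}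
    (hs : closedBall z s ⊆ U) :
    ‖g z‖ₑ * volume (ball (0 : Cn n) s) ≤ ∫⁻ w in ball (0 : Cn n) s, ‖g (z + w)‖ₑ := by
  set P : ℝ≥0∞ := ENNReal.ofReal (2 * Real.pi) with hP
  have hP0 : P ≠ 0 := by simp [hP, Real.pi_pos]
  have hP1 : P ≠ ∞ := ENNReal.ofReal_ne_top
  have hm : Measurable (fun q : ℝ × Cn n => ‖g (z + circleMap 0 1 q.1 • q.2)‖ₑ) := by
    have : Measurable (fun q : ℝ × Cn n => z + circleMap 0 1 q.1 • q.2) := by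
      have : Continuous (fun q : ℝ × Cn n => z + circleMap 0 1 q.1 • q.2) := by fun_prop
      exact this.measurable
    exact (hgm.comp this).enorm
  have hpt : ∀ w ∈ ball (0 : Cn n) s, P * ‖g z‖ₑ ≤
      ∫⁻ θ in Ioc 0 (2 * Real.pi), ‖g (z + circleMap 0 1 θ • w)‖ₑ := by
    intro w hw
    have hd : DifferentiableOn ℂ (fun l : ℂ => g (z + l • w)) (closedBall 0 1) := by
      refine hg.comp (by fun_prop) fun l hl => hs ?_
      simp only [mem_closedBall, dist_self_add_left, norm_smul]
      have h1 : ‖l‖ ≤ 1 := by simpa using hl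
      have h2 : ‖w‖ < s := by simpa using hw
      nlinarith [norm_nonneg l, norm_nonneg w]
    have hcl : DiffContOnCl ℂ (fun l : ℂ => g (z + l • w)) (ball 0 |1|) := by
      rw [abs_one]
      exact (hd.mono (closure_ball_subset_closedBall)).diffContOnCl
    have hav := hcl.circleAverage
    rw [Real.circleAverage_def, zero_smul, add_zero,
      intervalIntegral.integral_of_le (by positivity)] at hav
    have h3 : (∫ θ in Ioc 0 (2 * Real.pi), g (z + circleMap 0 1 θ • w)) =
        (2 * Real.pi) • g z := by
      rw [← hav, smul_smul, mul_inv_cancel₀ (by positivity), one_smul]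
    calc P * ‖g z‖ₑ = ‖(2 * Real.pi) • g z‖ₑ := by
          rw [enorm_smul, Real.enorm_eq_ofReal (by positivity)]
      _ ≤ _ := by rw [← h3]; exact enorm_integral_le_lintegral_enorm _
  have hin : ∀ θ : ℝ, ∫⁻ w in ball (0 : Cn n) s, ‖g (z + circleMap 0 1 θ • w)‖ₑ =
      ∫⁻ w in ball (0 : Cn n) s, ‖g (z + w)‖ₑ := by
    intro θ
    have hn : ‖circleMap 0 1 θ‖ = 1 := by simp
    have hmp := (measurePreserving_unit_smul (n := n) _ hn).restrict_preimage
      (measurableSet_ball (x := (0 : Cn n)) (ε := s))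
    have hpre : (fun w : Cn n => circleMap 0 1 θ • w) ⁻¹' ball 0 s = ball 0 s := by
      ext w
      simp [norm_smul]
    rw [hpre] at hmp
    exact hmp.lintegral_comp (f := fun w => ‖g (z + w)‖ₑ)
      (hgm.comp (measurable_const_add z)).enorm
  have hmul : P * (‖g z‖ₑ * volume (ball (0 : Cn n) s)) ≤
      P * ∫⁻ w in ball (0 : Cn n) s, ‖g (z + w)‖ₑ := by
    calc P * (‖g z‖ₑ * volume (ball (0 : Cn n) s))
        = ∫⁻ w in ball (0 : Cn n) s, P * ‖g z‖ₑ := by rw [setLIntegral_const, mul_assoc]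
      _ ≤ ∫⁻ w in ball (0 : Cn n) s, ∫⁻ θ in Ioc 0 (2 * Real.pi),
            ‖g (z + circleMap 0 1 θ • w)‖ₑ := setLIntegral_mono' measurableSet_ball hpt
      _ = ∫⁻ θ in Ioc 0 (2 * Real.pi), ∫⁻ w in ball (0 : Cn n) s,
            ‖g (z + circleMap 0 1 θ • w)‖ₑ :=
          (lintegral_lintegral_swap hm.aemeasurable).symm
      _ = _ := by
          simp_rw [hin]
          rw [setLIntegral_const, Real.volume_Ioc, sub_zero, mul_comm]
  exact (ENNReal.mul_le_mul_iff_right hP0 hP1).1 hmul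

namespace BergmanWeight
variable {n : ℕ} (ρ : BergmanWeight n)

theorem measurable_of_mem {f : Cn n → ℂ} (hf : DifferentiableOn ℂ f (ball 0 1))
    (h0 : ∀ z ∉ ball (0 : Cn n) 1, f z = 0) : Measurable f := by
  classical
  have : f = (ball (0 : Cn n) 1).piecewise f (fun _ => 0) := by
    ext z
    by_cases hz : z ∈ ball (0 : Cn n) 1
    · rw [piecewise_eq_of_mem _ _ _ hz]
    · rw [piecewise_eq_of_notMem _ _ _ hz, h0 z hz]
  rw [this]
  exact hf.continuousOn.measurable_piecewise continuousOn_const measurableSet_ball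

/-- Point evaluations are bounded, uniformly on each smaller ball. -/
theorem exists_enorm_le {r : ℝ} (h1 : r < 1) : ∃ C : ℝ≥0∞, C ≠ ∞ ∧
    ∀ f ∈ ρ.submodule, ∀ z ∈ closedBall (0 : Cn n) r, ‖f z‖ₑ ≤ C * eLpNorm f 2 ρ.measure := by
  rcases lt_or_ge r 0 with h0 | h0
  · exact ⟨0, by simp, fun f _ z hz => absurd hz (by simp [closedBall_eq_empty.2 h0])⟩
  set s := (1 - r) / 2 with hs
  have hs0 : 0 < s := by simp only [hs]; linarith
  obtain ⟨C, hC, hle⟩ := ρ.exists_restrict_le (r := r + s) (by positivity) (by simp only [hs]; linarith)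
  have hV0 : volume (ball (0 : Cn n) s) ≠ 0 := (measure_ball_pos _ _ hs0).ne'
  have hV1 : volume (ball (0 : Cn n) s) ≠ ∞ := measure_ball_lt_top.ne
  refine ⟨(C * (volume (ball (0 : Cn n) s))⁻¹) ^ (1 / 2 : ℝ),
    ENNReal.rpow_ne_top_of_nonneg (by norm_num) (ENNReal.mul_ne_top hC (ENNReal.inv_ne_top.2 hV0)),
    fun f hf z hz => ?_⟩
  have hfm := measurable_of_mem hf.1 hf.2.1
  have hz' : ‖z‖ ≤ r := by simpa using hz
  have hsub : closedBall z s ⊆ ball (0 : Cn n) 1 := by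
    intro w hw
    have h2 : ‖w - z‖ ≤ s := by simpa [dist_eq_norm] using hw
    have h3 : ‖w‖ ≤ ‖w - z‖ + ‖z‖ := by simpa using norm_add_le (w - z) z
    have : ‖w‖ < 1 := by simp only [hs] at h2; linarith
    simpa using this
  have hmv := enorm_mul_volume_le (g := fun w => f w ^ 2) (hf.1.pow 2)
    (hfm.pow_const 2) hsub
  have htr : ∫⁻ w in ball (0 : Cn n) s, ‖f (z + w) ^ 2‖ₑ ≤
      C * ∫⁻ w, ‖f w‖ₑ ^ 2 ∂ρ.measure := by
    calc ∫⁻ w in ball (0 : Cn n) s, ‖f (z + w) ^ 2‖ₑ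
        = ∫⁻ w in ball z s, ‖f w ^ 2‖ₑ := by
          have hmp := (measurePreserving_add_left (volume : Measure (Cn n)) z).restrict_preimage
            (measurableSet_ball (x := z) (ε := s))
          have hpre : (fun w : Cn n => z + w) ⁻¹' ball z s = ball 0 s := by
            ext w
            simp
          rw [hpre] at hmp
          exact hmp.lintegral_comp (f := fun w => ‖f w ^ 2‖ₑ) (hfm.pow_const 2).enorm
      _ ≤ ∫⁻ w in closedBall 0 (r + s), ‖f w ^ 2‖ₑ := by
          refine lintegral_mono_set fun w hw => ?_
          have h2 : ‖w - z‖ < s := by simpa [dist_eq_norm] using hw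
          have h3 : ‖w‖ ≤ ‖w - z‖ + ‖z‖ := by simpa using norm_add_le (w - z) z
          have : ‖w‖ ≤ r + s := by linarith
          simpa using this
      _ ≤ ∫⁻ w, ‖f w ^ 2‖ₑ ∂(C • ρ.measure) := lintegral_mono' hle le_rfl
      _ = _ := by
          rw [lintegral_smul_measure, smul_eq_mul]
          simp_rw [enorm_pow]
  have hsq : ‖f z‖ₑ ^ 2 ≤ C * (volume (ball (0 : Cn n) s))⁻¹ * ∫⁻ w, ‖f w‖ₑ ^ 2 ∂ρ.measure := by
    have h4 := hmv.trans htr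
    rw [enorm_pow] at h4
    calc ‖f z‖ₑ ^ 2 = ‖f z‖ₑ ^ 2 * volume (ball (0 : Cn n) s) * (volume (ball (0 : Cn n) s))⁻¹ := by
          rw [mul_assoc, ENNReal.mul_inv_cancel hV0 hV1, mul_one]
      _ ≤ (C * ∫⁻ w, ‖f w‖ₑ ^ 2 ∂ρ.measure) * (volume (ball (0 : Cn n) s))⁻¹ :=
          mul_le_mul_left h4 _
      _ = _ := by ring
  have hL : eLpNorm f 2 ρ.measure = (∫⁻ w, ‖f w‖ₑ ^ 2 ∂ρ.measure) ^ (1 / 2 : ℝ) := by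
    rw [eLpNorm_eq_lintegral_rpow_enorm_toReal (by norm_num) (by norm_num)]
    simp
  rw [hL, ← ENNReal.mul_rpow_of_nonneg _ _ (by norm_num)]
  calc ‖f z‖ₑ = (‖f z‖ₑ ^ 2) ^ (1 / 2 : ℝ) := by
        rw [← ENNReal.rpow_natCast, ← ENNReal.rpow_mul]
        simp
    _ ≤ _ := ENNReal.rpow_le_rpow hsq (by norm_num)

end BergmanWeight

/-- The weighted Bergman space `A²_ρ`, with the inner product of `L²(ρ dv)`. -/
def BergmanSpace {n : ℕ} (ρ : BergmanWeight n) : Type := ρ.submodule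

namespace BergmanSpace

variable {n : ℕ} {ρ : BergmanWeight n}

instance : AddCommGroup (BergmanSpace ρ) := inferInstanceAs (AddCommGroup ρ.submodule)

instance : Module ℂ (BergmanSpace ρ) := inferInstanceAs (Module ℂ ρ.submodule)

/-- The inclusion of `A²_ρ` in `L²(ρ dv)`. -/
def toL2 : BergmanSpace ρ →ₗ[ℂ] Lp ℂ 2 ρ.measure where
  toFun f := MemLp.toLp f.1 f.2.2.2
  map_add' f g := MemLp.toLp_add f.2.2.2 g.2.2.2
  map_smul' c f := MemLp.toLp_const_smul c f.2.2.2

theorem enorm_toL2 (f : BergmanSpace ρ) : ‖toL2 f‖ₑ = eLpNorm f.1 2 ρ.measure :=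
  Lp.enorm_toLp f.2.2.2

theorem toL2_injective : Function.Injective (toL2 (ρ := ρ)) := by
  refine (injective_iff_map_eq_zero _).2 fun f hf => Subtype.ext (funext fun z => ?_)
  change f.1 z = 0
  by_cases hz : z ∈ ball (0 : Cn n) 1
  · have hz1 : ‖z‖ < 1 := by simpa using hz
    obtain ⟨C, -, hC⟩ := ρ.exists_enorm_le hz1
    have h := hC f.1 f.2 z (by simp)
    rw [← enorm_toL2, hf, enorm_zero, mul_zero] at h
    simpa using h
  · exact f.2.2.1 z hz

instance : NormedAddCommGroup (BergmanSpace ρ) :=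
  NormedAddCommGroup.induced (BergmanSpace ρ) (Lp ℂ 2 ρ.measure) toL2 toL2_injective

instance : InnerProductSpace ℂ (BergmanSpace ρ) where
  norm_smul_le c f := by
    change ‖toL2 (c • f)‖ ≤ ‖c‖ * ‖toL2 f‖
    rw [map_smul, norm_smul]
  inner f g := inner ℂ (toL2 f) (toL2 g)
  norm_sq_eq_re_inner f := norm_sq_eq_re_inner (𝕜 := ℂ) (toL2 f)
  conj_inner_symm f g := inner_conj_symm (toL2 f) (toL2 g)
  add_left f g h := by
    change inner ℂ (toL2 (f + g)) (toL2 h) = _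
    rw [map_add, inner_add_left]
  smul_left f g c := by
    change inner ℂ (toL2 (c • f)) (toL2 g) = _
    rw [map_smul, inner_smul_left]

theorem enorm_eq (f : BergmanSpace ρ) : ‖f‖ₑ = eLpNorm f.1 2 ρ.measure := enorm_toL2 f

theorem inner_eq (f g : BergmanSpace ρ) :
    inner ℂ f g = ∫ z, g.1 z * conj (f.1 z) ∂ρ.measure := by
  change inner ℂ (toL2 f) (toL2 g) = _
  rw [L2.inner_def]
  refine integral_congr_ae ?_
  filter_upwards [MemLp.coeFn_toLp f.2.2.2, MemLp.coeFn_toLp g.2.2.2] with z hf hg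
  change inner ℂ ((MemLp.toLp f.1 f.2.2.2 : Cn n → ℂ) z) ((MemLp.toLp g.1 g.2.2.2 : Cn n → ℂ) z) = _
  rw [hf, hg]
  rfl

theorem exists_norm_le {r : ℝ} (h1 : r < 1) : ∃ C : ℝ, 0 ≤ C ∧
    ∀ f : BergmanSpace ρ, ∀ z ∈ closedBall (0 : Cn n) r, ‖f.1 z‖ ≤ C * ‖f‖ := by
  obtain ⟨C, hC, h⟩ := ρ.exists_enorm_le h1
  refine ⟨C.toReal, ENNReal.toReal_nonneg, fun f z hz => ?_⟩
  have h2 := h f.1 f.2 z hz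
  rw [← enorm_eq] at h2
  have h3 := ENNReal.toReal_mono (ENNReal.mul_ne_top hC enorm_ne_top) h2
  simpa using h3

theorem norm_fderiv_le {r : ℝ} (h1 : r < 1) : ∃ C : ℝ, 0 ≤ C ∧
    ∀ f : BergmanSpace ρ, ∀ z ∈ closedBall (0 : Cn n) r, ‖fderiv ℂ f.1 z‖ ≤ C * ‖f‖ := by
  set s := (1 - r) / 2 with hs
  have hs0 : 0 < s := by simp only [hs]; linarith
  obtain ⟨C, hC, h⟩ := exists_norm_le (ρ := ρ) (r := r + s) (by simp only [hs]; linarith)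
  refine ⟨2 * C / s, by positivity, fun f z hz => ?_⟩
  have hz' : ‖z‖ ≤ r := by simpa using hz
  have hb : ∀ w ∈ ball z s, ‖w‖ ≤ r + s := by
    intro w hw
    have h2 : ‖w - z‖ < s := by simpa [dist_eq_norm] using hw
    have h3 : ‖w‖ ≤ ‖w - z‖ + ‖z‖ := by simpa using norm_add_le (w - z) z
    linarith
  have hd : DifferentiableOn ℂ f.1 (ball z s) := f.2.1.mono fun w hw => by
    have := hb w hw
    have h4 : ‖w‖ < 1 := by simp only [hs] at this; linarith
    simpa using h4
  have hmaps : MapsTo f.1 (ball z s) (closedBall (f.1 z) (2 * C * ‖f‖)) := by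
    intro w hw
    have h5 := h f w (by simpa using hb w hw)
    have h6 := h f z (by simpa using hz'.trans (by linarith))
    rw [mem_closedBall, dist_eq_norm]
    have := norm_sub_le (f.1 w) (f.1 z)
    linarith
  refine (Complex.norm_fderiv_le_div_of_mapsTo_ball hd hmaps hs0).trans (le_of_eq ?_)
  ring

instance : CompleteSpace (BergmanSpace ρ) := by
  refine Metric.complete_of_cauchySeq_tendsto fun u hu => ?_
  have hpt : ∀ z : Cn n, CauchySeq fun k => (u k).1 z := by
    intro z
    by_cases hz : z ∈ ball (0 : Cn n) 1
    · obtain ⟨C, hC, h⟩ := exists_norm_le (ρ := ρ) (r := ‖z‖) (by simpa using hz)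
      have hC1 : 0 < C + 1 := by linarith
      rw [Metric.cauchySeq_iff] at hu ⊢
      intro ε hε
      obtain ⟨N, hN⟩ := hu (ε / (C + 1)) (by positivity)
      refine ⟨N, fun k hk m hm => ?_⟩
      have h1 := hN k hk m hm
      have h2 := h (u k - u m) z (by simp)
      rw [dist_eq_norm] at h1 ⊢
      rw [lt_div_iff₀ hC1] at h1
      have h3 : ‖(u k).1 z - (u m).1 z‖ ≤ C * ‖u k - u m‖ := h2
      nlinarith [norm_nonneg (u k - u m)]
    · have : (fun k => (u k).1 z) = fun _ => 0 := funext fun k => (u k).2.2.1 z hz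
      rw [this]
      exact cauchySeq_const 0
  choose g hg using fun z => cauchySeq_tendsto_of_complete (hpt z)
  have hder : ∀ z : Cn n, CauchySeq fun k => (ball (0 : Cn n) 1).indicator (fderiv ℂ (u k).1) z := by
    intro z
    by_cases hz : z ∈ ball (0 : Cn n) 1
    · obtain ⟨C, hC, h⟩ := norm_fderiv_le (ρ := ρ) (r := ‖z‖) (by simpa using hz)
      have hC1 : 0 < C + 1 := by linarith
      rw [Metric.cauchySeq_iff] at hu ⊢
      intro ε hε
      obtain ⟨N, hN⟩ := hu (ε / (C + 1)) (by positivity)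
      refine ⟨N, fun k hk m hm => ?_⟩
      have h1 := hN k hk m hm
      have h2 := h (u k - u m) z (by simp)
      rw [dist_eq_norm] at h1 ⊢
      rw [lt_div_iff₀ hC1] at h1
      simp only [indicator_of_mem hz]
      have hda : ∀ j, DifferentiableAt ℂ (u j).1 z := fun j =>
        (u j).2.1.differentiableAt (isOpen_ball.mem_nhds hz)
      have h4 : fderiv ℂ (u k - u m).1 z = fderiv ℂ (u k).1 z - fderiv ℂ (u m).1 z :=
        fderiv_sub (hda k) (hda m)
      rw [h4] at h2
      nlinarith [norm_nonneg (u k - u m)]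
    · simp only [indicator_of_notMem hz]
      exact cauchySeq_const 0
  choose g' hg' using fun z => cauchySeq_tendsto_of_complete (hder z)
  have hgd : ∀ z ∈ ball (0 : Cn n) 1, HasFDerivAt g (g' z) z := by
    intro z hz
    have hz1 : ‖z‖ < 1 := by simpa using hz
    obtain ⟨r, hr, hr1⟩ := exists_between hz1
    obtain ⟨C, hC, h⟩ := norm_fderiv_le (ρ := ρ) hr1
    have hC1 : 0 < C + 1 := by linarith
    have hsub : ball (0 : Cn n) r ⊆ ball 0 1 := ball_subset_ball hr1.le
    have hunif : TendstoUniformlyOn (fun k => fderiv ℂ (u k).1) g' atTop (ball (0 : Cn n) r) := by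
      refine UniformCauchySeqOn.tendstoUniformlyOn_of_tendsto ?_ fun w hw => ?_
      · rw [Metric.uniformCauchySeqOn_iff]
        rw [Metric.cauchySeq_iff] at hu
        intro ε hε
        obtain ⟨N, hN⟩ := hu (ε / (C + 1)) (by positivity)
        refine ⟨N, fun k hk m hm w hw => ?_⟩
        have h1 := hN k hk m hm
        have h2 := h (u k - u m) w (ball_subset_closedBall hw)
        rw [dist_eq_norm] at h1 ⊢
        rw [lt_div_iff₀ hC1] at h1
        have hda : ∀ j, DifferentiableAt ℂ (u j).1 w := fun j =>
          (u j).2.1.differentiableAt (isOpen_ball.mem_nhds (hsub hw))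
        have h4 : fderiv ℂ (u k - u m).1 w = fderiv ℂ (u k).1 w - fderiv ℂ (u m).1 w :=
          fderiv_sub (hda k) (hda m)
        rw [h4] at h2
        nlinarith [norm_nonneg (u k - u m)]
      · have := hg' w
        simpa only [indicator_of_mem (hsub hw)] using this
    exact hasFDerivAt_of_tendstoUniformlyOn isOpen_ball hunif
      (fun k w hw => ((u k).2.1.differentiableAt (isOpen_ball.mem_nhds (hsub hw))).hasFDerivAt)
      (fun w _ => hg w) (by simpa using hr)
  have hgdiff : DifferentiableOn ℂ g (ball 0 1) := fun z hz =>
    (hgd z hz).differentiableAt.differentiableWithinAt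
  have hg0 : ∀ z ∉ ball (0 : Cn n) 1, g z = 0 := by
    intro z hz
    refine tendsto_nhds_unique (hg z) ?_
    have : (fun k => (u k).1 z) = fun _ => 0 := funext fun k => (u k).2.2.1 z hz
    rw [this]
    exact tendsto_const_nhds
  have hgm : Measurable g := BergmanWeight.measurable_of_mem hgdiff hg0
  have hsmall : ∀ ε : ℝ, 0 < ε → ∃ N, ∀ k ≥ N,
      eLpNorm (fun z => g z - (u k).1 z) 2 ρ.measure ≤ ENNReal.ofReal ε := by
    intro ε hε
    rw [Metric.cauchySeq_iff] at hu
    obtain ⟨N, hN⟩ := hu ε hε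
    refine ⟨N, fun k hk => ?_⟩
    refine (Lp.eLpNorm_lim_le_liminf_eLpNorm (f := fun m z => (u m).1 z - (u k).1 z)
      (fun m => ((u m).2.2.2.1.sub (u k).2.2.2.1)) _
      (Eventually.of_forall fun z => (hg z).sub_const _)).trans ?_
    refine (liminf_le_liminf (v := fun _ => ENNReal.ofReal ε) ?_).trans (by simp)
    filter_upwards [eventually_ge_atTop N] with m hm
    have h1 := hN m hm k hk
    rw [dist_eq_norm] at h1
    have h2 : ‖u m - u k‖ₑ = eLpNorm (fun z => (u m).1 z - (u k).1 z) 2 ρ.measure :=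
      enorm_eq (u m - u k)
    rw [← h2, ← ofReal_norm]
    exact ENNReal.ofReal_le_ofReal h1.le
  have hgL : MemLp g 2 ρ.measure := by
    obtain ⟨N, hN⟩ := hsmall 1 one_pos
    have h1 : MemLp (fun z => g z - (u N).1 z) 2 ρ.measure :=
      ⟨hgm.aestronglyMeasurable.sub (u N).2.2.2.1, (hN N le_rfl).trans_lt ENNReal.ofReal_lt_top⟩
    have := h1.add (u N).2.2.2
    refine this.congr_norm hgm.aestronglyMeasurable (Eventually.of_forall fun z => ?_)
    simp
  let G : BergmanSpace ρ := ⟨g, hgdiff, hg0, hgL⟩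
  refine ⟨G, Metric.tendsto_atTop.2 fun ε hε => ?_⟩
  obtain ⟨N, hN⟩ := hsmall (ε / 2) (by positivity)
  refine ⟨N, fun k hk => ?_⟩
  have h2 : ‖G - u k‖ₑ = eLpNorm (fun z => g z - (u k).1 z) 2 ρ.measure := enorm_eq (G - u k)
  have h3 := hN k hk
  rw [← h2, ← ofReal_norm, ENNReal.ofReal_le_ofReal_iff (by positivity)] at h3
  rw [dist_comm, dist_eq_norm]
  linarith

/-- `A²_ρ` is a Hilbert space of functions with continuous point evaluations. -/
instance : RKHS ℂ (BergmanSpace ρ) (Cn n) ℂ where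
  coeCLM :=
    { toFun := fun f => f.1
      map_add' := fun _ _ => rfl
      map_smul' := fun _ _ => rfl
      cont := by
        refine continuous_pi fun z => ?_
        by_cases hz : z ∈ ball (0 : Cn n) 1
        · obtain ⟨C, -, h⟩ := exists_norm_le (ρ := ρ) (r := ‖z‖) (by simpa using hz)
          exact (LinearMap.mkContinuous
            ({ toFun := fun f => f.1 z
               map_add' := fun _ _ => rfl
               map_smul' := fun _ _ => rfl } : BergmanSpace ρ →ₗ[ℂ] ℂ) C fun f => h f z (by simp)).continuous
        · have : (fun f : BergmanSpace ρ => f.1 z) = fun _ => 0 := funext fun f => f.2.2.1 z hz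
          rw [this]
          exact continuous_const }
  coeCLM_injective := Subtype.val_injective

theorem coe_eq (f : BergmanSpace ρ) (z : Cn n) : f z = f.1 z := rfl

end BergmanSpace

namespace BergmanWeight

variable {n : ℕ} (ρ : BergmanWeight n)

/-- The class `S`: `inf_k (1 - r_k) / (1 - r_{k+1}) > 1`. -/
def InClassS : Prop :=
  1 < ⨅ k : ℕ, (1 - ρ.radius k) / (1 - ρ.radius (k + 1))

/-- `ρ*(r) = (1 - r)⁻¹ ∫_r^1 ρ(t) dt`. -/
def rhoStar (r : ℝ) : ℝ := (1 - r)⁻¹ * ρ.tail r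

/-- The class `S*`: weights in `S` with `ρ* ≲ ρ` on `(0,1)`. -/
def InClassSStar : Prop :=
  ρ.InClassS ∧ ∃ C > 0, ∀ r ∈ Ioo (0 : ℝ) 1, ρ.rhoStar r ≤ C * ρ r

/-- The index `k` with `r_k ≤ |z| < r_{k+1}`; it is `0` for `|z| < r_0`. -/
def shell (z : Cn n) : ℕ := sInf {k | ‖z‖ < ρ.radius (k + 1)}

/-- The measure `dλ_ρ = 2^k ρ(z) dv(z) / (1 - |z|)^n`, where `k` is the index of the shell
containing `z`. -/
def lambdaMeasure : Measure (Cn n) :=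
  (ballVolume n).withDensity
    (fun z => ENNReal.ofReal (2 ^ ρ.shell z * ρ ‖z‖ / (1 - ‖z‖) ^ n))

/-- The reproducing kernel `K_ρ(z, w)` of `A²_ρ`. -/
def kernel (z w : Cn n) : ℂ := RKHS.kernel (BergmanSpace ρ) z w 1

/-- The kernel function `K_z = K_ρ(·, z)` as an element of `A²_ρ`. -/
def kernelFun (z : Cn n) : BergmanSpace ρ := RKHS.kerFun (BergmanSpace ρ) z 1

/-- The normalized kernel function `k_z = K_z / ‖K_z‖`. -/
def normKernelFun (z : Cn n) : BergmanSpace ρ := (‖ρ.kernelFun z‖ : ℂ)⁻¹ • ρ.kernelFun z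

/-- `T` is the (everywhere defined, bounded) Toeplitz operator with symbol `μ`:
`T f(z) = ∫ K_ρ(z, w) f(w) dμ(w)`, the integrals being absolutely convergent. -/
def IsToeplitz (μ : Measure (Cn n)) (T : BergmanSpace ρ →L[ℂ] BergmanSpace ρ) : Prop :=
  ∀ f : BergmanSpace ρ, ∀ z ∈ ball (0 : Cn n) 1,
    Integrable (fun w => ρ.kernel z w * f w) μ ∧ T f z = ∫ w, ρ.kernel z w * f w ∂μ

/-- The Berezin transform of `T_μ`, that is `⟨T_μ k_z, k_z⟩ = ∫ |k_z|² dμ`; the integral makes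
sense whether or not `T_μ` is bounded. -/
def berezin (μ : Measure (Cn n)) (z : Cn n) : ℝ≥0∞ := ∫⁻ w, ‖ρ.normKernelFun z w‖ₑ ^ 2 ∂μ

theorem kernelFun_apply (z w : Cn n) : ρ.kernelFun z w = ρ.kernel w z :=
  RKHS.kerFun_apply (BergmanSpace ρ) z 1 w

theorem inner_kernelFun (f : BergmanSpace ρ) (z : Cn n) : inner ℂ (ρ.kernelFun z) f = f z := by
  simp [kernelFun]

theorem conj_kernel (z w : Cn n) : conj (ρ.kernel w z) = ρ.kernel z w := by
  rw [← kernelFun_apply, ← kernelFun_apply, ← inner_kernelFun, ← inner_kernelFun, inner_conj_symm]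

/-- If `T_μ` is bounded then `berezin` is the Berezin transform `⟨T_μ k_z, k_z⟩`. -/
theorem IsToeplitz.inner_normKernelFun {ρ : BergmanWeight n} {μ : Measure (Cn n)}
    {T : BergmanSpace ρ →L[ℂ] BergmanSpace ρ} (hT : ρ.IsToeplitz μ T) {z : Cn n}
    (hz : z ∈ ball (0 : Cn n) 1) :
    ρ.berezin μ z < ∞ ∧
    inner ℂ (ρ.normKernelFun z) (T (ρ.normKernelFun z)) = ((ρ.berezin μ z).toReal : ℂ) := by
  obtain ⟨hi, he⟩ := hT (ρ.normKernelFun z) z hz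
  set c : ℂ := (‖ρ.kernelFun z‖ : ℂ)⁻¹ with hc
  have hcc : conj c = c := by simp [hc]
  have hk : ∀ w, ρ.normKernelFun z w = c * ρ.kernel w z := fun w => by
    rw [← kernelFun_apply]; rfl
  have hpt : ∀ w, c * (ρ.kernel z w * ρ.normKernelFun z w) =
      ((‖ρ.normKernelFun z w‖ ^ 2 : ℝ) : ℂ) := fun w => by
    rw [Complex.ofReal_pow, ← Complex.mul_conj', hk, map_mul, hcc, conj_kernel]
    ring
  have hint : Integrable (fun w => ‖ρ.normKernelFun z w‖ ^ 2) μ := by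
    have h1 := (hi.const_mul c).norm
    refine h1.congr (Eventually.of_forall fun w => ?_)
    change ‖c * (ρ.kernel z w * ρ.normKernelFun z w)‖ = _
    rw [hpt, Complex.norm_real, Real.norm_of_nonneg (by positivity)]
  have hb : ρ.berezin μ z = ∫⁻ w, ENNReal.ofReal (‖ρ.normKernelFun z w‖ ^ 2) ∂μ := by
    refine lintegral_congr fun w => ?_
    rw [ENNReal.ofReal_pow (norm_nonneg _), ofReal_norm]
  refine ⟨?_, ?_⟩
  · rw [hb]
    exact hint.lintegral_lt_top
  · have h2 : inner ℂ (ρ.normKernelFun z) (T (ρ.normKernelFun z)) =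
        c * T (ρ.normKernelFun z) z := by
      conv_lhs => rw [normKernelFun, inner_smul_left, inner_kernelFun]
      rw [← hc, hcc]
      rfl
    rw [h2, he, ← integral_const_mul, integral_congr_ae (Eventually.of_forall hpt),
      integral_complex_ofReal, integral_eq_lintegral_of_nonneg_ae
        (Eventually.of_forall fun w => by positivity) hint.aestronglyMeasurable, hb]

end BergmanWeight

/-- The Möbius involution `φ_a` of the ball that interchanges `0` and `a`:
`φ_a(z) = (a - P z - √(1 - |a|²) (z - P z)) / (1 - ⟨z, a⟩)`, where `P` is the orthogonal
projection onto `ℂ a` (so that `φ_0(z) = -z`). -/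
def moebius {n : ℕ} (a z : Cn n) : Cn n :=
  (1 - inner ℂ a z)⁻¹ •
    (a - (inner ℂ a z / (‖a‖ : ℂ) ^ 2) • a -
      (√(1 - ‖a‖ ^ 2) : ℂ) • (z - (inner ℂ a z / (‖a‖ : ℂ) ^ 2) • a))

/-- The Bergman metric `β(z,w) = ½ log ((1 + |φ_z(w)|) / (1 - |φ_z(w)|))`. -/
def bergmanDist {n : ℕ} (z w : Cn n) : ℝ :=
  1 / 2 * Real.log ((1 + ‖moebius z w‖) / (1 - ‖moebius z w‖))

/-- The Bergman metric ball `E(z, α)`. -/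
def bergmanBall {n : ℕ} (z : Cn n) (α : ℝ) : Set (Cn n) :=
  {w | w ∈ ball (0 : Cn n) 1 ∧ bergmanDist z w < α}

/-- The averaging function `μ̂_α(z) = 2^k μ(E(z, α)) / (1 - |z|)^n`, where `k` is the index of
the shell containing `z`. -/
def BergmanWeight.average {n : ℕ} (ρ : BergmanWeight n) (μ : Measure (Cn n)) (α : ℝ) (z : Cn n) :
    ℝ :=
  2 ^ ρ.shell z * μ.real (bergmanBall z α) / (1 - ‖z‖) ^ n

/-- The Schatten class `S_p` of a Hilbert space: compact operators `T` with a singular value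
decomposition `T x = ∑ s_i ⟨x, e_i⟩ f_i`, `s_i > 0`, `(e_i)` and `(f_i)` orthonormal, such that
`∑ s_i^p < ∞`. -/
def InSchattenClass {H : Type*} [NormedAddCommGroup H] [InnerProductSpace ℂ H] (p : ℝ)
    (T : H →L[ℂ] H) : Prop :=
  IsCompactOperator T ∧ ∃ (ι : Type) (s : ι → ℝ) (e f : ι → H), (∀ i, 0 < s i) ∧
    Orthonormal ℂ e ∧ Orthonormal ℂ f ∧
    (∀ x, HasSum (fun i => ((s i : ℂ) * inner ℂ (e i) x) • f i) (T x)) ∧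
    Summable fun i => s i ^ p

end

/-! Write T(r) for the tail ∫_r^1 ρ and Q(z) = 2^k/(1-|z|)^n for `kernelSize`. Everything rests on
the comparison Q(z) ≍ ‖K_z‖² = K(z,z). Since dλ_ρ = Q ρ dv, integrating against λ_ρ amounts to
taking a trace on A²_ρ.

Class S makes T doubling, T(1-2t) ≤ D T(1-t), and 2^k ≍ 1/T(|z|). The upper bound for K(z,z) comes
from the sub-mean value property in a frame scaled by 1-|z| along z and by √(1-|z|) across it, where
ρ* ≲ ρ bounds the weight below (`exists_enorm_sq_le`). The lower bound comes from testing evaluation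
at z on (1-⟨w,z⟩)^(-N) with N large. The norm of that function is estimated dyadically, using the ρ
dv-measure of nonisotropic balls. Schwarz's lemma in the same frame then gives |k_z|² ≳ Q(z) on a
Bergman ball of fixed radius α₀ about z (`exists_le_norm_normKernelFun_sq`).

From (a) to (b): if T = ∑ s_i⟨·,e_i⟩f_i, Jensen's inequality gives |⟨T k_z,k_z⟩|^p ≤ ∑
s_i^p(|⟨e_i,k_z⟩|² + |⟨f_i,k_z⟩|²). As Q(z)|⟨g,k_z⟩|² ≲ |g(z)|², integration leaves a multiple of ∑
s_i^p.

From (b) to (c): the averaging function is pointwise at most a constant times the Berezin transform.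

From (c') to (a): integrate the sub-mean value estimate against μ and exchange the integrals. This
gives ∫|f|² dμ ≲ ∫ μ̂|f|²ρ dv. For a unit vector f, Jensen's inequality raises both sides to the
power p. Summing over an orthonormal system and using ∑|f|² ≤ K(w,w) ≲ Q(w) gives ∑ ‖Jf‖^(2p) ≲ ∫
μ̂^p dλ_ρ, where J is the embedding of A²_ρ in L²(μ). Such a uniform bound forces J to be compact
and J*J = T_μ to lie in S_p (`inSchattenClass_adjoint_comp_self`). -/

noncomputable section

/-! ### Schatten classes: sums over orthonormal systems and singular value decompositions -/

section SchattenCriterion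

variable {H G : Type*} [NormedAddCommGroup H] [InnerProductSpace ℂ H]
  [NormedAddCommGroup G] [InnerProductSpace ℂ G]

/-- The bound limits the number of orthonormal vectors with ‖J e‖ > ε. Take a system of such vectors
of greatest cardinality and let V be its span: a unit vector of Vᗮ violating the estimate could be
added to it. -/
theorem exists_finiteDimensional_norm_le_on_orthogonal {J : H →L[ℂ] G} {p M : ℝ}
    (hM : ∀ s : Finset H, Orthonormal ℂ (Subtype.val : ↥(s : Set H) → H) →
      ∑ e ∈ s, (‖J e‖ ^ 2) ^ p ≤ M) (hp : 0 < p) {ε : ℝ} (hε : 0 < ε) :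
    ∃ V : Submodule ℂ H, FiniteDimensional ℂ V ∧ ∀ x ∈ Vᗮ, ‖J x‖ ≤ ε * ‖x‖ := by
  classical
  set Q : ℕ → Prop := fun m => ∃ s : Finset H, s.card = m ∧
    Orthonormal ℂ (Subtype.val : ↥(s : Set H) → H) ∧ ∀ e ∈ s, ε < ‖J e‖ with hQ
  have hbd : ∀ m, Q m → (m : ℝ) ≤ M / (ε ^ 2) ^ p := by
    rintro m ⟨s, rfl, hs, hJ⟩
    rw [le_div_iff₀ (by positivity)]
    refine le_trans ?_ (hM s hs)
    rw [← nsmul_eq_mul]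
    refine Finset.card_nsmul_le_sum _ _ _ fun e he => ?_
    have := hJ e he
    gcongr
  have h0 : Q 0 := ⟨∅, by simp, by
    rw [orthonormal_subtype_iff_ite]; simp, by simp⟩
  set N := Nat.findGreatest Q ⌊M / (ε ^ 2) ^ p⌋₊ with hN
  obtain ⟨s, hcard, hs, hJ⟩ : Q N := Nat.findGreatest_spec (Nat.zero_le _) h0
  refine ⟨Submodule.span ℂ (s : Set H), FiniteDimensional.span_finset ℂ s, fun x hx => ?_⟩
  by_contra! hlt
  have hx0 : 0 < ‖x‖ := by
    rcases eq_or_ne x 0 with rfl | h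
    · simp at hlt
    · exact norm_pos_iff.2 h
  set u : H := (‖x‖ : ℂ)⁻¹ • x with hu
  have hun : ‖u‖ = 1 := by
    rw [hu, norm_smul, norm_inv, Complex.norm_real, norm_norm, inv_mul_cancel₀ hx0.ne']
  have huJ : ε < ‖J u‖ := by
    rw [hu, map_smul, norm_smul, norm_inv, Complex.norm_real, norm_norm, ← div_eq_inv_mul,
      lt_div_iff₀ hx0]
    exact hlt
  have huV : u ∈ (Submodule.span ℂ (s : Set H))ᗮ := Submodule.smul_mem _ _ hx
  have horth : ∀ e ∈ s, inner ℂ e u = 0 := fun e he =>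
    (Submodule.mem_orthogonal _ _).1 huV e (Submodule.subset_span he)
  have hnot : u ∉ s := by
    intro h
    have := horth u h
    rw [inner_self_eq_norm_sq_to_K, hun] at this
    simp at this
  have hQ1 : Q (N + 1) := by
    refine ⟨insert u s, by rw [Finset.card_insert_of_notMem hnot, hcard], ?_, ?_⟩
    · rw [orthonormal_subtype_iff_ite] at hs ⊢
      intro v hv w hw
      rw [Finset.coe_insert, Set.mem_insert_iff] at hv hw
      rcases hv with rfl | hv <;> rcases hw with rfl | hw
      · rw [inner_self_eq_norm_sq_to_K, hun]; simp
      · rw [← inner_conj_symm, horth w hw, if_neg]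
        · simp
        · rintro rfl; exact hnot hw
      · rw [horth v hv, if_neg]
        rintro rfl; exact hnot hv
      · exact hs v hv w hw
    · intro e he
      rcases Finset.mem_insert.1 he with rfl | he
      · exact huJ
      · exact hJ e he
  have hle : N + 1 ≤ ⌊M / (ε ^ 2) ^ p⌋₊ := Nat.le_floor (hbd _ hQ1)
  have := Nat.le_findGreatest hle hQ1
  omega

/-- With P the projection onto the finite-dimensional space of the preceding lemma, J - JP = J(1 -
P) has small norm. So J is a norm limit of finite rank operators. -/
theorem isCompactOperator_of_sum_le [CompleteSpace G] {J : H →L[ℂ] G} {p M : ℝ}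
    (hM : ∀ s : Finset H, Orthonormal ℂ (Subtype.val : ↥(s : Set H) → H) →
      ∑ e ∈ s, (‖J e‖ ^ 2) ^ p ≤ M) (hp : 0 < p) : IsCompactOperator J := by
  have hcl : IsClosed {f : H →L[ℂ] G | IsCompactOperator f} :=
    isClosed_setOfPred_isCompactOperator
  change J ∈ {f : H →L[ℂ] G | IsCompactOperator f}
  rw [← hcl.closure_eq, Metric.mem_closure_iff]
  intro ε hε
  obtain ⟨V, hV, hle⟩ := exists_finiteDimensional_norm_le_on_orthogonal hM hp (half_pos hε)
  refine ⟨(J ∘L V.subtypeL) ∘L V.orthogonalProjectionOnto, ?_, ?_⟩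
  · have : LocallyCompactSpace V := 
      have := FiniteDimensional.proper ℂ V
      inferInstance
    exact IsCompactOperator.comp_clm (f := J ∘L V.subtypeL)
      (isCompactOperator_of_locallyCompactSpace_rng (J ∘L V.subtypeL)) _
  · rw [dist_eq_norm]
    refine lt_of_le_of_lt (ContinuousLinearMap.opNorm_le_bound _ (half_pos hε).le fun x => ?_)
      (half_lt_self hε)
    have h1 : x - V.starProjection x ∈ Vᗮ := Submodule.sub_starProjection_mem_orthogonal x
    have h2 := hle _ h1
    have h3 : ‖x - V.starProjection x‖ ≤ ‖x‖ := by
      have h4 := Submodule.norm_sq_eq_add_norm_sq_starProjection x V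
      rw [Submodule.starProjection_orthogonal_val] at h4
      nlinarith [sq_nonneg ‖V.starProjection x‖, norm_nonneg x, norm_nonneg (x - V.starProjection x)]
    calc _ = ‖J (x - V.starProjection x)‖ := by
          rw [map_sub]; rfl
      _ ≤ _ := h2.trans (by gcongr)

end SchattenCriterion

/-- A compact symmetric operator is diagonal in some Hilbert basis. -/
theorem exists_hilbertBasis_eigenvectors {H : Type} [NormedAddCommGroup H]
    [InnerProductSpace ℂ H] [CompleteSpace H] {T : H →L[ℂ] H} (hT : IsCompactOperator T)
    (hs : T.IsSymmetric) :
    ∃ (ι : Type) (b : HilbertBasis ι ℂ H) (c : ι → ℂ), ∀ i, T (b i) = c i • b i := by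
  have hcl : ∀ μ : ℂ, IsClosed (Module.End.eigenspace (T : Module.End ℂ H) μ : Set H) := fun μ => by
    have : (Module.End.eigenspace (T : Module.End ℂ H) μ : Set H) = {x | T x = μ • x} := by
      ext x; simp
    rw [this]
    exact isClosed_eq T.continuous (continuous_const_smul μ)
  have hcs : ∀ μ : ℂ, CompleteSpace (Module.End.eigenspace (T : Module.End ℂ H) μ) := fun μ =>
    (hcl μ).completeSpace_coe
  choose w b hb using fun μ : ℂ =>
    exists_hilbertBasis ℂ (Module.End.eigenspace (T : Module.End ℂ H) μ)
  have hOF := hs.orthogonalFamily_eigenspaces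
  have hon := hOF.orthonormal_sigma_orthonormal (v_family := fun μ => b μ)
    (fun μ => (b μ).orthonormal)
  set v : (Σ μ, w μ) → H := fun a => (b a.1 a.2 : _) with hv
  replace hon : Orthonormal ℂ v := hon
  have hbot : (Submodule.span ℂ (Set.range v))ᗮ = ⊥ := by
    rw [eq_bot_iff, ← ContinuousLinearMap.orthogonalComplement_iSup_eigenspaces_eq_bot hT hs]
    intro x hx
    rw [Submodule.mem_orthogonal] at hx ⊢
    -- A vector orthogonal to the chosen bases is orthogonal to every eigenspace, by expanding its
    -- elements in that eigenspace's basis. The spectral theorem then makes it zero.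
    have key : (⨆ μ, Module.End.eigenspace (T : Module.End ℂ H) μ) ≤ (Submodule.span ℂ {x})ᗮ := by
      refine iSup_le fun μ y hy => ?_
      rw [Submodule.mem_orthogonal_singleton_iff_inner_right]
      have h1 := (b μ).hasSum_repr ⟨y, hy⟩
      have h2 := (h1.mapL (Submodule.subtypeL _)).mapL (innerSL ℂ x)
      simp only [Submodule.subtypeL_apply, innerSL_apply_apply, Submodule.coe_smul, inner_smul_right] at h2
      refine h2.unique ?_
      convert hasSum_zero using 2 with i
      have := hx _ (Submodule.subset_span ⟨⟨μ, i⟩, rfl⟩)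
      rw [← inner_conj_symm, this]
      simp
    intro y hy
    have := key hy
    rwa [Submodule.mem_orthogonal_singleton_iff_inner_left] at this
  refine ⟨_, HilbertBasis.mkOfOrthogonalEqBot hon hbot, fun a => a.1, fun a => ?_⟩
  rw [HilbertBasis.coe_mkOfOrthogonalEqBot]
  have := (b a.1 a.2).2
  rwa [Module.End.mem_eigenspace_iff] at this

/-- In an eigenbasis b of J*J the eigenvalues are ‖J b_i‖². The assumed bound, applied to finite
parts of that basis, is therefore the summability of their p-th powers. Indices with J b_i = 0 are
dropped because singular values are required to be positive. -/
theorem inSchattenClass_adjoint_comp_self {H G : Type} [NormedAddCommGroup H]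
    [InnerProductSpace ℂ H] [CompleteSpace H] [NormedAddCommGroup G] [InnerProductSpace ℂ G]
    [CompleteSpace G] {J : H →L[ℂ] G} {p M : ℝ} (hp : 0 < p)
    (hM : ∀ s : Finset H, Orthonormal ℂ (Subtype.val : ↥(s : Set H) → H) →
      ∑ e ∈ s, (‖J e‖ ^ 2) ^ p ≤ M) : InSchattenClass p (J.adjoint ∘L J) := by
  classical
  have hT : IsCompactOperator (J.adjoint ∘L J) :=
    (isCompactOperator_of_sum_le hM hp).clm_comp J.adjoint
  have hs : (J.adjoint ∘L J).IsSymmetric := fun x y => by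
    simp [ContinuousLinearMap.adjoint_inner_left, ContinuousLinearMap.adjoint_inner_right]
  obtain ⟨ι, b, c, hb⟩ := exists_hilbertBasis_eigenvectors hT hs
  have hc : ∀ i, c i = ((‖J (b i)‖ ^ 2 : ℝ) : ℂ) := fun i => by
    have h1 : inner ℂ (b i) ((J.adjoint ∘L J) (b i)) = c i := by
      rw [hb, inner_smul_right, inner_self_eq_norm_sq_to_K, b.orthonormal.1 i]; simp
    rw [← h1, ContinuousLinearMap.comp_apply, ContinuousLinearMap.adjoint_inner_right,
      inner_self_eq_norm_sq_to_K]
    simp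
  have hinj : Function.Injective fun i : {i // J (b i) ≠ 0} => b i :=
    b.orthonormal.linearIndependent.injective.comp Subtype.val_injective
  have hone : Orthonormal ℂ fun i : {i // J (b i) ≠ 0} => b i :=
    b.orthonormal.comp _ Subtype.val_injective
  refine ⟨hT, {i // J (b i) ≠ 0}, fun i => ‖J (b i)‖ ^ 2, fun i => b i, fun i => b i, fun i => ?_,
    hone, hone, fun x => ?_, ?_⟩
  · have := norm_pos_iff.2 i.2
    positivity
  · have h1 := (b.hasSum_repr x).mapL (J.adjoint ∘L J)
    have h2 : (fun i => (J.adjoint ∘L J) (b.repr x i • b i)) =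
        fun i => (((‖J (b i)‖ ^ 2 : ℝ) : ℂ) * inner ℂ (b i) x) • b i := by
      ext1 i
      rw [map_smul, hb, hc, b.repr_apply_apply, smul_smul, mul_comm]
    rw [h2] at h1
    have h3 : Function.support (fun i => (((‖J (b i)‖ ^ 2 : ℝ) : ℂ) * inner ℂ (b i) x) • b i) ⊆
        {i | J (b i) ≠ 0} := by
      intro i hi h
      rw [Function.mem_support] at hi
      rw [h] at hi
      simp at hi
    exact (hasSum_subtype_iff_of_support_subset h3).2 h1
  · refine summable_of_sum_le (c := M) (fun i => by positivity) fun u => ?_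
    have := hM (u.image fun i : {i // J (b i) ≠ 0} => b i) ?_
    · rwa [Finset.sum_image fun i _ j _ h => hinj h] at this
    · rw [orthonormal_subtype_iff_ite]
      intro v hv w hw
      rw [Finset.coe_image] at hv hw
      obtain ⟨i, -, rfl⟩ := hv
      obtain ⟨j, -, rfl⟩ := hw
      rw [orthonormal_iff_ite.1 hone i j]
      simp [hinj.eq_iff]

/-- The weights |⟨e_i,k⟩⟨f_i,k⟩| have total mass at most 1 by Bessel's inequality, so Jensen's
inequality moves the power p inside the sum. Bounding each weight by a sum of squares separates the
two systems. -/
theorem enorm_inner_rpow_le_tsum {H : Type*} [NormedAddCommGroup H] [InnerProductSpace ℂ H]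
    {ι : Type*} {s : ι → ℝ} {e f : ι → H} (hs : ∀ i, 0 < s i) (he : Orthonormal ℂ e)
    (hf : Orthonormal ℂ f) {k y : H} (hk : ‖k‖ ≤ 1)
    (hy : HasSum (fun i => ((s i : ℂ) * inner ℂ (e i) k) • f i) y) {p : ℝ} (hp : 1 ≤ p) :
    ‖inner ℂ k y‖ₑ ^ p ≤
      ∑' i, ENNReal.ofReal (s i ^ p) * (‖inner ℂ (e i) k‖ₑ ^ 2 + ‖inner ℂ (f i) k‖ₑ ^ 2) := by
  have hp0 : 0 < p := by linarith
  set a : ι → ℝ := fun i => ‖inner ℂ (e i) k‖ * ‖inner ℂ (f i) k‖ with ha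
  have ha0 : ∀ i, 0 ≤ a i := fun i => by positivity
  have hale : ∀ i, a i ≤ ‖inner ℂ (e i) k‖ ^ 2 + ‖inner ℂ (f i) k‖ ^ 2 := fun i => by
    simp only [ha]
    nlinarith [sq_nonneg (‖inner ℂ (e i) k‖ - ‖inner ℂ (f i) k‖), sq_nonneg ‖inner ℂ (e i) k‖,
      sq_nonneg ‖inner ℂ (f i) k‖]
  have hasum : ∀ u : Finset ι, ∑ i ∈ u, a i ≤ 1 := fun u => by
    have h1 := he.sum_inner_products_le k (s := u)
    have h2 := hf.sum_inner_products_le k (s := u)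
    have h3 : ‖k‖ ^ 2 ≤ 1 := pow_le_one₀ (norm_nonneg _) hk
    have h4 : ∑ i ∈ u, 2 * a i ≤ ∑ i ∈ u, (‖inner ℂ (e i) k‖ ^ 2 + ‖inner ℂ (f i) k‖ ^ 2) :=
      Finset.sum_le_sum fun i _ => by
        simp only [ha]
        nlinarith [sq_nonneg (‖inner ℂ (e i) k‖ - ‖inner ℂ (f i) k‖)]
    rw [Finset.sum_add_distrib, ← Finset.mul_sum] at h4
    linarith
  have hfin : ∀ u : Finset ι, (∑ i ∈ u, s i * a i) ^ p ≤ ∑ i ∈ u, s i ^ p * a i := fun u => by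
    have h1 := Real.inner_le_weight_mul_Lp_of_nonneg u hp a s ha0 fun i => (hs i).le
    have h2 : (∑ i ∈ u, a i) ^ (1 - p⁻¹) ≤ 1 :=
      Real.rpow_le_one (Finset.sum_nonneg fun i _ => ha0 i) (hasum u)
        (sub_nonneg.2 (inv_le_one_of_one_le₀ hp))
    have h3 : 0 ≤ ∑ i ∈ u, a i * s i ^ p :=
      Finset.sum_nonneg fun i _ => mul_nonneg (ha0 i) (Real.rpow_nonneg (hs i).le _)
    have h4 : ∑ i ∈ u, s i * a i ≤ (∑ i ∈ u, a i * s i ^ p) ^ p⁻¹ := by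
      simp only [mul_comm (s _)]
      exact h1.trans (mul_le_of_le_one_left (by positivity) h2)
    have h5 : 0 ≤ ∑ i ∈ u, s i * a i := Finset.sum_nonneg fun i _ => mul_nonneg (hs i).le (ha0 i)
    calc _ ≤ ((∑ i ∈ u, a i * s i ^ p) ^ p⁻¹) ^ p := by gcongr
      _ = _ := by
        rw [← Real.rpow_mul h3, inv_mul_cancel₀ hp0.ne', Real.rpow_one]
        simp only [mul_comm (a _)]
  have h1 := hy.mapL (innerSL ℂ k)
  simp only [innerSL_apply_apply, inner_smul_right] at h1
  have hten : Tendsto (fun u : Finset ι => ‖∑ i ∈ u, (s i : ℂ) * inner ℂ (e i) k * inner ℂ k (f i)‖ₑ ^ p)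
      atTop (𝓝 (‖inner ℂ k y‖ₑ ^ p)) :=
    (ENNReal.continuous_rpow_const.tendsto _).comp ((continuous_enorm.tendsto _).comp h1)
  refine le_of_tendsto hten (Eventually.of_forall fun u => ?_)
  have hn : ‖∑ i ∈ u, (s i : ℂ) * inner ℂ (e i) k * inner ℂ k (f i)‖ ≤ ∑ i ∈ u, s i * a i := by
    refine (norm_sum_le _ _).trans (le_of_eq (Finset.sum_congr rfl fun i _ => ?_))
    rw [norm_mul, norm_mul, Complex.norm_real, Real.norm_of_nonneg (hs i).le,
      norm_inner_symm k, mul_assoc]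
  calc _ = ENNReal.ofReal (‖∑ i ∈ u, (s i : ℂ) * inner ℂ (e i) k * inner ℂ k (f i)‖ ^ p) := by
        rw [← ofReal_norm, ENNReal.ofReal_rpow_of_nonneg (norm_nonneg _) hp0.le]
    _ ≤ ENNReal.ofReal (∑ i ∈ u, s i ^ p * (‖inner ℂ (e i) k‖ ^ 2 + ‖inner ℂ (f i) k‖ ^ 2)) := by
        refine ENNReal.ofReal_le_ofReal (le_trans ?_ ((hfin u).trans
          (Finset.sum_le_sum fun i _ => ?_)))
        · gcongr
        · exact mul_le_mul_of_nonneg_left (hale i) (Real.rpow_nonneg (hs i).le _)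
    _ = ∑ i ∈ u, ENNReal.ofReal (s i ^ p) *
          (‖inner ℂ (e i) k‖ₑ ^ 2 + ‖inner ℂ (f i) k‖ₑ ^ 2) := by
        rw [ENNReal.ofReal_sum_of_nonneg]
        · refine Finset.sum_congr rfl fun i _ => ?_
          rw [ENNReal.ofReal_mul (Real.rpow_nonneg (hs i).le _),
            ENNReal.ofReal_add (by positivity) (by positivity), ENNReal.ofReal_pow (norm_nonneg _),
            ENNReal.ofReal_pow (norm_nonneg _), ofReal_norm, ofReal_norm]
        · exact fun i _ => mul_nonneg (Real.rpow_nonneg (hs i).le _) (by positivity)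
    _ ≤ _ := ENNReal.sum_le_tsum u

/-! ### Tails, shells and the doubling property -/

namespace BergmanWeight

variable {n : ℕ} (ρ : BergmanWeight n)

theorem tail_eq_add {a b : ℝ} (ha : a ∈ Icc (0 : ℝ) 1) (hb : b ∈ Icc (0 : ℝ) 1) :
    ρ.tail a = (∫ x in a..b, ρ x) + ρ.tail b :=
  (intervalIntegral.integral_add_adjacent_intervals (ρ.intervalIntegrable ha hb)
    (ρ.intervalIntegrable hb (by simp))).symm

theorem tail_lt_tail {a b : ℝ} (ha : 0 ≤ a) (hab : a < b) (hb : b ≤ 1) : ρ.tail b < ρ.tail a := by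
  have ma : a ∈ Icc (0 : ℝ) 1 := ⟨ha, hab.le.trans hb⟩
  have mb : b ∈ Icc (0 : ℝ) 1 := ⟨ha.trans hab.le, hb⟩
  have h2 : 0 < ∫ x in a..b, ρ x :=
    intervalIntegral.intervalIntegral_pos_of_pos_on (ρ.intervalIntegrable ma mb)
      (fun x hx => ρ.pos x ⟨ha.trans hx.1.le, hx.2.trans_le hb⟩) hab
  rw [ρ.tail_eq_add ma mb]
  linarith

theorem tail_anti {a b : ℝ} (ha : 0 ≤ a) (hab : a ≤ b) (hb : b ≤ 1) : ρ.tail b ≤ ρ.tail a := by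
  rcases hab.eq_or_lt with rfl | h
  · exact le_rfl
  · exact (ρ.tail_lt_tail ha h hb).le

theorem lt_of_tail_lt {a b : ℝ} (ha : a ≤ 1) (hb : 0 ≤ b) (h : ρ.tail b < ρ.tail a) : a < b := by
  by_contra! hle
  exact absurd (ρ.tail_anti hb hle ha) (not_le.2 h)

theorem tail_pos {r : ℝ} (h0 : 0 ≤ r) (h1 : r < 1) : 0 < ρ.tail r := by
  have := ρ.tail_lt_tail h0 h1 le_rfl
  rwa [show ρ.tail 1 = 0 by simp [tail]] at this

theorem one_le_tail_zero : 1 ≤ ρ.tail 0 := by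
  have h := ρ.radius_spec 0
  have := ρ.tail_anti le_rfl h.1.1 h.1.2.le
  rwa [h.2, pow_zero] at this

theorem exists_lt_radius {r : ℝ} (h0 : 0 ≤ r) (h1 : r < 1) : ∃ k, r < ρ.radius (k + 1) := by
  obtain ⟨k, hk⟩ := exists_pow_lt_of_lt_one (ρ.tail_pos h0 h1) (y := (1 / 2 : ℝ)) (by norm_num)
  refine ⟨k, ρ.lt_of_tail_lt h1.le (ρ.radius_spec _).1.1 ?_⟩
  rw [(ρ.radius_spec _).2]
  exact lt_of_le_of_lt (pow_le_pow_of_le_one (by norm_num) (by norm_num) (Nat.le_succ k)) hk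

theorem norm_lt_radius_shell {z : Cn n} (hz : ‖z‖ < 1) : ‖z‖ < ρ.radius (ρ.shell z + 1) :=
  Nat.sInf_mem (s := {k | ‖z‖ < ρ.radius (k + 1)}) (ρ.exists_lt_radius (norm_nonneg z) hz)

theorem radius_shell_le {z : Cn n} (h : ρ.shell z ≠ 0) : ρ.radius (ρ.shell z) ≤ ‖z‖ := by
  obtain ⟨k, hk⟩ := Nat.exists_eq_succ_of_ne_zero h
  have : k ∉ {k | ‖z‖ < ρ.radius (k + 1)} := Nat.notMem_of_lt_sInf (by
    change k < ρ.shell z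
    omega)
  rw [hk]
  exact not_lt.1 this

theorem half_pow_shell_lt {z : Cn n} (hz : ‖z‖ < 1) : (1 / 2) ^ (ρ.shell z + 1) < ρ.tail ‖z‖ := by
  have h := ρ.radius_spec (ρ.shell z + 1)
  rw [← h.2]
  exact ρ.tail_lt_tail (norm_nonneg z) (ρ.norm_lt_radius_shell hz) h.1.2.le

theorem tail_le_half_pow_shell {z : Cn n} (hz : ‖z‖ < 1) (h : ρ.shell z ≠ 0) :
    ρ.tail ‖z‖ ≤ (1 / 2) ^ ρ.shell z := by
  rw [← (ρ.radius_spec (ρ.shell z)).2]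
  exact ρ.tail_anti (ρ.radius_spec _).1.1 (ρ.radius_shell_le h) hz.le

/-- Together with `inv_tail_le` this gives 2^k ≍ 1/T(|z|). The factor T(0) ≥ 1 pays for |z| < r_0,
where the index is 0 although the tail exceeds 1. -/
theorem two_pow_shell_le {z : Cn n} (hz : ‖z‖ < 1) :
    2 ^ ρ.shell z ≤ ρ.tail 0 / ρ.tail ‖z‖ := by
  rw [le_div_iff₀ (ρ.tail_pos (norm_nonneg z) hz)]
  by_cases h : ρ.shell z = 0
  · rw [h, pow_zero, one_mul]
    exact ρ.tail_anti le_rfl (norm_nonneg z) hz.le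
  · have h1 := ρ.tail_le_half_pow_shell hz h
    calc (2 : ℝ) ^ ρ.shell z * ρ.tail ‖z‖ ≤ 2 ^ ρ.shell z * (1 / 2) ^ ρ.shell z := by gcongr
      _ = 1 := by rw [← mul_pow]; norm_num
      _ ≤ _ := ρ.one_le_tail_zero

theorem inv_tail_le {z : Cn n} (hz : ‖z‖ < 1) : (ρ.tail ‖z‖)⁻¹ ≤ 2 * 2 ^ ρ.shell z := by
  have h := ρ.half_pow_shell_lt hz
  rw [inv_le_comm₀ (ρ.tail_pos (norm_nonneg z) hz) (by positivity)]
  refine le_trans (le_of_eq ?_) h.le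
  rw [one_div, inv_pow, pow_succ, mul_comm]

variable {ρ}

/-- The distances 1 - r_k decay at least like q^(-k) with q > 1. Doubling the distance to the sphere
thus moves back only a bounded number of shells, and each shell costs a factor 2 in the tail. -/
theorem InClassS.exists_tail_doubling (h : ρ.InClassS) : ∃ D : ℝ, 1 ≤ D ∧ ∀ t : ℝ, 0 < t →
    ρ.tail (max 0 (1 - 2 * t)) ≤ D * ρ.tail (max 0 (1 - t)) := by
  set q := ⨅ k : ℕ, (1 - ρ.radius k) / (1 - ρ.radius (k + 1)) with hq
  have hq1 : 1 < q := h
  have hr : ∀ k, 0 < 1 - ρ.radius k := fun k => sub_pos.2 (ρ.radius_spec k).1.2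
  have hstep : ∀ k, q * (1 - ρ.radius (k + 1)) ≤ 1 - ρ.radius k := fun k => by
    rw [← le_div_iff₀ (hr _)]
    refine ciInf_le (f := fun k : ℕ => (1 - ρ.radius k) / (1 - ρ.radius (k + 1))) ⟨0, ?_⟩ k
    rintro _ ⟨k, rfl⟩
    exact div_nonneg (hr _).le (hr _).le
  have hiter : ∀ j k, q ^ j * (1 - ρ.radius (k + j)) ≤ 1 - ρ.radius k := by
    intro j k
    induction j with
    | zero => simp
    | succ j ih =>
      refine le_trans ?_ ih
      rw [pow_succ, mul_assoc]
      exact mul_le_mul_of_nonneg_left (hstep (k + j)) (by positivity)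
  obtain ⟨j, hj⟩ := pow_unbounded_of_one_lt 2 hq1
  have hT0 := ρ.one_le_tail_zero
  have h2j : (1 : ℝ) ≤ 2 ^ (j + 1) := one_le_pow₀ (by norm_num)
  have hD : 1 ≤ ρ.tail 0 * 2 ^ (j + 1) := by nlinarith
  refine ⟨ρ.tail 0 * 2 ^ (j + 1), hD, fun t ht => ?_⟩
  rcases le_or_gt 1 t with ht1 | ht1
  · rw [max_eq_left (by linarith), max_eq_left (by linarith)]
    nlinarith
  have hrange : (0 : ℝ) ≤ max 0 (1 - 2 * t) := le_max_left _ _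
  have hlt : max 0 (1 - 2 * t) ≤ (1 : ℝ) := max_le zero_le_one (by linarith)
  rw [max_eq_right (a := 0) (b := 1 - t) (by linarith)]
  have hTt : 0 < ρ.tail (1 - t) := ρ.tail_pos (by linarith) (by linarith)
  have hex := ρ.exists_lt_radius (r := 1 - t) (by linarith) (by linarith)
  classical
  set k := Nat.find hex with hk
  have hk1 : 1 - t < ρ.radius (k + 1) := Nat.find_spec hex
  have hk2 : (1 / 2 : ℝ) ^ (k + 1) < ρ.tail (1 - t) := by
    rw [← (ρ.radius_spec (k + 1)).2]
    exact ρ.tail_lt_tail (by linarith) hk1 (ρ.radius_spec _).1.2.le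
  -- In the first j shells there is no room to go back j steps, but there the tail is bounded below
  -- and can be compared with T(0).
  rcases lt_or_ge k j with hkj | hkj
  · have h1 : (1 / 2 : ℝ) ^ (j + 1) ≤ ρ.tail (1 - t) :=
      (pow_le_pow_of_le_one (by norm_num) (by norm_num) (by omega)).trans hk2.le
    have h2 : 1 ≤ 2 ^ (j + 1) * ρ.tail (1 - t) := by
      calc (1 : ℝ) = 2 ^ (j + 1) * (1 / 2) ^ (j + 1) := by rw [← mul_pow]; norm_num
        _ ≤ _ := by gcongr
    calc ρ.tail (max 0 (1 - 2 * t)) ≤ ρ.tail 0 := ρ.tail_anti le_rfl hrange hlt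
      _ ≤ ρ.tail 0 * (2 ^ (j + 1) * ρ.tail (1 - t)) := le_mul_of_one_le_right (by linarith) h2
      _ = _ := by ring
  · obtain ⟨m, hm⟩ := Nat.exists_eq_add_of_le' hkj
    have hj0 : j ≠ 0 := by rintro rfl; norm_num at hj
    have hk3 : ρ.radius k ≤ 1 - t := by
      obtain ⟨i, hi⟩ := Nat.exists_eq_succ_of_ne_zero (show k ≠ 0 by omega)
      have := Nat.find_min hex (m := i) (by rw [← hk]; omega)
      rw [hi]
      exact not_lt.1 this
    have h1 : ρ.radius m ≤ 1 - 2 * t := by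
      have h2 := hiter j m
      rw [← hm] at h2
      have h3 : 2 * t ≤ q ^ j * (1 - ρ.radius k) := by
        have : t ≤ 1 - ρ.radius k := by linarith
        nlinarith
      linarith
    have h4 : ρ.tail (max 0 (1 - 2 * t)) ≤ (1 / 2) ^ m := by
      rw [← (ρ.radius_spec m).2]
      exact ρ.tail_anti (ρ.radius_spec m).1.1 (h1.trans (le_max_right _ _)) hlt
    calc _ ≤ (1 / 2 : ℝ) ^ m := h4
      _ = 2 ^ (j + 1) * (1 / 2) ^ (k + 1) := by
        rw [hm, show m + j + 1 = m + (j + 1) by ring, pow_add (1 / 2 : ℝ) m, mul_left_comm, ← mul_pow]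
        norm_num
      _ ≤ 2 ^ (j + 1) * ρ.tail (1 - t) := by gcongr
      _ ≤ ρ.tail 0 * (2 ^ (j + 1) * ρ.tail (1 - t)) :=
        le_mul_of_one_le_left (by positivity) hT0
      _ = _ := by ring

/-- The defining inequality is assumed on (0,1) only. Enlarging the constant includes the centre. -/
theorem InClassSStar.exists_tail_le (h : ρ.InClassSStar) : ∃ C : ℝ, 0 < C ∧
    ∀ r ∈ Ico (0 : ℝ) 1, ρ.tail r ≤ C * ((1 - r) * ρ r) := by
  obtain ⟨C, hC, hle⟩ := h.2
  have h0 : 0 < ρ 0 := ρ.pos 0 (by simp)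
  refine ⟨max C (ρ.tail 0 / ρ 0), lt_max_of_lt_left hC, fun r hr => ?_⟩
  rcases hr.1.eq_or_lt with rfl | hr0
  · rw [sub_zero, one_mul, ← div_le_iff₀ h0]
    exact le_max_right _ _
  · have h1 : 0 < 1 - r := by linarith [hr.2]
    have h2 := hle r ⟨hr0, hr.2⟩
    rw [rhoStar, inv_mul_le_iff₀ h1] at h2
    calc ρ.tail r ≤ C * ((1 - r) * ρ r) := by linarith
      _ ≤ _ := mul_le_mul_of_nonneg_right (le_max_left _ _)
        (mul_nonneg h1.le (ρ.pos r hr).le)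

variable (ρ) in
/-- The size `2^k / (1 - |z|)^n` of the reproducing kernel at `z`, `k` the index of the shell. -/
def kernelSize (z : Cn n) : ℝ := 2 ^ ρ.shell z / (1 - ‖z‖) ^ n

theorem kernelSize_pos {z : Cn n} (hz : ‖z‖ < 1) : 0 < ρ.kernelSize z := by
  have : 0 < 1 - ‖z‖ := by linarith
  rw [kernelSize]; positivity

theorem InClassS.exists_tail_norm_le (h : ρ.InClassS) : ∃ D : ℝ, 1 ≤ D ∧ ∀ z w : Cn n,
    ‖z‖ < 1 → ‖w‖ < 1 → 1 - ‖z‖ ≤ 2 * (1 - ‖w‖) → ρ.tail ‖z‖ ≤ D * ρ.tail ‖w‖ := by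
  obtain ⟨D, hD, hd⟩ := h.exists_tail_doubling
  refine ⟨D, hD, fun z w hz hw hzw => ?_⟩
  have h1 := hd (1 - ‖w‖) (by linarith)
  rw [sub_sub_cancel, max_eq_right (norm_nonneg w)] at h1
  refine le_trans (ρ.tail_anti (le_max_left _ _) (max_le (norm_nonneg z) (by linarith)) hz.le) h1

/-- Doubling of the tail transfers to 2^k because 2^k ≍ 1/T. The hypothesis is one-sided, so points
at comparable distance from the sphere get both inequalities. -/
theorem InClassS.exists_kernelSize_le (h : ρ.InClassS) : ∃ C : ℝ, 0 < C ∧ ∀ z w : Cn n,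
    ‖z‖ < 1 → ‖w‖ < 1 → 1 - ‖z‖ ≤ 2 * (1 - ‖w‖) → ρ.kernelSize w ≤ C * ρ.kernelSize z := by
  obtain ⟨D, hD, hd⟩ := h.exists_tail_norm_le
  have hT0 := ρ.one_le_tail_zero
  refine ⟨2 ^ n * (ρ.tail 0 * D * 2), by positivity, fun z w hz hw hzw => ?_⟩
  have h1 : 0 < 1 - ‖z‖ := by linarith
  have h2 : 0 < 1 - ‖w‖ := by linarith
  have hTz := ρ.tail_pos (norm_nonneg z) hz
  have hTw := ρ.tail_pos (norm_nonneg w) hw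
  have h3 : (2 : ℝ) ^ ρ.shell w ≤ ρ.tail 0 * D * 2 * 2 ^ ρ.shell z := by
    calc (2 : ℝ) ^ ρ.shell w ≤ ρ.tail 0 / ρ.tail ‖w‖ := ρ.two_pow_shell_le hw
      _ ≤ ρ.tail 0 * (D * (ρ.tail ‖z‖)⁻¹) := by
        rw [div_eq_mul_inv]
        gcongr
        rw [inv_le_iff_one_le_mul₀ hTw, mul_right_comm, ← div_eq_mul_inv, one_le_div hTz]
        exact hd z w hz hw hzw
      _ ≤ ρ.tail 0 * (D * (2 * 2 ^ ρ.shell z)) := by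
        gcongr
        exact ρ.inv_tail_le hz
      _ = _ := by ring
  have h4 : (1 - ‖z‖) ^ n ≤ 2 ^ n * (1 - ‖w‖) ^ n := by
    rw [← mul_pow]
    gcongr
  rw [kernelSize, kernelSize, div_le_iff₀ (by positivity)]
  calc (2 : ℝ) ^ ρ.shell w ≤ ρ.tail 0 * D * 2 * 2 ^ ρ.shell z := h3
    _ = ρ.tail 0 * D * 2 * 2 ^ ρ.shell z / (1 - ‖z‖) ^ n * (1 - ‖z‖) ^ n := by
      field_simp
    _ ≤ ρ.tail 0 * D * 2 * 2 ^ ρ.shell z / (1 - ‖z‖) ^ n * (2 ^ n * (1 - ‖w‖) ^ n) := by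
      gcongr
    _ = _ := by ring

end BergmanWeight

/-! ### Anisotropic dilations -/

section Dilation

variable {n : ℕ}

/-- At the origin any unit vector serves. Working with e and ‖z‖ keeps later formulas free of a
division by ‖z‖. -/
theorem exists_unit_smul_eq (hn : 1 ≤ n) (z : Cn n) : ∃ e : Cn n, ‖e‖ = 1 ∧ z = (‖z‖ : ℂ) • e := by
  rcases eq_or_ne z 0 with rfl | hz
  · exact ⟨EuclideanSpace.single ⟨0, hn⟩ 1, by simp, by simp⟩
  · have h : ‖z‖ ≠ 0 := norm_ne_zero_iff.2 hz
    refine ⟨(‖z‖ : ℂ)⁻¹ • z, ?_, ?_⟩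
    · rw [norm_smul, norm_inv, Complex.norm_real, norm_norm, inv_mul_cancel₀ h]
    · rw [smul_smul, mul_inv_cancel₀ (by exact_mod_cast h), one_smul]

theorem norm_sub_inner_smul_sq {e : Cn n} (he : ‖e‖ = 1) (x : Cn n) :
    ‖x - inner ℂ e x • e‖ ^ 2 = ‖x‖ ^ 2 - ‖inner ℂ e x‖ ^ 2 := by
  have h := norm_sub_sq (𝕜 := ℂ) x (inner ℂ e x • e)
  rw [inner_smul_right, ← inner_conj_symm x e, RCLike.mul_conj, norm_smul, he] at h
  have h2 : RCLike.re (((‖inner ℂ e x‖ : ℝ) : ℂ) ^ 2) = ‖inner ℂ e x‖ ^ 2 := by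
    rw [← Complex.ofReal_pow]; exact Complex.ofReal_re _
  erw [h2] at h
  rw [h]; ring

theorem inner_sub_inner_smul {e : Cn n} (he : ‖e‖ = 1) (x : Cn n) :
    inner ℂ e (x - inner ℂ e x • e) = 0 := by
  rw [inner_sub_right, inner_smul_right, inner_self_eq_norm_sq_to_K, he]
  simp

theorem norm_smul_add_sq {e : Cn n} (he : ‖e‖ = 1) (a b : ℂ) {v : Cn n} (hv : inner ℂ e v = 0) :
    ‖a • e + b • v‖ ^ 2 = ‖a‖ ^ 2 + ‖b‖ ^ 2 * ‖v‖ ^ 2 := by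
  have h := norm_add_sq (𝕜 := ℂ) (a • e) (b • v)
  rw [inner_smul_right, inner_smul_left, hv, norm_smul, norm_smul, he] at h
  simp at h
  rw [h]; ring

/-- The linear map with eigenvalue `a` on `ℂ e` and `b` on its orthogonal complement. -/
def dilation (e : Cn n) (a b : ℂ) : Cn n →L[ℂ] Cn n :=
  b • ContinuousLinearMap.id ℂ (Cn n) + (a - b) • (innerSL ℂ e).smulRight e

theorem dilation_apply (e : Cn n) (a b : ℂ) (x : Cn n) :
    dilation e a b x = (a * inner ℂ e x) • e + b • (x - inner ℂ e x • e) := by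
  simp only [dilation, add_apply, smul_apply,
    ContinuousLinearMap.id_apply, ContinuousLinearMap.smulRight_apply, innerSL_apply_apply]
  module

theorem inner_dilation {e : Cn n} (he : ‖e‖ = 1) (a b : ℂ) (x : Cn n) :
    inner ℂ e (dilation e a b x) = a * inner ℂ e x := by
  rw [dilation_apply, inner_add_right, inner_smul_right, inner_smul_right,
    inner_sub_inner_smul he, inner_self_eq_norm_sq_to_K, he]
  simp

theorem dilation_sub_inner_smul {e : Cn n} (he : ‖e‖ = 1) (a b : ℂ) (x : Cn n) :
    dilation e a b x - inner ℂ e (dilation e a b x) • e = b • (x - inner ℂ e x • e) := by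
  rw [inner_dilation he, dilation_apply]
  abel

theorem dilation_dilation {e : Cn n} (he : ‖e‖ = 1) (a b a' b' : ℂ) (x : Cn n) :
    dilation e a b (dilation e a' b' x) = dilation e (a * a') (b * b') x := by
  rw [dilation_apply e a b, dilation_sub_inner_smul he, inner_dilation he, dilation_apply,
    smul_smul, mul_assoc]

theorem dilation_one (e x : Cn n) : dilation e 1 1 x = x := by
  rw [dilation_apply]; module

theorem det_dilation (hn : 1 ≤ n) {e : Cn n} (he : ‖e‖ = 1) (a b : ℂ) :
    LinearMap.det (dilation e a b : Cn n →ₗ[ℂ] Cn n) = a * b ^ (n - 1) := by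
  obtain ⟨m, rfl⟩ := Nat.exists_eq_add_of_le' hn
  obtain ⟨B, hB⟩ := Orthonormal.exists_orthonormalBasis_extension_of_card_eq (𝕜 := ℂ)
    (E := Cn (m + 1)) (ι := Fin (m + 1)) (by simp) (v := fun _ => e) (s := {0}) (by
      rw [orthonormal_iff_ite]
      rintro ⟨i, hi⟩ ⟨j, hj⟩
      rw [mem_singleton_iff] at hi hj
      subst hi; subst hj
      simp [he])
  have hB0 : B 0 = e := hB 0 rfl
  have hval : ∀ j, dilation e a b (B j) = (if j = 0 then a else b) • B j := by
    intro j
    rw [dilation_apply, ← hB0, orthonormal_iff_ite.1 B.orthonormal]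
    by_cases h : j = 0
    · subst h; simp
    · rw [if_neg (Ne.symm h), if_neg h]; simp
  rw [← LinearMap.det_toMatrix B.toBasis]
  have hM : LinearMap.toMatrix B.toBasis B.toBasis (dilation e a b : Cn (m+1) →ₗ[ℂ] Cn (m+1)) =
      Matrix.diagonal fun j => if j = 0 then a else b := by
    ext i j
    rw [LinearMap.toMatrix_apply, OrthonormalBasis.coe_toBasis, ContinuousLinearMap.coe_coe, hval,
      OrthonormalBasis.coe_toBasis_repr_apply, map_smul, OrthonormalBasis.repr_self]
    by_cases h : i = j
    · subst h; split_ifs <;> simp [*]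
    · rw [Matrix.diagonal_apply_ne _ h]
      split_ifs <;> simp [h]
  rw [hM, Matrix.det_diagonal, Fin.prod_univ_succ]
  simp

/-- The real determinant is the squared modulus of the complex one: t² from the direction e and t
from each of the n - 1 orthogonal directions. -/
theorem map_dilation_volume (hn : 1 ≤ n) {e : Cn n} (he : ‖e‖ = 1) {t : ℝ} (ht : 0 < t) :
    (volume : Measure (Cn n)).map (dilation e t (√t : ℝ)) =
      ENNReal.ofReal ((t ^ (n + 1))⁻¹) • volume := by
  have hdet : LinearMap.det ((dilation e t (√t : ℝ) : Cn n →ₗ[ℂ] Cn n).restrictScalars ℝ) =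
      t ^ (n + 1) := by
    rw [LinearMap.det_restrictScalars, det_dilation hn he, Algebra.norm_complex_apply,
      Complex.normSq_eq_norm_sq, norm_mul, norm_pow, Complex.norm_real, Complex.norm_real,
      Real.norm_of_nonneg ht.le, Real.norm_of_nonneg (Real.sqrt_nonneg t), mul_pow, ← pow_mul,
      mul_comm (n - 1), pow_mul, Real.sq_sqrt ht.le, ← pow_add]
    congr 1
    omega
  have h := Measure.map_linearMap_addHaar_eq_smul_addHaar (volume : Measure (Cn n))
    (f := (dilation e t (√t : ℝ) : Cn n →ₗ[ℂ] Cn n).restrictScalars ℝ)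
    (by rw [hdet]; positivity)
  rw [hdet, abs_of_pos (by positivity)] at h
  exact h

end Dilation

/-! ### The Möbius involutions and the frame adapted to the Bergman metric -/

section Moebius

variable {n : ℕ}

theorem moebius_smul {e : Cn n} (he : ‖e‖ = 1) (r : ℝ) (w : Cn n) :
    moebius ((r : ℂ) • e) w = (1 - r * inner ℂ e w)⁻¹ •
      ((r - inner ℂ e w) • e - (√(1 - r ^ 2) : ℂ) • (w - inner ℂ e w • e)) := by
  have h1 : inner ℂ ((r : ℂ) • e) w = r * inner ℂ e w := by
    rw [inner_smul_left, Complex.conj_ofReal]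
  have h2 : ‖(r : ℂ) • e‖ ^ 2 = r ^ 2 := by
    rw [norm_smul, he, mul_one, Complex.norm_real, Real.norm_eq_abs, sq_abs]
  have h3 : ((‖(r : ℂ) • e‖ : ℝ) : ℂ) ^ 2 = (r : ℂ) ^ 2 := by
    rw [← Complex.ofReal_pow, h2, Complex.ofReal_pow]
  rw [moebius, h1, h2, h3]
  rcases eq_or_ne r 0 with rfl | hr
  · simp
    abel
  · have hr' : (r : ℂ) ≠ 0 := by exact_mod_cast hr
    have h4 : (r * inner ℂ e w / (r : ℂ) ^ 2) • (r : ℂ) • e = inner ℂ e w • e := by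
      rw [smul_smul]; congr 1; field_simp
    rw [h4, sub_smul]

theorem norm_moebius_smul_sq {e : Cn n} (he : ‖e‖ = 1) {r : ℝ} (hr : r ^ 2 ≤ 1) (w : Cn n) :
    ‖moebius ((r : ℂ) • e) w‖ ^ 2 = (‖(r : ℂ) - inner ℂ e w‖ ^ 2 +
      (1 - r ^ 2) * ‖w - inner ℂ e w • e‖ ^ 2) / ‖1 - r * inner ℂ e w‖ ^ 2 := by
  rw [moebius_smul he, norm_smul, mul_pow, norm_inv,
    sub_eq_add_neg (_ • e), ← neg_smul,
    norm_smul_add_sq he _ _ (inner_sub_inner_smul he w), norm_neg, Complex.norm_real,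
    Real.norm_of_nonneg (Real.sqrt_nonneg _), Real.sq_sqrt (by linarith)]
  rw [inv_pow, div_eq_inv_mul]

theorem norm_inner_lt_one {z w : Cn n} (hz : ‖z‖ < 1) (hw : ‖w‖ < 1) : ‖inner ℂ z w‖ < 1 :=
  lt_of_le_of_lt (norm_inner_le_norm (𝕜 := ℂ) z w) (by nlinarith [norm_nonneg z, norm_nonneg w])

theorem norm_one_sub_inner_pos {z w : Cn n} (hz : ‖z‖ < 1) (hw : ‖w‖ < 1) :
    0 < ‖1 - inner ℂ z w‖ := by
  refine norm_pos_iff.2 fun h => ?_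
  have := norm_inner_lt_one hz hw
  rw [← sub_eq_zero.1 h] at this
  simp at this

/-- The classical identity, from which both the symmetry of the Bergman metric and ‖φ_z(w)‖ < 1 are
read off. -/
theorem one_sub_norm_moebius_sq (hn : 1 ≤ n) {z w : Cn n} (hz : ‖z‖ < 1) (hw : ‖w‖ < 1) :
    1 - ‖moebius z w‖ ^ 2 = (1 - ‖z‖ ^ 2) * (1 - ‖w‖ ^ 2) / ‖1 - inner ℂ z w‖ ^ 2 := by
  have hpos := norm_one_sub_inner_pos hz hw
  obtain ⟨e, he, hze⟩ := exists_unit_smul_eq hn z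
  set r := ‖z‖ with hr
  have hr0 : 0 ≤ r := norm_nonneg z
  have h1 : inner ℂ z w = r * inner ℂ e w := by
    rw [hze, inner_smul_left, Complex.conj_ofReal]
  rw [h1] at hpos ⊢
  rw [hze, norm_moebius_smul_sq he (by nlinarith), eq_div_iff (by positivity), sub_mul,
    div_mul_cancel₀ _ (by positivity), norm_sub_inner_smul_sq he]
  have h2 : ∀ c : ℂ, ‖1 - r * c‖ ^ 2 = 1 - 2 * r * c.re + r ^ 2 * ‖c‖ ^ 2 := fun c => by
    rw [← Complex.normSq_eq_norm_sq, ← Complex.normSq_eq_norm_sq, Complex.normSq_apply,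
      Complex.normSq_apply]
    simp
    ring
  have h3 : ∀ c : ℂ, ‖(r : ℂ) - c‖ ^ 2 = r ^ 2 - 2 * r * c.re + ‖c‖ ^ 2 := fun c => by
    rw [← Complex.normSq_eq_norm_sq, ← Complex.normSq_eq_norm_sq, Complex.normSq_apply,
      Complex.normSq_apply]
    simp
    ring
  rw [h2, h3]
  ring

theorem norm_moebius_comm (hn : 1 ≤ n) {z w : Cn n} (hz : ‖z‖ < 1) (hw : ‖w‖ < 1) :
    ‖moebius z w‖ = ‖moebius w z‖ := by
  have h1 := one_sub_norm_moebius_sq hn hz hw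
  have h2 := one_sub_norm_moebius_sq hn hw hz
  have h3 : ‖1 - inner ℂ z w‖ = ‖1 - inner ℂ w z‖ := by
    rw [← inner_conj_symm z w, ← RCLike.norm_conj]
    simp
  rw [h3, mul_comm (1 - ‖z‖ ^ 2), ← h2] at h1
  have : ‖moebius z w‖ ^ 2 = ‖moebius w z‖ ^ 2 := by linarith
  exact (pow_left_inj₀ (norm_nonneg _) (norm_nonneg _) two_ne_zero).1 this

theorem norm_moebius_lt_one (hn : 1 ≤ n) {z w : Cn n} (hz : ‖z‖ < 1) (hw : ‖w‖ < 1) :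
    ‖moebius z w‖ < 1 := by
  have h1 := one_sub_norm_moebius_sq hn hz hw
  have hpos := norm_one_sub_inner_pos hz hw
  have h2 : 0 < (1 - ‖z‖ ^ 2) * (1 - ‖w‖ ^ 2) / ‖1 - inner ℂ z w‖ ^ 2 := by
    have : 0 < 1 - ‖z‖ ^ 2 := by nlinarith [norm_nonneg z]
    have : 0 < 1 - ‖w‖ ^ 2 := by nlinarith [norm_nonneg w]
    positivity
  nlinarith [norm_nonneg (moebius z w)]

theorem half_log_lt_half_log_iff {x y : ℝ} (hx0 : 0 ≤ x) (hx : x < 1) (hy0 : 0 ≤ y) (hy : y < 1) :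
    1 / 2 * Real.log ((1 + x) / (1 - x)) < 1 / 2 * Real.log ((1 + y) / (1 - y)) ↔ x < y := by
  have h1 : 0 < 1 - x := by linarith
  have h2 : 0 < 1 - y := by linarith
  rw [mul_lt_mul_iff_right₀ (by norm_num), Real.log_lt_log_iff (by positivity) (by positivity),
    div_lt_div_iff₀ h1 h2]
  constructor <;> intro h <;> nlinarith

theorem exists_half_log_eq {α : ℝ} (hα : 0 < α) :
    ∃ τ ∈ Ioo (0 : ℝ) 1, 1 / 2 * Real.log ((1 + τ) / (1 - τ)) = α := by
  have h1 : 1 < Real.exp (2 * α) := Real.one_lt_exp_iff.2 (by linarith)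
  have h2 : 0 < Real.exp (2 * α) + 1 := by linarith
  -- This is tanh α.
  refine ⟨(Real.exp (2 * α) - 1) / (Real.exp (2 * α) + 1), ⟨by
    apply div_pos <;> linarith, by rw [div_lt_one h2]; linarith⟩, ?_⟩
  have h3 : (1 + (Real.exp (2 * α) - 1) / (Real.exp (2 * α) + 1)) /
      (1 - (Real.exp (2 * α) - 1) / (Real.exp (2 * α) + 1)) = Real.exp (2 * α) := by
    field_simp
    ring
  rw [h3, Real.log_exp]
  ring

theorem mem_bergmanBall_iff (hn : 1 ≤ n) {τ : ℝ} (hτ : τ ∈ Ioo (0 : ℝ) 1) {z : Cn n} (hz : ‖z‖ < 1)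
    (w : Cn n) : w ∈ bergmanBall z (1 / 2 * Real.log ((1 + τ) / (1 - τ))) ↔
      ‖w‖ < 1 ∧ ‖moebius z w‖ < τ := by
  rw [bergmanBall, mem_ofPred_eq, mem_ball_zero_iff, bergmanDist]
  refine and_congr_right fun hw => ?_
  rw [half_log_lt_half_log_iff (norm_nonneg _) (norm_moebius_lt_one hn hz hw) hτ.1.le hτ.2]

theorem mem_bergmanBall_comm (hn : 1 ≤ n) {α : ℝ} {z w : Cn n} (hz : ‖z‖ < 1) (hw : ‖w‖ < 1) :
    w ∈ bergmanBall z α ↔ z ∈ bergmanBall w α := by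
  rw [bergmanBall, bergmanBall, mem_ofPred_eq, mem_ofPred_eq, mem_ball_zero_iff, mem_ball_zero_iff,
    bergmanDist, bergmanDist, norm_moebius_comm hn hz hw]
  simp [hz, hw]

/-- The point with coordinates `x` in the frame at `r • e` adapted to the Bergman metric. -/
def nearPoint (e : Cn n) (r : ℝ) (x : Cn n) : Cn n :=
  (r : ℂ) • e + dilation e ((1 - r : ℝ) : ℂ) (√(1 - r) : ℝ) x

theorem inner_nearPoint {e : Cn n} (he : ‖e‖ = 1) (r : ℝ) (x : Cn n) :
    inner ℂ e (nearPoint e r x) = r + ((1 - r : ℝ) : ℂ) * inner ℂ e x := by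
  rw [nearPoint, inner_add_right, inner_smul_right, inner_dilation he, inner_self_eq_norm_sq_to_K,
    he]
  simp

theorem nearPoint_sub {e : Cn n} (he : ‖e‖ = 1) (r : ℝ) (x : Cn n) :
    nearPoint e r x - inner ℂ e (nearPoint e r x) • e =
      ((√(1 - r) : ℝ) : ℂ) • (x - inner ℂ e x • e) := by
  rw [inner_nearPoint he, nearPoint, dilation_apply]
  module

theorem norm_sub_nearPoint_sq {e : Cn n} (he : ‖e‖ = 1) {r : ℝ} (hr : r ≤ 1) (x : Cn n) :
    ‖nearPoint e r x - inner ℂ e (nearPoint e r x) • e‖ ^ 2 =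
      (1 - r) * (‖x‖ ^ 2 - ‖inner ℂ e x‖ ^ 2) := by
  rw [nearPoint_sub he, norm_smul, mul_pow, norm_sub_inner_smul_sq he, Complex.norm_real,
    Real.norm_of_nonneg (Real.sqrt_nonneg _), Real.sq_sqrt (by linarith)]

theorem norm_inner_le_of_unit {e : Cn n} (he : ‖e‖ = 1) (x : Cn n) : ‖inner ℂ e x‖ ≤ ‖x‖ := by
  simpa [he] using norm_inner_le_norm (𝕜 := ℂ) e x

theorem norm_nearPoint_bounds {e : Cn n} (he : ‖e‖ = 1) {r : ℝ} (hr0 : 0 ≤ r) (hr : r < 1)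
    {x : Cn n} (hx : ‖x‖ ≤ 1 / 10) :
    1 - r ≤ 2 * (1 - ‖nearPoint e r x‖) ∧ 1 - ‖nearPoint e r x‖ ≤ 2 * (1 - r) := by
  set w := nearPoint e r x with hw
  set c := inner ℂ e x with hc
  have hcx : ‖c‖ ≤ ‖x‖ := norm_inner_le_of_unit he x
  have h1 := norm_sub_nearPoint_sq he hr.le x
  rw [norm_sub_inner_smul_sq he, ← hw, inner_nearPoint he, ← hc] at h1
  set p : ℂ := r + ((1 - r : ℝ) : ℂ) * c with hp
  have hm : ‖((1 - r : ℝ) : ℂ) * c‖ = (1 - r) * ‖c‖ := by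
    rw [norm_mul, Complex.norm_real, Real.norm_of_nonneg (by linarith)]
  have hrn : ‖(r : ℂ)‖ = r := by rw [Complex.norm_real, Real.norm_of_nonneg hr0]
  have hp1 : ‖p‖ ≤ r + (1 - r) * ‖c‖ := by
    have := norm_add_le (r : ℂ) (((1 - r : ℝ) : ℂ) * c)
    rwa [hrn, hm] at this
  have hp2 : r - (1 - r) * ‖c‖ ≤ ‖p‖ := by
    have := norm_sub_norm_le (r : ℂ) (-(((1 - r : ℝ) : ℂ) * c))
    rwa [norm_neg, hrn, hm, sub_neg_eq_add] at this
  have hpw : ‖p‖ ≤ ‖w‖ := by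
    have := norm_inner_le_of_unit he w
    rwa [hw, inner_nearPoint he] at this
  have hd : 0 < 1 - r := by linarith
  have hc0 := norm_nonneg c
  constructor
  -- By Pythagoras ‖w‖² = ‖p‖² + (1 - r)(‖x‖² - ‖c‖²). The radius 1/10 is small enough that at least
  -- half of the distance to the sphere remains.
  · have h2 : ‖w‖ ^ 2 ≤ ((1 + r) / 2) ^ 2 := by
      have h3 : ‖p‖ ^ 2 ≤ (r + (1 - r) * (1 / 10)) ^ 2 := by
        have : ‖p‖ ≤ r + (1 - r) * (1 / 10) := by nlinarith
        gcongr
      have h4 : (1 - r) * (‖x‖ ^ 2 - ‖c‖ ^ 2) ≤ (1 - r) * (1 / 100) := by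
        apply mul_le_mul_of_nonneg_left _ hd.le
        nlinarith [norm_nonneg x]
      nlinarith
    have := (pow_le_pow_iff_left₀ (norm_nonneg w) (by linarith) two_ne_zero).1 h2
    linarith
  · nlinarith

/-- In these coordinates the numerator of φ is of order (1 - r)‖x‖, while the denominator is at
least (9/10)(1 - r). Hence small Bergman balls contain the images of fixed Euclidean balls. -/
theorem norm_moebius_nearPoint_le {e : Cn n} (he : ‖e‖ = 1) {r : ℝ} (hr0 : 0 ≤ r) (hr : r < 1)
    {x : Cn n} (hx : ‖x‖ ≤ 1 / 10) : ‖moebius ((r : ℂ) • e) (nearPoint e r x)‖ ≤ 2 * ‖x‖ := by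
  set c := inner ℂ e x with hc
  have hcx : ‖c‖ ≤ ‖x‖ := norm_inner_le_of_unit he x
  have hd : 0 < 1 - r := by linarith
  have hm : ‖((1 - r : ℝ) : ℂ) * c‖ = (1 - r) * ‖c‖ := by
    rw [norm_mul, Complex.norm_real, Real.norm_of_nonneg (by linarith)]
  have hden : (1 - r) * (9 / 10) ≤ ‖1 - r * inner ℂ e (nearPoint e r x)‖ := by
    rw [inner_nearPoint he, ← hc]
    have h1 : (1 : ℂ) - r * (r + ((1 - r : ℝ) : ℂ) * c) =
        ((1 - r ^ 2 : ℝ) : ℂ) - r * (((1 - r : ℝ) : ℂ) * c) := by push_cast; ring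
    rw [h1]
    have := norm_sub_norm_le ((1 - r ^ 2 : ℝ) : ℂ) (r * (((1 - r : ℝ) : ℂ) * c))
    rw [norm_mul _ (((1 - r : ℝ) : ℂ) * c), hm, Complex.norm_real, Complex.norm_real,
      Real.norm_of_nonneg hr0, Real.norm_of_nonneg (by nlinarith)] at this
    refine le_trans ?_ this
    have : r * ((1 - r) * ‖c‖) ≤ 1 * ((1 - r) * (1 / 10)) := by
      gcongr
      linarith
    nlinarith
  have hsq : ‖moebius ((r : ℂ) • e) (nearPoint e r x)‖ ^ 2 ≤ (2 * ‖x‖) ^ 2 := by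
    rw [norm_moebius_smul_sq he (by nlinarith), norm_sub_nearPoint_sq he hr.le]
    have h2 : ‖(r : ℂ) - inner ℂ e (nearPoint e r x)‖ = (1 - r) * ‖c‖ := by
      rw [inner_nearPoint he, sub_add_cancel_left, norm_neg, hm]
    have hdp : 0 < (1 - r) * (9 / 10) := by linarith
    have hqp := hdp.trans_le hden
    rw [h2, ← hc, div_le_iff₀ (pow_pos hqp 2)]
    have h3 : ((1 - r) * (9 / 10)) ^ 2 ≤ ‖1 - r * inner ℂ e (nearPoint e r x)‖ ^ 2 := by gcongr
    have h4 : (1 - r ^ 2) * ((1 - r) * (‖x‖ ^ 2 - ‖c‖ ^ 2)) ≤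
        2 * (1 - r) * ((1 - r) * (‖x‖ ^ 2 - ‖c‖ ^ 2)) := by
      apply mul_le_mul_of_nonneg_right
      · nlinarith
      · apply mul_nonneg hd.le
        nlinarith [norm_nonneg c]
    have h5 : (2 * ‖x‖) ^ 2 * ((1 - r) * (9 / 10)) ^ 2 ≤
        (2 * ‖x‖) ^ 2 * ‖1 - r * inner ℂ e (nearPoint e r x)‖ ^ 2 := by gcongr
    nlinarith [sq_nonneg ((1 - r) * ‖c‖), sq_nonneg ((1 - r) * ‖x‖)]
  exact (pow_le_pow_iff_left₀ (norm_nonneg _) (by positivity) two_ne_zero).1 hsq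

/-- The converse inclusion: x is found by inverting the dilation, and the size of φ controls the
normal and tangential parts of x. -/
theorem exists_nearPoint_eq {e : Cn n} (he : ‖e‖ = 1) {r : ℝ} (hr0 : 0 ≤ r) (hr : r < 1)
    {w : Cn n} (hw : ‖w‖ < 1) {τ : ℝ} (hτ : τ ≤ 1 / 2)
    (h : ‖moebius ((r : ℂ) • e) w‖ < τ) : ∃ x : Cn n, ‖x‖ ≤ 4 * τ ∧ nearPoint e r x = w := by
  have hd : 0 < 1 - r := by linarith
  have hτ0 : 0 < τ := (norm_nonneg _).trans_lt h
  have hs : 0 < √(1 - r) := Real.sqrt_pos.2 hd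
  have hd' : ((1 - r : ℝ) : ℂ) ≠ 0 := by exact_mod_cast hd.ne'
  have hs' : ((√(1 - r) : ℝ) : ℂ) ≠ 0 := by exact_mod_cast hs.ne'
  set x := dilation e ((1 - r : ℝ) : ℂ)⁻¹ ((√(1 - r) : ℝ) : ℂ)⁻¹ (w - (r : ℂ) • e) with hxdef
  have hxw : nearPoint e r x = w := by
    rw [nearPoint, hxdef, dilation_dilation he, mul_inv_cancel₀ hd', mul_inv_cancel₀ hs',
      dilation_one]
    abel
  refine ⟨x, ?_, hxw⟩
  set c := inner ℂ e x with hc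
  have hm : ‖((1 - r : ℝ) : ℂ) * c‖ = (1 - r) * ‖c‖ := by
    rw [norm_mul, Complex.norm_real, Real.norm_of_nonneg (by linarith)]
  have hcx : ‖c‖ ≤ ‖x‖ := norm_inner_le_of_unit he x
  have hsq : ‖moebius ((r : ℂ) • e) w‖ ^ 2 < τ ^ 2 := by gcongr
  have hpos : 0 < ‖1 - r * inner ℂ e w‖ := by
    have h1 : ‖(r : ℂ) • e‖ < 1 := by
      rw [norm_smul, he, mul_one, Complex.norm_real, Real.norm_of_nonneg hr0]; exact hr
    have := norm_one_sub_inner_pos h1 hw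
    rwa [inner_smul_left, Complex.conj_ofReal] at this
  rw [norm_moebius_smul_sq he (by nlinarith), div_lt_iff₀ (by positivity), ← hxw,
    norm_sub_nearPoint_sq he hr.le] at hsq
  have h2 : ‖(r : ℂ) - inner ℂ e (nearPoint e r x)‖ = (1 - r) * ‖c‖ := by
    rw [inner_nearPoint he, sub_add_cancel_left, norm_neg, hm]
  have hden : ‖1 - r * inner ℂ e (nearPoint e r x)‖ ≤ 2 * (1 - r) + (1 - r) * ‖c‖ := by
    rw [inner_nearPoint he, ← hc]
    have h1 : (1 : ℂ) - r * (r + ((1 - r : ℝ) : ℂ) * c) =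
        ((1 - r ^ 2 : ℝ) : ℂ) - r * (((1 - r : ℝ) : ℂ) * c) := by push_cast; ring
    rw [h1]
    have := norm_sub_le ((1 - r ^ 2 : ℝ) : ℂ) (r * (((1 - r : ℝ) : ℂ) * c))
    rw [norm_mul _ (((1 - r : ℝ) : ℂ) * c), hm, Complex.norm_real, Complex.norm_real,
      Real.norm_of_nonneg hr0, Real.norm_of_nonneg (by nlinarith)] at this
    refine this.trans ?_
    have : r * ((1 - r) * ‖c‖) ≤ 1 * ((1 - r) * ‖c‖) := by gcongr
    nlinarith
  rw [h2] at hsq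
  set q := ‖1 - r * inner ℂ e (nearPoint e r x)‖ with hq
  have hxc : 0 ≤ ‖x‖ ^ 2 - ‖c‖ ^ 2 := by nlinarith [norm_nonneg c]
  have hr2 : 0 ≤ 1 - r ^ 2 := by nlinarith
  have h3 : ((1 - r) * ‖c‖) ^ 2 ≤ (τ * q) ^ 2 := by
    have : 0 ≤ (1 - r ^ 2) * ((1 - r) * (‖x‖ ^ 2 - ‖c‖ ^ 2)) := by positivity
    nlinarith
  have hq0 : 0 ≤ q := norm_nonneg _
  have h4 : (1 - r) * ‖c‖ ≤ τ * q :=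
    (pow_le_pow_iff_left₀ (by positivity) (by positivity) two_ne_zero).1 h3
  -- The bound for q contains ‖c‖ itself. As τ ≤ 1/2, that term is absorbed on the left, whence q ≤
  -- 4(1 - r).
  have h5 : (1 - r) * ‖c‖ ≤ 2 * (1 - r) := by
    have : τ * q ≤ 1 / 2 * (2 * (1 - r) + (1 - r) * ‖c‖) := by gcongr
    linarith
  have h6 : τ ^ 2 * q ^ 2 ≤ τ ^ 2 * (4 * (1 - r)) ^ 2 := by
    gcongr
    linarith
  have h7 : (1 - r) ^ 2 * ‖x‖ ^ 2 ≤ (1 - r) ^ 2 * (4 * τ) ^ 2 := by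
    have : (1 - r) * ((1 - r) * (‖x‖ ^ 2 - ‖c‖ ^ 2)) ≤
        (1 - r ^ 2) * ((1 - r) * (‖x‖ ^ 2 - ‖c‖ ^ 2)) := by
      apply mul_le_mul_of_nonneg_right
      · nlinarith
      · positivity
    nlinarith
  have h8 := le_of_mul_le_mul_left h7 (by positivity)
  exact (pow_le_pow_iff_left₀ (norm_nonneg _) (by positivity) two_ne_zero).1 h8

end Moebius

/-! ### Measurability of Bergman balls and integration against the weight -/

section Measurability

variable {n : ℕ}

theorem measurable_moebius : Measurable fun p : Cn n × Cn n => moebius p.1 p.2 := by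
  have h1 : Measurable fun p : Cn n × Cn n => (inner ℂ p.1 p.2 : ℂ) :=
    (continuous_fst.inner continuous_snd).measurable
  have h2 : Measurable fun p : Cn n × Cn n => inner ℂ p.1 p.2 / (‖p.1‖ : ℂ) ^ 2 :=
    h1.div ((Complex.measurable_ofReal.comp measurable_fst.norm).pow_const 2)
  have h3 : Measurable fun p : Cn n × Cn n => ((√(1 - ‖p.1‖ ^ 2) : ℝ) : ℂ) :=
    Complex.measurable_ofReal.comp
      (Real.continuous_sqrt.measurable.comp ((measurable_fst.norm.pow_const 2).const_sub 1))
  exact (h1.const_sub 1).inv.smul ((measurable_fst.sub (h2.smul measurable_fst)).sub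
    (h3.smul (measurable_snd.sub (h2.smul measurable_fst))))

theorem measurableSet_bergmanBall_prod (α : ℝ) :
    MeasurableSet {p : Cn n × Cn n | p.2 ∈ bergmanBall p.1 α} := by
  have h1 : Measurable fun p : Cn n × Cn n => bergmanDist p.1 p.2 := by
    have h := (measurable_moebius (n := n)).norm
    exact (Real.measurable_log.comp ((h.const_add 1).div (h.const_sub 1))).const_mul (1 / 2)
  exact (measurable_snd measurableSet_ball).inter (measurableSet_lt h1 measurable_const)

theorem measurableSet_bergmanBall (z : Cn n) (α : ℝ) : MeasurableSet (bergmanBall z α) :=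
  (measurable_prodMk_left (x := z)) (measurableSet_bergmanBall_prod α)

namespace BergmanWeight

variable (ρ : BergmanWeight n)

theorem continuousOn_comp_norm : ContinuousOn (fun z : Cn n => ρ ‖z‖) (ball 0 1) :=
  ρ.continuousOn.comp continuous_norm.continuousOn fun z hz =>
    ⟨norm_nonneg z, by simpa using hz⟩

theorem aemeasurable_comp_norm {s : Set (Cn n)} (hs : MeasurableSet s) (hsub : s ⊆ ball 0 1) :
    AEMeasurable (fun z : Cn n => ENNReal.ofReal (ρ ‖z‖)) (volume.restrict s) :=
  ((ρ.continuousOn_comp_norm.mono hsub).aemeasurable hs).ennreal_ofReal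

theorem lintegral_measure (g : Cn n → ℝ≥0∞) (hg : Measurable g) : ∫⁻ z, g z ∂ρ.measure =
    (volume (ball (0 : Cn n) 1))⁻¹ * ∫⁻ z in ball 0 1, ENNReal.ofReal (ρ ‖z‖) * g z := by
  have h : AEMeasurable (fun z : Cn n => ENNReal.ofReal (ρ ‖z‖)) (ballVolume n) :=
    (ρ.aemeasurable_comp_norm measurableSet_ball Subset.rfl).smul_measure _
  rw [measure, lintegral_withDensity_eq_lintegral_mul₀ h hg.aemeasurable, ballVolume,
    lintegral_smul_measure, smul_eq_mul]
  rfl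

theorem measure_compl_ball : ρ.measure (ball (0 : Cn n) 1)ᶜ = 0 := by
  refine withDensity_absolutelyContinuous _ _ ?_
  rw [ballVolume, Measure.smul_apply, Measure.restrict_apply measurableSet_ball.compl]
  simp

theorem ae_mem_ball : ∀ᵐ z ∂ρ.measure, ‖z‖ < 1 := by
  have := ρ.measure_compl_ball
  rw [← mem_ae_iff] at this
  filter_upwards [this] with z hz
  simpa using hz

end BergmanWeight

end Measurability

namespace BergmanSpace

variable {n : ℕ} {ρ : BergmanWeight n}

theorem measurable_coe (f : BergmanSpace ρ) : Measurable f :=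
  BergmanWeight.measurable_of_mem f.2.1 f.2.2.1

theorem lintegral_enorm_sq (f : BergmanSpace ρ) : ∫⁻ w, ‖f w‖ₑ ^ 2 ∂ρ.measure = ‖f‖ₑ ^ 2 := by
  rw [enorm_eq, eLpNorm_eq_lintegral_rpow_enorm_toReal (by norm_num) (by norm_num)]
  simp only [ENNReal.toReal_ofNat, ENNReal.rpow_ofNat, one_div]
  rw [← ENNReal.rpow_natCast, ← ENNReal.rpow_mul]
  simp
  rfl

end BergmanSpace

/-! ### Sub-mean value estimate on Bergman balls and the upper bound for the kernel -/

namespace BergmanWeight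

variable {n : ℕ} {ρ : BergmanWeight n}

/-- Pull f² back by `nearPoint` and use the sub-mean value property on a fixed Euclidean ball. The
change of variables costs (1 - r)^(-(n+1)), and the weight there is at least a multiple of T(r)/(1 -
r). The quotient is of order 2^k/(1 - r)^n. -/
theorem InClassSStar.exists_enorm_sq_le (hn : 1 ≤ n) (hρ : ρ.InClassSStar) {α : ℝ} (hα : 0 < α) :
    ∃ C : ℝ≥0∞, C ≠ ∞ ∧ ∀ f ∈ ρ.submodule, ∀ z : Cn n, ‖z‖ < 1 → ‖f z‖ₑ ^ 2 ≤
      C * (ENNReal.ofReal (ρ.kernelSize z) * ∫⁻ w in bergmanBall z α, ‖f w‖ₑ ^ 2 ∂ρ.measure) := by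
  obtain ⟨τ, hτ, rfl⟩ := exists_half_log_eq hα
  set α := 1 / 2 * Real.log ((1 + τ) / (1 - τ)) with hα'
  obtain ⟨D, hD, hd⟩ := hρ.1.exists_tail_norm_le
  obtain ⟨A, hA, ha⟩ := hρ.exists_tail_le
  -- 1/11 keeps the closed ball inside the frame of radius 1/10. With τ/3 the bound ‖φ‖ ≤ 2‖x‖
  -- places the image in the Bergman ball.
  set ε : ℝ := min (1 / 11) (τ / 3) with hε
  have hε0 : 0 < ε := lt_min (by norm_num) (by linarith [hτ.1])
  set V := volume (ball (0 : Cn n) 1) with hV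
  set W := volume (ball (0 : Cn n) ε) with hW
  have hW0 : W ≠ 0 := (measure_ball_pos _ _ hε0).ne'
  have hW1 : W ≠ ∞ := measure_ball_lt_top.ne
  have hV0 : V ≠ 0 := (measure_ball_pos _ _ one_pos).ne'
  have hV1 : V ≠ ∞ := measure_ball_lt_top.ne
  refine ⟨W⁻¹ * V * ENNReal.ofReal (2 * (2 * D * A)), ENNReal.mul_ne_top
    (ENNReal.mul_ne_top (ENNReal.inv_ne_top.2 hW0) hV1) ENNReal.ofReal_ne_top, fun f hf z hz => ?_⟩
  have hfm := measurable_of_mem hf.1 hf.2.1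
  obtain ⟨e, he, hze⟩ := exists_unit_smul_eq hn z
  set r := ‖z‖ with hr
  have hr0 : 0 ≤ r := norm_nonneg z
  have hδ : 0 < 1 - r := by linarith
  have hT := ρ.tail_pos hr0 hz
  have hcont : Continuous (nearPoint e r) := by unfold nearPoint; fun_prop
  have hdiff : Differentiable ℂ (nearPoint e r) := by unfold nearPoint; fun_prop
  have hzero : nearPoint e r 0 = z := by rw [nearPoint, map_zero, add_zero, ← hze]
  have hball : ∀ x : Cn n, ‖x‖ ≤ 1 / 10 → ‖nearPoint e r x‖ < 1 := fun x hx => by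
    have := (norm_nearPoint_bounds he hr0 hz hx).1
    linarith
  have hmv := enorm_mul_volume_le (g := fun x => f (nearPoint e r x) ^ 2) (U := ball 0 (1 / 10))
    ((hf.1.comp hdiff.differentiableOn fun x hx => by
      simpa using hball x (by simpa using (mem_ball_zero_iff.1 hx).le)).pow 2)
    ((hfm.comp hcont.measurable).pow_const 2) (z := 0) (s := ε) (by
      refine closedBall_subset_ball ?_
      exact (min_le_left _ _).trans_lt (by norm_num))
  simp only [zero_add, hzero] at hmv
  set Φ : Cn n → ℝ≥0∞ := (bergmanBall z α).indicator
    (fun w => ENNReal.ofReal (ρ ‖w‖) * ‖f w‖ₑ ^ 2) with hΦ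
  set K : ℝ≥0∞ := ENNReal.ofReal (2 * D * A * (1 - r) / ρ.tail r) with hK
  -- The constant K is chosen so that K ρ(‖w‖) ≥ 1 at every image point w, by doubling and ρ* ≲ ρ.
  have hpt : ∀ x ∈ ball (0 : Cn n) ε, ‖f (nearPoint e r x) ^ 2‖ₑ ≤ K * Φ (nearPoint e r x) := by
    intro x hx
    rw [mem_ball_zero_iff] at hx
    have hx1 : ‖x‖ ≤ 1 / 10 := (hx.le.trans (min_le_left _ _)).trans (by norm_num)
    have hx2 : ‖x‖ < τ / 3 := hx.trans_le (min_le_right _ _)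
    set w := nearPoint e r x with hw
    have hw1 := hball x hx1
    have hb := norm_nearPoint_bounds he hr0 hz hx1
    have hm := norm_moebius_nearPoint_le he hr0 hz hx1
    rw [← hze] at hm
    have hmem : w ∈ bergmanBall z α := (mem_bergmanBall_iff hn hτ hz w).2 ⟨hw1, by
      refine hm.trans_lt ?_
      linarith [hτ.1]⟩
    rw [hΦ, indicator_of_mem hmem, ← mul_assoc, enorm_pow]
    refine le_mul_of_one_le_left' ?_
    have hρw : 0 < ρ ‖w‖ := ρ.pos _ ⟨norm_nonneg w, hw1⟩
    rw [hK, ← ENNReal.ofReal_mul (by positivity), ENNReal.one_le_ofReal, div_mul_eq_mul_div,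
      one_le_div hT]
    calc ρ.tail r ≤ D * ρ.tail ‖w‖ := hd z w hz hw1 hb.1
      _ ≤ D * (A * ((1 - ‖w‖) * ρ ‖w‖)) := by
        gcongr
        exact ha _ ⟨norm_nonneg w, hw1⟩
      _ ≤ D * (A * ((2 * (1 - r)) * ρ ‖w‖)) := by
        gcongr
        exact hb.2
      _ = _ := by ring
  have hmapz : (volume : Measure (Cn n)).map (nearPoint e r) =
      ENNReal.ofReal (((1 - r) ^ (n + 1))⁻¹) • volume := by
    have h1 : nearPoint e r = (fun y => (r : ℂ) • e + y) ∘ dilation e ((1 - r : ℝ) : ℂ) (√(1 - r) : ℝ) := rfl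
    rw [h1, ← Measure.map_map (measurable_const_add _) (ContinuousLinearMap.continuous _).measurable,
      map_dilation_volume hn he hδ, Measure.map_smul, map_add_left_eq_self]
  have hE := measurableSet_bergmanBall z α
  have hsubE : bergmanBall z α ⊆ ball 0 1 := fun w hw => hw.1
  have hint : ∫⁻ w, Φ w = V * ∫⁻ w in bergmanBall z α, ‖f w‖ₑ ^ 2 ∂ρ.measure := by
    rw [← lintegral_indicator hE, lintegral_measure _ _ ((hfm.enorm.pow_const 2).indicator hE),
      ← mul_assoc, ENNReal.mul_inv_cancel hV0 hV1, one_mul, ← lintegral_indicator measurableSet_ball]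
    refine lintegral_congr fun w => ?_
    by_cases hw : w ∈ bergmanBall z α
    · rw [hΦ, indicator_of_mem hw, indicator_of_mem (hsubE hw), indicator_of_mem hw]
    · rw [hΦ, indicator_of_notMem hw]
      simp [indicator, hw]
  have hΦm : AEMeasurable Φ volume :=
    (aemeasurable_indicator_iff hE).2 ((ρ.aemeasurable_comp_norm hE hsubE).mul
      (hfm.enorm.pow_const 2).aemeasurable)
  have hmain : ‖f z‖ₑ ^ 2 * W ≤ K * (ENNReal.ofReal (((1 - r) ^ (n + 1))⁻¹) *
      (V * ∫⁻ w in bergmanBall z α, ‖f w‖ₑ ^ 2 ∂ρ.measure)) := by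
    calc ‖f z‖ₑ ^ 2 * W ≤ ∫⁻ x in ball (0 : Cn n) ε, ‖f (nearPoint e r x) ^ 2‖ₑ := by
          rwa [enorm_pow] at hmv
      _ ≤ ∫⁻ x in ball (0 : Cn n) ε, K * Φ (nearPoint e r x) :=
          setLIntegral_mono' measurableSet_ball hpt
      _ ≤ ∫⁻ x, K * Φ (nearPoint e r x) := setLIntegral_le_lintegral _ _
      _ = K * ∫⁻ x, Φ (nearPoint e r x) := lintegral_const_mul' _ _ ENNReal.ofReal_ne_top
      _ = K * ∫⁻ w, Φ w ∂((volume : Measure (Cn n)).map (nearPoint e r)) := by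
          rw [lintegral_map' _ hcont.measurable.aemeasurable]
          rw [hmapz]
          exact hΦm.smul_measure _
      _ = _ := by rw [hmapz, lintegral_smul_measure, smul_eq_mul, hint]
  have hconst : K * ENNReal.ofReal (((1 - r) ^ (n + 1))⁻¹) ≤
      ENNReal.ofReal (2 * (2 * D * A)) * ENNReal.ofReal (ρ.kernelSize z) := by
    rw [hK, ← ENNReal.ofReal_mul (by positivity), ← ENNReal.ofReal_mul (by positivity)]
    refine ENNReal.ofReal_le_ofReal ?_
    rw [kernelSize, ← hr]
    have hinv := ρ.inv_tail_le hz
    calc 2 * D * A * (1 - r) / ρ.tail r * ((1 - r) ^ (n + 1))⁻¹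
        = 2 * D * A * ((ρ.tail r)⁻¹ / (1 - r) ^ n) := by
          rw [pow_succ]; field_simp
      _ ≤ 2 * D * A * ((2 * 2 ^ ρ.shell z) / (1 - r) ^ n) := by gcongr
      _ = _ := by ring
  calc ‖f z‖ₑ ^ 2 = W⁻¹ * (‖f z‖ₑ ^ 2 * W) := by
        rw [mul_comm (‖f z‖ₑ ^ 2), ← mul_assoc, ENNReal.inv_mul_cancel hW0 hW1, one_mul]
    _ ≤ W⁻¹ * ((K * ENNReal.ofReal (((1 - r) ^ (n + 1))⁻¹)) *
        (V * ∫⁻ w in bergmanBall z α, ‖f w‖ₑ ^ 2 ∂ρ.measure)) := by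
        rw [mul_assoc K]
        gcongr
    _ ≤ W⁻¹ * ((ENNReal.ofReal (2 * (2 * D * A)) * ENNReal.ofReal (ρ.kernelSize z)) *
        (V * ∫⁻ w in bergmanBall z α, ‖f w‖ₑ ^ 2 ∂ρ.measure)) := by gcongr
    _ = _ := by ring

theorem norm_kernelFun_sq (z : Cn n) : ‖ρ.kernelFun z‖ ^ 2 = ‖ρ.kernelFun z z‖ := by
  rw [← ρ.inner_kernelFun, inner_self_eq_norm_sq_to_K]
  simp

theorem norm_apply_le (f : BergmanSpace ρ) (z : Cn n) : ‖f z‖ ≤ ‖ρ.kernelFun z‖ * ‖f‖ := by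
  rw [← ρ.inner_kernelFun]
  exact norm_inner_le_norm _ _

/-- The pointwise estimate for K_z at z reads ‖K_z‖⁴ ≤ C Q(z) ‖K_z‖², and one factor cancels. -/
theorem InClassSStar.exists_norm_kernelFun_sq_le (hn : 1 ≤ n) (hρ : ρ.InClassSStar) :
    ∃ C : ℝ, 0 < C ∧ ∀ z : Cn n, ‖z‖ < 1 → ‖ρ.kernelFun z‖ ^ 2 ≤ C * ρ.kernelSize z := by
  obtain ⟨C, hC, h⟩ := hρ.exists_enorm_sq_le hn one_pos
  refine ⟨C.toReal + 1, by positivity, fun z hz => ?_⟩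
  have h1 := h (ρ.kernelFun z) (ρ.kernelFun z).2 z hz
  have h2 : ‖ρ.kernelFun z z‖ₑ ^ 2 ≤ C * (ENNReal.ofReal (ρ.kernelSize z) * ‖ρ.kernelFun z‖ₑ ^ 2) := by
    refine h1.trans ?_
    gcongr
    rw [← BergmanSpace.lintegral_enorm_sq]
    exact setLIntegral_le_lintegral _ _
  have hk := kernelSize_pos (ρ := ρ) hz
  have h3 := ENNReal.toReal_mono (by finiteness) h2
  simp only [ENNReal.toReal_mul, ENNReal.toReal_pow, toReal_enorm, ENNReal.toReal_ofReal hk.le] at h3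
  rw [← norm_kernelFun_sq] at h3
  rcases eq_or_ne ‖ρ.kernelFun z‖ 0 with h0 | h0
  · rw [h0, zero_pow two_ne_zero]; positivity
  · have h4 : 0 < ‖ρ.kernelFun z‖ ^ 2 := by positivity
    have h5 : ‖ρ.kernelFun z‖ ^ 2 ≤ C.toReal * ρ.kernelSize z := by
      refine le_of_mul_le_mul_right ?_ h4
      calc _ = (‖ρ.kernelFun z‖ ^ 2) ^ 2 := by ring
        _ ≤ _ := h3
        _ = _ := by ring
    refine h5.trans ?_
    gcongr
    linarith

end BergmanWeight

/-! ### Polar coordinates and nonisotropic caps -/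

section Polar

variable {n : ℕ}

theorem finrank_real_Cn (n : ℕ) : Module.finrank ℝ (Cn n) = 2 * n := by
  rw [← Module.finrank_mul_finrank ℝ ℂ (Cn n), Complex.finrank_real_complex]
  simp

/-- Integration in polar coordinates of a product of a radial and an angular function. -/
theorem lintegral_indicator_mul_norm (S : Set (Cn n)) (hS : MeasurableSet S) {F : ℝ → ℝ≥0∞}
    (hF : Measurable F) (hn : 1 ≤ n) :
    ∫⁻ x : Cn n, S.indicator 1 (‖x‖⁻¹ • x) * F ‖x‖ =
      (volume : Measure (Cn n)).toSphere (Subtype.val ⁻¹' S) *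
        ∫⁻ y in Ioi (0 : ℝ), ENNReal.ofReal (y ^ (2 * n - 1)) * F y := by
  have : Nonempty (Fin n) := ⟨⟨0, hn⟩⟩
  have hind : Measurable (S.indicator (1 : Cn n → ℝ≥0∞)) := measurable_one.indicator hS
  calc ∫⁻ x : Cn n, S.indicator 1 (‖x‖⁻¹ • x) * F ‖x‖
      = ∫⁻ x : ({0}ᶜ : Set (Cn n)), S.indicator 1 (‖x.1‖⁻¹ • x.1) * F ‖x.1‖
          ∂((volume : Measure (Cn n)).comap (↑)) := by
        rw [lintegral_subtype_comap (measurableSet_singleton _).compl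
          (fun x : Cn n => S.indicator 1 (‖x‖⁻¹ • x) * F ‖x‖), restrict_compl_singleton]
    _ = ∫⁻ x : sphere (0 : Cn n) 1 × Ioi (0 : ℝ), S.indicator 1 (x.1 : Cn n) * F x.2
          ∂((volume : Measure (Cn n)).toSphere.prod (.volumeIoiPow (2 * n - 1))) := by
        have h := (volume : Measure (Cn n)).measurePreserving_homeomorphUnitSphereProd.lintegral_comp_emb
          (Homeomorph.measurableEmbedding _)
          (fun x : sphere (0 : Cn n) 1 × Ioi (0 : ℝ) => S.indicator 1 (x.1 : Cn n) * F x.2)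
        rw [finrank_real_Cn] at h
        rw [← h]
        simp
    _ = (∫⁻ x : sphere (0 : Cn n) 1, S.indicator 1 (x : Cn n) ∂(volume : Measure (Cn n)).toSphere) *
          ∫⁻ y : Ioi (0 : ℝ), F y ∂(.volumeIoiPow (2 * n - 1)) := by
        rw [lintegral_prod_mul (f := fun x : sphere (0 : Cn n) 1 => S.indicator 1 (x : Cn n))
          (g := fun y : Ioi (0 : ℝ) => F y)]
        · exact (hind.comp measurable_subtype_coe).aemeasurable
        · exact (hF.comp measurable_subtype_coe).aemeasurable
    _ = _ := by
        congr 1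
        · rw [← lintegral_indicator_one (measurable_subtype_coe hS)]
          rfl
        · refine (lintegral_withDensity_eq_lintegral_mul₀
            (measurable_subtype_coe.pow_const _).ennreal_ofReal.aemeasurable
            (g := fun y : Ioi (0 : ℝ) => F y) (hF.comp measurable_subtype_coe).aemeasurable).trans ?_
          exact lintegral_subtype_comap measurableSet_Ioi
            (fun y : ℝ => ENNReal.ofReal (y ^ (2 * n - 1)) * F y)

theorem isOpen_norm_one_sub_inner_lt (z : Cn n) (t : ℝ) :
    IsOpen {w : Cn n | ‖1 - inner ℂ z w‖ < t} :=
  isOpen_lt (by fun_prop) continuous_const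

theorem isOpen_norm_lt_one_and_norm_one_sub_inner_lt (z : Cn n) (t : ℝ) :
    IsOpen {w : Cn n | ‖w‖ < 1 ∧ ‖1 - inner ℂ z w‖ < t} :=
  (isOpen_lt continuous_norm continuous_const).inter (isOpen_norm_one_sub_inner_lt z t)

/-- Rescaling about the boundary point e by t along e and √t across it puts the region into a fixed
ball: the part along e is less than 3 and the squared part across is less than 6, so ‖y‖² < 15 < 4².
The Jacobian is t^(n+1). -/
theorem volume_norm_one_sub_inner_lt_le (hn : 1 ≤ n) {e : Cn n} (he : ‖e‖ = 1) {t : ℝ} (ht : 0 < t) :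
    volume {x : Cn n | ‖x‖ < 1 ∧ ‖1 - inner ℂ e x‖ < 3 * t} ≤
      ENNReal.ofReal (t ^ (n + 1)) * volume (ball (0 : Cn n) 4) := by
  set S := {x : Cn n | ‖x‖ < 1 ∧ ‖1 - inner ℂ e x‖ < 3 * t} with hSdef
  have hSo : IsOpen S := isOpen_norm_lt_one_and_norm_one_sub_inner_lt e _
  set L : Cn n → Cn n := fun y => e + dilation e t (√t : ℝ) y with hL
  have hLm : Measurable L := by
    have : Continuous L := by fun_prop
    exact this.measurable
  have hmap : (volume : Measure (Cn n)).map L = ENNReal.ofReal ((t ^ (n + 1))⁻¹) • volume := by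
    have h1 : L = (fun y => e + y) ∘ dilation e t (√t : ℝ) := rfl
    rw [h1, ← Measure.map_map (measurable_const_add _) (ContinuousLinearMap.continuous _).measurable,
      map_dilation_volume hn he ht, Measure.map_smul, map_add_left_eq_self]
  have hpre : L ⁻¹' S ⊆ ball 0 4 := by
    rintro y ⟨hy1, hy2⟩
    have hin : inner ℂ e (L y) = 1 + t * inner ℂ e y := by
      rw [hL, inner_add_right, inner_dilation he, inner_self_eq_norm_sq_to_K, he]
      simp
    have hperp : ‖L y - inner ℂ e (L y) • e‖ ^ 2 = t * (‖y‖ ^ 2 - ‖inner ℂ e y‖ ^ 2) := by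
      have : L y - inner ℂ e (L y) • e = ((√t : ℝ) : ℂ) • (y - inner ℂ e y • e) := by
        rw [hin, hL]
        simp only [dilation_apply]
        module
      rw [this, norm_smul, mul_pow, norm_sub_inner_smul_sq he, Complex.norm_real,
        Real.norm_of_nonneg (Real.sqrt_nonneg _), Real.sq_sqrt ht.le]
    rw [norm_sub_inner_smul_sq he] at hperp
    have hc : ‖1 - inner ℂ e (L y)‖ = t * ‖inner ℂ e y‖ := by
      rw [hin, sub_add_cancel_left, norm_neg, norm_mul, Complex.norm_real, Real.norm_of_nonneg ht.le]
    have hc1 : ‖inner ℂ e (L y)‖ ≤ ‖L y‖ := norm_inner_le_of_unit he _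
    have hc2 : 1 - ‖inner ℂ e (L y)‖ < 3 * t := by
      have := norm_sub_norm_le (1 : ℂ) (inner ℂ e (L y))
      rw [norm_one] at this
      linarith
    have h3 : ‖inner ℂ e y‖ < 3 := by
      rw [hc] at hy2
      nlinarith
    have h4 : t * (‖y‖ ^ 2 - ‖inner ℂ e y‖ ^ 2) < t * 6 := by
      rw [← hperp]
      nlinarith [norm_nonneg (L y), norm_nonneg (inner ℂ e (L y))]
    have h5 := lt_of_mul_lt_mul_left h4 ht.le
    rw [mem_ball_zero_iff]
    nlinarith [norm_nonneg y, norm_nonneg (inner ℂ e y)]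
  have h1 : ENNReal.ofReal ((t ^ (n + 1))⁻¹) * volume S ≤ volume (ball (0 : Cn n) 4) := by
    have := congrArg (fun m => m S) hmap
    simp only [Measure.map_apply hLm hSo.measurableSet, Measure.smul_apply, smul_eq_mul] at this
    rw [← this]
    exact measure_mono hpre
  have hpos : 0 < t ^ (n + 1) := by positivity
  calc volume S = ENNReal.ofReal (t ^ (n + 1)) * (ENNReal.ofReal ((t ^ (n + 1))⁻¹) * volume S) := by
        rw [← mul_assoc, ← ENNReal.ofReal_mul hpos.le, mul_inv_cancel₀ hpos.ne',
          ENNReal.ofReal_one, one_mul]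
    _ ≤ _ := by gcongr

/-- Thicken the cap radially by t/2. The resulting set has volume O(t^(n+1)), and dividing by the
radial integral, of order t, leaves t^n. -/
theorem toSphere_cap_le (hn : 1 ≤ n) {e : Cn n} (he : ‖e‖ = 1) {t : ℝ} (ht : 0 < t) (ht1 : t ≤ 1) :
    (volume : Measure (Cn n)).toSphere (Subtype.val ⁻¹' {x : Cn n | ‖1 - inner ℂ e x‖ < 2 * t}) ≤
      ENNReal.ofReal (4 ^ n * t ^ n) * volume (ball (0 : Cn n) 4) := by
  set S := {x : Cn n | ‖1 - inner ℂ e x‖ < 2 * t} with hSdef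
  have hSo : IsOpen S := isOpen_lt (by fun_prop) continuous_const
  set F : ℝ → ℝ≥0∞ := (Ioo (1 - t / 2) 1).indicator 1 with hF
  have hFm : Measurable F := measurable_one.indicator measurableSet_Ioo
  have hpol := lintegral_indicator_mul_norm S hSo.measurableSet hFm hn
  have hup : ∫⁻ x : Cn n, S.indicator 1 (‖x‖⁻¹ • x) * F ‖x‖ ≤
      volume {x : Cn n | ‖x‖ < 1 ∧ ‖1 - inner ℂ e x‖ < 3 * t} := by
    have hSo' : MeasurableSet {x : Cn n | ‖x‖ < 1 ∧ ‖1 - inner ℂ e x‖ < 3 * t} :=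
      (isOpen_norm_lt_one_and_norm_one_sub_inner_lt e _).measurableSet
    rw [← lintegral_indicator_one hSo']
    refine lintegral_mono fun x => ?_
    by_cases hx : ‖x‖ ∈ Ioo (1 - t / 2) 1 ∧ ‖x‖⁻¹ • x ∈ S
    · obtain ⟨⟨hx1, hx2⟩, hx3⟩ := hx
      have hx0 : 0 < ‖x‖ := by linarith
      rw [indicator_of_mem hx3, hF,
        indicator_of_mem (show ‖x‖ ∈ Ioo (1 - t / 2) 1 from ⟨hx1, hx2⟩), indicator_of_mem]
      · simp
      refine ⟨hx2, ?_⟩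
      have h1 : ‖1 - inner ℂ e (‖x‖⁻¹ • x)‖ < 2 * t := hx3
      have h2 : inner ℂ e x = (‖x‖ : ℂ) * inner ℂ e (‖x‖⁻¹ • x) := by
        rw [← Complex.coe_smul ‖x‖⁻¹ x, inner_smul_right, ← mul_assoc, ← Complex.ofReal_mul, mul_inv_cancel₀ hx0.ne']
        simp
      have h3 : ‖inner ℂ e (‖x‖⁻¹ • x)‖ ≤ 1 := by
        refine (norm_inner_le_of_unit he _).trans (le_of_eq ?_)
        rw [norm_smul, norm_inv, norm_norm, inv_mul_cancel₀ hx0.ne']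
      set c := inner ℂ e (‖x‖⁻¹ • x) with hc
      have h4 : 1 - inner ℂ e x = (1 - c) + ((1 - ‖x‖ : ℝ) : ℂ) * c := by
        rw [h2]; push_cast; ring
      rw [h4]
      refine (norm_add_le _ _).trans_lt ?_
      rw [norm_mul, Complex.norm_real, Real.norm_of_nonneg (by linarith)]
      nlinarith [norm_nonneg c]
    · have : S.indicator (1 : Cn n → ℝ≥0∞) (‖x‖⁻¹ • x) * F ‖x‖ = 0 := by
        rw [mul_eq_zero]
        by_contra! h
        exact hx ⟨by_contra fun h' => h.2 (indicator_of_notMem h' _),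
          by_contra fun h' => h.1 (indicator_of_notMem h' _)⟩
      rw [this]
      exact zero_le
  -- On the interval, of length t/2, y is at least 1/2, and (1/2)^(2n-1) · t/2 = t · 4^(-n).
  have hlow : ENNReal.ofReal (t * (1 / 4) ^ n) ≤
      ∫⁻ y in Ioi (0 : ℝ), ENNReal.ofReal (y ^ (2 * n - 1)) * F y := by
    calc ENNReal.ofReal (t * (1 / 4) ^ n)
        = ENNReal.ofReal ((1 / 2) ^ (2 * n - 1)) * ENNReal.ofReal (1 - (1 - t / 2)) := by
          rw [← ENNReal.ofReal_mul (by positivity)]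
          congr 1
          have : 2 * n = (2 * n - 1) + 1 := by omega
          have h : ((1 : ℝ) / 4) ^ n = (1 / 2) ^ (2 * n) := by rw [pow_mul]; norm_num
          rw [h]
          nth_rewrite 1 [this]
          rw [pow_succ]
          ring
      _ = ∫⁻ y in Ioo (1 - t / 2) 1, ENNReal.ofReal ((1 / 2) ^ (2 * n - 1)) := by
          rw [setLIntegral_const, Real.volume_Ioo]
      _ ≤ ∫⁻ y in Ioo (1 - t / 2) 1, ENNReal.ofReal (y ^ (2 * n - 1)) * F y := by
          refine setLIntegral_mono' measurableSet_Ioo fun y hy => ?_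
          rw [hF, indicator_of_mem hy, Pi.one_apply, mul_one]
          refine ENNReal.ofReal_le_ofReal ?_
          gcongr
          linarith [hy.1]
      _ ≤ _ := lintegral_mono_set fun y hy => by
          have : 1 - t / 2 < y := hy.1
          change 0 < y
          linarith
  have hle := hup.trans (volume_norm_one_sub_inner_lt_le hn he ht)
  rw [hpol] at hle
  set m := (volume : Measure (Cn n)).toSphere (Subtype.val ⁻¹' S)
  have h5 : m * ENNReal.ofReal (t * (1 / 4) ^ n) ≤
      ENNReal.ofReal (t ^ (n + 1)) * volume (ball (0 : Cn n) 4) := le_trans (by gcongr) hle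
  have hp : 0 < t * (1 / 4) ^ n := by positivity
  calc m = (m * ENNReal.ofReal (t * (1 / 4) ^ n)) * ENNReal.ofReal ((t * (1 / 4) ^ n)⁻¹) := by
        rw [mul_assoc, ← ENNReal.ofReal_mul hp.le, mul_inv_cancel₀ hp.ne', ENNReal.ofReal_one,
          mul_one]
    _ ≤ (ENNReal.ofReal (t ^ (n + 1)) * volume (ball (0 : Cn n) 4)) *
        ENNReal.ofReal ((t * (1 / 4) ^ n)⁻¹) := by gcongr
    _ = (ENNReal.ofReal (t ^ (n + 1)) * ENNReal.ofReal ((t * (1 / 4) ^ n)⁻¹)) *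
        volume (ball (0 : Cn n) 4) := by ring
    _ = _ := by
        rw [← ENNReal.ofReal_mul (by positivity)]
        congr 2
        rw [one_div, inv_pow, mul_inv, inv_inv, pow_succ]
        field_simp

end Polar

/-! ### Measure of nonisotropic balls and the lower bound for the kernel -/

namespace BergmanWeight

variable {n : ℕ} (ρ : BergmanWeight n)

theorem lintegral_Ioo_le_tail {a : ℝ} (ha0 : 0 ≤ a) (ha1 : a ≤ 1) :
    ∫⁻ y in Ioi (0 : ℝ), ENNReal.ofReal (y ^ (2 * n - 1)) *
      (Ioo a 1).indicator (fun y => ENNReal.ofReal (ρ y)) y ≤ ENNReal.ofReal (ρ.tail a) := by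
  have hint : IntegrableOn ρ (Ioo a 1) :=
    ρ.integrableOn.mono_set fun y hy => ⟨ha0.trans hy.1.le, hy.2⟩
  have htail : ρ.tail a = ∫ y in Ioo a 1, ρ y := by
    rw [tail, intervalIntegral.integral_of_le ha1, integral_Ioc_eq_integral_Ioo]
  rw [htail, ofReal_integral_eq_lintegral_ofReal hint, ← lintegral_indicator measurableSet_Ioi,
    ← lintegral_indicator measurableSet_Ioo]
  · refine lintegral_mono fun y => ?_
    by_cases hy : y ∈ Ioo a 1
    · have h0 : (0 : ℝ) < y := ha0.trans_lt hy.1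
      rw [indicator_of_mem (show y ∈ Ioi (0 : ℝ) from h0), indicator_of_mem hy]
      refine mul_le_of_le_one_left' ?_
      rw [ENNReal.ofReal_le_one]
      exact pow_le_one₀ h0.le hy.2.le
    · simp [indicator, hy]
  · filter_upwards [ae_restrict_mem measurableSet_Ioo] with y hy
    exact (ρ.pos y ⟨ha0.trans hy.1.le, hy.2⟩).le

theorem measurable_indicator_Ioo {a : ℝ} (ha0 : 0 ≤ a) :
    Measurable ((Ioo a 1).indicator (fun y => ENNReal.ofReal (ρ y))) := by
  classical
  have h : ContinuousOn (fun y => ENNReal.ofReal (ρ y)) (Ioo a 1) :=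
    ENNReal.continuous_ofReal.comp_continuousOn
      (ρ.continuousOn.mono fun y hy => ⟨ha0.trans hy.1.le, hy.2⟩)
  have := h.measurable_piecewise (g := 0) continuousOn_const measurableSet_Ioo
  rwa [piecewise_eq_indicator] at this

/-- Up to the null set {0}, the part of U in the ball lies in the cone over S beyond radius a, where
the polar integral is a product of an angular and a radial factor. -/
theorem measure_cone_le (hn : 1 ≤ n) {a : ℝ} (ha0 : 0 ≤ a) (ha1 : a ≤ 1) {S : Set (Cn n)}
    (hS : MeasurableSet S) {U : Set (Cn n)} (hU : MeasurableSet U)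
    (h : ∀ w ∈ U, ‖w‖ < 1 → w ≠ 0 → a < ‖w‖ ∧ ‖w‖⁻¹ • w ∈ S) :
    ρ.measure U ≤ (volume (ball (0 : Cn n) 1))⁻¹ *
      ((volume : Measure (Cn n)).toSphere (Subtype.val ⁻¹' S) * ENNReal.ofReal (ρ.tail a)) := by
  have : Nonempty (Fin n) := ⟨⟨0, hn⟩⟩
  have : Nontrivial (Cn n) := inferInstance
  rw [← lintegral_indicator_one hU, lintegral_measure _ _ (measurable_one.indicator hU)]
  gcongr
  refine le_trans ?_ (le_trans (lintegral_indicator_mul_norm S hS (ρ.measurable_indicator_Ioo ha0)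
    hn).le (mul_le_mul_right (ρ.lintegral_Ioo_le_tail ha0 ha1) _))
  rw [← lintegral_indicator measurableSet_ball]
  have h0 : ∀ᵐ w : Cn n, w ≠ 0 := by
    rw [ae_iff]
    simp
  refine lintegral_mono_ae ?_
  filter_upwards [h0] with w hw0
  by_cases hw : w ∈ U ∧ ‖w‖ < 1
  · obtain ⟨h1, h2⟩ := h w hw.1 hw.2 hw0
    rw [indicator_of_mem (mem_ball_zero_iff.2 hw.2), indicator_of_mem h2,
      indicator_of_mem (show ‖w‖ ∈ Ioo a 1 from ⟨h1, hw.2⟩), indicator_of_mem hw.1]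
    simp
  · refine le_of_eq_of_le ?_ zero_le
    rw [not_and_or] at hw
    rcases hw with hw | hw <;> simp [indicator, hw]

/-- The `ρ dv`-measure of the nonisotropic balls at the boundary. -/
theorem exists_measure_norm_one_sub_inner_lt_le (hn : 1 ≤ n) : ∃ C : ℝ≥0∞, C ≠ ∞ ∧
    ∀ z : Cn n, ‖z‖ < 1 → ∀ t : ℝ, 0 < t → ρ.measure {w | ‖1 - inner ℂ z w‖ < t} ≤
      C * ENNReal.ofReal (t ^ n * ρ.tail (max 0 (1 - t))) := by
  set V := volume (ball (0 : Cn n) 1) with hV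
  set B := volume (ball (0 : Cn n) 4) with hB
  have hV0 : V ≠ 0 := (measure_ball_pos _ _ one_pos).ne'
  have hB1 : B ≠ ∞ := measure_ball_lt_top.ne
  set m := (volume : Measure (Cn n)).toSphere univ with hm
  have hm1 : m ≠ ∞ := measure_ne_top _ _
  refine ⟨V⁻¹ * (ENNReal.ofReal (4 ^ n) * B + m), ENNReal.mul_ne_top (ENNReal.inv_ne_top.2 hV0)
    (by finiteness), fun z hz t ht => ?_⟩
  have hUo : IsOpen {w : Cn n | ‖1 - inner ℂ z w‖ < t} := isOpen_lt (by fun_prop) continuous_const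
  obtain ⟨e, he, hze⟩ := exists_unit_smul_eq hn z
  set r := ‖z‖ with hr
  have hr0 : 0 ≤ r := norm_nonneg z
  rcases le_or_gt t 1 with ht1 | ht1
  · have hSo : IsOpen {x : Cn n | ‖1 - inner ℂ e x‖ < 2 * t} :=
      isOpen_lt (by fun_prop) continuous_const
    -- The condition |1 - ⟨w,z⟩| < t forces |w| > 1 - t. Projecting both z and w to the sphere
    -- changes the inner product by at most 1 - |z||w| < t, which explains the cap of size 2t.
    have h1 := ρ.measure_cone_le hn (a := 1 - t) (by linarith) (by linarith) hSo.measurableSet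
      hUo.measurableSet (by
        intro w hw hw1 hw0
        have hw0' : 0 < ‖w‖ := norm_pos_iff.2 hw0
        have hin : inner ℂ z w = r * inner ℂ e w := by
          rw [hze, inner_smul_left, Complex.conj_ofReal]
        have hw' : ‖1 - (r : ℂ) * inner ℂ e w‖ < t := by rw [← hin]; exact hw
        set c := inner ℂ e w with hc
        have hcw : ‖c‖ ≤ ‖w‖ := norm_inner_le_of_unit he w
        have h2 : 1 - r * ‖c‖ < t := by
          have := norm_sub_norm_le (1 : ℂ) (r * c)
          rw [norm_one, norm_mul, Complex.norm_real, Real.norm_of_nonneg hr0] at this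
          linarith
        have h3 : r * ‖c‖ ≤ r * ‖w‖ := by gcongr
        have h3' : r * ‖w‖ ≤ 1 * ‖w‖ := by gcongr
        refine ⟨by linarith, ?_⟩
        change ‖1 - inner ℂ e (‖w‖⁻¹ • w)‖ < 2 * t
        have h4 : inner ℂ e (‖w‖⁻¹ • w) = ((‖w‖⁻¹ : ℝ) : ℂ) * c := by
          rw [← Complex.coe_smul ‖w‖⁻¹ w, inner_smul_right]
        have h5 : 1 - ((‖w‖⁻¹ : ℝ) : ℂ) * c =
            (1 - (r : ℂ) * c) - (((1 - r * ‖w‖) * ‖w‖⁻¹ : ℝ) : ℂ) * c := by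
          have : (‖w‖ : ℂ) ≠ 0 := by exact_mod_cast hw0'.ne'
          push_cast
          field_simp
          ring
        rw [h4, h5]
        refine (norm_sub_le _ _).trans_lt ?_
        rw [norm_mul, Complex.norm_real, Real.norm_of_nonneg (by
          apply mul_nonneg _ (by positivity); linarith)]
        have h6 : (1 - r * ‖w‖) * ‖w‖⁻¹ * ‖c‖ ≤ 1 - r * ‖w‖ := by
          rw [mul_assoc]
          apply mul_le_of_le_one_right (by linarith)
          rw [inv_mul_le_iff₀ hw0', mul_one]
          exact hcw
        linarith)
    refine h1.trans ?_
    rw [max_eq_right (by linarith), mul_assoc]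
    refine mul_le_mul_right ?_ _
    calc _ ≤ (ENNReal.ofReal (4 ^ n * t ^ n) * B) * ENNReal.ofReal (ρ.tail (1 - t)) := by
          gcongr
          exact toSphere_cap_le hn he ht ht1
      _ = (ENNReal.ofReal (4 ^ n) * B) * ENNReal.ofReal (t ^ n * ρ.tail (1 - t)) := by
          rw [ENNReal.ofReal_mul (p := 4 ^ n) (by positivity),
            ENNReal.ofReal_mul (p := t ^ n) (by positivity)]
          ring
      _ ≤ _ := mul_le_mul_left le_self_add _
  -- For t > 1 the measure of the whole ball suffices, because t^n ≥ 1.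
  · rw [max_eq_left (by linarith)]
    have h1 := ρ.measure_cone_le hn (a := 0) le_rfl zero_le_one MeasurableSet.univ
      hUo.measurableSet (fun w _ _ hw0 => ⟨norm_pos_iff.2 hw0, mem_univ _⟩)
    refine h1.trans ?_
    rw [mul_assoc, preimage_univ]
    refine mul_le_mul_right (mul_le_mul' le_add_self (ENNReal.ofReal_le_ofReal ?_)) _
    · exact le_mul_of_one_le_left (by linarith [ρ.one_le_tail_zero]) (one_le_pow₀ ht1.le)

variable {ρ}

/-- Split the ball by the dyadic size 2^i(1 - |z|) of |1 - ⟨w,z⟩|. The measure bounds grow like (2^n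
D)^i and the integrand decays like 4^(-Ni). With N large the series is dominated by a geometric one
of ratio 1/2. -/
theorem InClassS.exists_lintegral_one_sub_inner_le (hn : 1 ≤ n) (hρ : ρ.InClassS) :
    ∃ (N : ℕ) (C : ℝ≥0∞), C ≠ ∞ ∧ ∀ z : Cn n, ‖z‖ < 1 →
      ∫⁻ w, ENNReal.ofReal (((‖1 - inner ℂ z w‖ ^ (2 * N)))⁻¹) ∂ρ.measure ≤
        C * ENNReal.ofReal ((1 - ‖z‖) ^ n * ((1 - ‖z‖) ^ (2 * N))⁻¹ * ρ.tail ‖z‖) := by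
  obtain ⟨D, hD, hd⟩ := hρ.exists_tail_doubling
  obtain ⟨C, hC, hCle⟩ := ρ.exists_measure_norm_one_sub_inner_lt_le hn
  obtain ⟨N, hN⟩ := pow_unbounded_of_one_lt (2 * (2 ^ n * D)) (show (1 : ℝ) < 4 by norm_num)
  refine ⟨N, C * (ENNReal.ofReal (2 ^ n * D) * 2), by finiteness, fun z hz => ?_⟩
  set δ := 1 - ‖z‖ with hδdef
  have hδ : 0 < δ := by linarith
  have hT := ρ.tail_pos (norm_nonneg z) hz
  have hiter : ∀ i : ℕ, ρ.tail (max 0 (1 - 2 ^ i * δ)) ≤ D ^ i * ρ.tail ‖z‖ := by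
    intro i
    induction i with
    | zero =>
      rw [pow_zero, pow_zero, one_mul, one_mul, hδdef, sub_sub_cancel, max_eq_right (norm_nonneg z)]
    | succ i ih =>
      have := hd (2 ^ i * δ) (by positivity)
      rw [pow_succ, mul_comm ((2 : ℝ) ^ i), mul_assoc]
      refine this.trans ?_
      rw [pow_succ, mul_comm (D ^ i), mul_assoc]
      gcongr
  set S : ℕ → Set (Cn n) := fun i => {w | ‖1 - inner ℂ z w‖ < 2 ^ (i + 1) * δ} with hS
  have hSm : ∀ i, MeasurableSet (S i) := fun i =>
    (isOpen_lt (by fun_prop) continuous_const).measurableSet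
  have hpt : ∀ᵐ w ∂ρ.measure, ENNReal.ofReal (((‖1 - inner ℂ z w‖ ^ (2 * N)))⁻¹) ≤
      ∑' i, (S i).indicator (fun _ => ENNReal.ofReal (((2 ^ i * δ) ^ (2 * N))⁻¹)) w := by
    filter_upwards [ρ.ae_mem_ball] with w hw
    have hx : δ ≤ ‖1 - inner ℂ z w‖ := by
      have h1 := norm_sub_norm_le (1 : ℂ) (inner ℂ z w)
      have h2 := norm_inner_le_norm (𝕜 := ℂ) z w
      rw [norm_one] at h1
      nlinarith [norm_nonneg z, norm_nonneg w]
    obtain ⟨i, hi1, hi2⟩ := exists_nat_pow_near ((one_le_div hδ).2 hx) (one_lt_two (α := ℝ))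
    rw [le_div_iff₀ hδ] at hi1
    rw [div_lt_iff₀ hδ] at hi2
    refine le_trans ?_ (ENNReal.le_tsum i)
    rw [indicator_of_mem (show w ∈ S i from hi2)]
    refine ENNReal.ofReal_le_ofReal ?_
    gcongr
  have hq : 2 ^ n * D / 4 ^ N ≤ 1 / 2 := by
    rw [div_le_iff₀ (by positivity)]
    linarith
  have hterm : ∀ i : ℕ, ENNReal.ofReal (((2 ^ i * δ) ^ (2 * N))⁻¹) * ρ.measure (S i) ≤
      C * (ENNReal.ofReal (2 ^ n * D) * ENNReal.ofReal (δ ^ n * (δ ^ (2 * N))⁻¹ * ρ.tail ‖z‖)) *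
        (2⁻¹ : ℝ≥0∞) ^ i := by
    intro i
    have h2 : ((2 : ℝ≥0∞)⁻¹) ^ i = ENNReal.ofReal ((1 / 2) ^ i) := by
      rw [ENNReal.ofReal_pow (by norm_num), one_div, ENNReal.ofReal_inv_of_pos two_pos]
      simp
    calc _ ≤ ENNReal.ofReal (((2 ^ i * δ) ^ (2 * N))⁻¹) *
          (C * ENNReal.ofReal ((2 ^ (i + 1) * δ) ^ n * (D ^ (i + 1) * ρ.tail ‖z‖))) := by
          gcongr
          refine (hCle z hz (2 ^ (i + 1) * δ) (by positivity)).trans ?_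
          gcongr
          exact hiter (i + 1)
      _ = C * ENNReal.ofReal (((2 ^ i * δ) ^ (2 * N))⁻¹ *
          ((2 ^ (i + 1) * δ) ^ n * (D ^ (i + 1) * ρ.tail ‖z‖))) := by
          rw [ENNReal.ofReal_mul (p := ((2 ^ i * δ) ^ (2 * N))⁻¹) (by positivity)]
          ring
      _ ≤ C * ENNReal.ofReal ((2 ^ n * D) * (δ ^ n * (δ ^ (2 * N))⁻¹ * ρ.tail ‖z‖) * (1 / 2) ^ i) := by
          refine mul_le_mul_right (ENNReal.ofReal_le_ofReal ?_) _
          have h3 : ((2 ^ i * δ) ^ (2 * N))⁻¹ * ((2 ^ (i + 1) * δ) ^ n * (D ^ (i + 1) * ρ.tail ‖z‖)) =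
              (2 ^ n * D) * (δ ^ n * (δ ^ (2 * N))⁻¹ * ρ.tail ‖z‖) * (2 ^ n * D / 4 ^ N) ^ i := by
            have h4 : (4 : ℝ) ^ N = 2 ^ (2 * N) := by rw [pow_mul]; norm_num
            rw [h4, div_pow, mul_pow, mul_pow, mul_pow, mul_inv, ← pow_mul, ← pow_mul, ← pow_mul,
              ← pow_mul, add_mul, one_mul, pow_add, pow_succ D, mul_comm (2 * N) i, mul_comm n i]
            field_simp
          rw [h3]
          gcongr
      _ = _ := by
          rw [h2, ENNReal.ofReal_mul (q := (1 / 2) ^ i) (by positivity),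
            ENNReal.ofReal_mul (p := 2 ^ n * D) (by positivity)]
          ring
  calc _ ≤ ∫⁻ w, ∑' i, (S i).indicator (fun _ => ENNReal.ofReal (((2 ^ i * δ) ^ (2 * N))⁻¹)) w
        ∂ρ.measure := lintegral_mono_ae hpt
    _ = ∑' i, ENNReal.ofReal (((2 ^ i * δ) ^ (2 * N))⁻¹) * ρ.measure (S i) := by
        rw [lintegral_tsum fun i => (measurable_const.indicator (hSm i)).aemeasurable]
        simp_rw [lintegral_indicator_const (hSm _)]
    _ ≤ ∑' i : ℕ, C * (ENNReal.ofReal (2 ^ n * D) *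
          ENNReal.ofReal (δ ^ n * (δ ^ (2 * N))⁻¹ * ρ.tail ‖z‖)) * (2⁻¹ : ℝ≥0∞) ^ i :=
        ENNReal.tsum_le_tsum hterm
    _ = _ := by
        rw [ENNReal.tsum_mul_left, ENNReal.tsum_geometric]
        simp
        ring

/-- From |G(z)| ≤ ‖K_z‖ ‖G‖ with G(w) = (1 - ⟨w,z⟩)^(-N): the value at z is (1 - |z|²)^(-N), and the
preceding integral bounds the norm. -/
theorem InClassS.exists_kernelSize_le_norm_kernelFun_sq (hn : 1 ≤ n) (hρ : ρ.InClassS) :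
    ∃ C : ℝ, 0 < C ∧ ∀ z : Cn n, ‖z‖ < 1 → ρ.kernelSize z ≤ C * ‖ρ.kernelFun z‖ ^ 2 := by
  classical
  obtain ⟨N, C, hC, hle⟩ := hρ.exists_lintegral_one_sub_inner_le hn
  refine ⟨ρ.tail 0 * (4 ^ N * (C.toReal + 1)), by
    have := ρ.one_le_tail_zero
    positivity, fun z hz => ?_⟩
  set δ := 1 - ‖z‖ with hδdef
  have hδ : 0 < δ := by linarith
  have hT := ρ.tail_pos (norm_nonneg z) hz
  set g : Cn n → ℂ := (ball 0 1).indicator fun w => ((1 - inner ℂ z w) ^ N)⁻¹ with hg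
  have hg0 : ∀ w ∉ ball (0 : Cn n) 1, g w = 0 := fun w hw => indicator_of_notMem hw _
  have hgd : DifferentiableOn ℂ g (ball 0 1) := by
    have h1 : DifferentiableOn ℂ (fun w : Cn n => ((1 - inner ℂ z w) ^ N)⁻¹) (ball 0 1) := by
      refine DifferentiableOn.inv ?_ fun w hw => ?_
      · have : Differentiable ℂ fun w : Cn n => (1 - innerSL ℂ z w) ^ N := by fun_prop
        exact this.differentiableOn
      · exact pow_ne_zero _ (norm_pos_iff.1 (norm_one_sub_inner_pos hz (mem_ball_zero_iff.1 hw)))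
    exact h1.congr fun w hw => indicator_of_mem hw _
  have hgm := measurable_of_mem hgd hg0
  have hsq : ∫⁻ w, ‖g w‖ₑ ^ 2 ∂ρ.measure ≤
      C * ENNReal.ofReal (δ ^ n * (δ ^ (2 * N))⁻¹ * ρ.tail ‖z‖) := by
    refine (lintegral_mono_ae ?_).trans (hle z hz)
    filter_upwards [ρ.ae_mem_ball] with w hw
    rw [hg, indicator_of_mem (mem_ball_zero_iff.2 hw), ← ofReal_norm,
      ← ENNReal.ofReal_pow (norm_nonneg _), norm_inv, norm_pow, inv_pow, ← pow_mul, mul_comm N]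
  have hgL : MemLp g 2 ρ.measure := by
    refine ⟨hgm.aestronglyMeasurable, ?_⟩
    rw [eLpNorm_lt_top_iff_lintegral_rpow_enorm_lt_top (by norm_num) (by norm_num)]
    simp only [ENNReal.toReal_ofNat, ENNReal.rpow_ofNat]
    exact hsq.trans_lt (by finiteness)
  let G : BergmanSpace ρ := ⟨g, hgd, hg0, hgL⟩
  have hG : ‖G‖ ^ 2 ≤ C.toReal * (δ ^ n * (δ ^ (2 * N))⁻¹ * ρ.tail ‖z‖) := by
    have h1 : ‖G‖ₑ ^ 2 ≤ C * ENNReal.ofReal (δ ^ n * (δ ^ (2 * N))⁻¹ * ρ.tail ‖z‖) := by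
      rw [← BergmanSpace.lintegral_enorm_sq]; exact hsq
    have h2 := ENNReal.toReal_mono (by finiteness) h1
    rwa [ENNReal.toReal_mul, ENNReal.toReal_pow, toReal_enorm,
      ENNReal.toReal_ofReal (by positivity)] at h2
  have hGz : ((2 * δ) ^ (2 * N))⁻¹ ≤ ‖G z‖ ^ 2 := by
    have h1 : G z = ((1 - inner ℂ z z) ^ N)⁻¹ :=
      (show g z = _ from indicator_of_mem (mem_ball_zero_iff.2 hz) _)
    have h2 : (1 : ℂ) - inner ℂ z z = ((1 - ‖z‖ ^ 2 : ℝ) : ℂ) := by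
      rw [inner_self_eq_norm_sq_to_K]; push_cast; rfl
    have h3 : 0 < 1 - ‖z‖ ^ 2 := by nlinarith [norm_nonneg z]
    rw [h1, h2, norm_inv, norm_pow, Complex.norm_real, Real.norm_of_nonneg h3.le, inv_pow, ← pow_mul,
      mul_comm N]
    gcongr
    nlinarith [norm_nonneg z]
  have hev := norm_apply_le G z
  have h1 : ((2 * δ) ^ (2 * N))⁻¹ ≤ ‖ρ.kernelFun z‖ ^ 2 *
      ((C.toReal + 1) * (δ ^ n * (δ ^ (2 * N))⁻¹ * ρ.tail ‖z‖)) := by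
    calc _ ≤ ‖G z‖ ^ 2 := hGz
      _ ≤ (‖ρ.kernelFun z‖ * ‖G‖) ^ 2 := by gcongr
      _ = ‖ρ.kernelFun z‖ ^ 2 * ‖G‖ ^ 2 := by ring
      _ ≤ _ := by
        gcongr
        refine hG.trans ?_
        gcongr
        linarith
  have h4 : (2 : ℝ) ^ (2 * N) = 4 ^ N := by rw [pow_mul]; norm_num
  rw [mul_pow, mul_inv, h4] at h1
  have h5 : (δ ^ n)⁻¹ * (ρ.tail ‖z‖)⁻¹ ≤ 4 ^ N * (C.toReal + 1) * ‖ρ.kernelFun z‖ ^ 2 := by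
    have hP : 0 < δ ^ (2 * N) * 4 ^ N * ((δ ^ n)⁻¹ * (ρ.tail ‖z‖)⁻¹) := by positivity
    calc (δ ^ n)⁻¹ * (ρ.tail ‖z‖)⁻¹ = ((4 ^ N)⁻¹ * (δ ^ (2 * N))⁻¹) *
          (δ ^ (2 * N) * 4 ^ N * ((δ ^ n)⁻¹ * (ρ.tail ‖z‖)⁻¹)) := by field_simp
      _ ≤ (‖ρ.kernelFun z‖ ^ 2 * ((C.toReal + 1) * (δ ^ n * (δ ^ (2 * N))⁻¹ * ρ.tail ‖z‖))) *
          (δ ^ (2 * N) * 4 ^ N * ((δ ^ n)⁻¹ * (ρ.tail ‖z‖)⁻¹)) := by gcongr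
      _ = _ := by field_simp
  calc ρ.kernelSize z ≤ ρ.tail 0 / ρ.tail ‖z‖ / δ ^ n := by
        rw [kernelSize, ← hδdef]
        gcongr
        exact ρ.two_pow_shell_le hz
    _ = ρ.tail 0 * ((δ ^ n)⁻¹ * (ρ.tail ‖z‖)⁻¹) := by field_simp
    _ ≤ ρ.tail 0 * (4 ^ N * (C.toReal + 1) * ‖ρ.kernelFun z‖ ^ 2) := by
        have := ρ.one_le_tail_zero
        gcongr
    _ = _ := by ring

/-! ### The normalized kernel near the diagonal -/

theorem kernelFun_apply_le (z w : Cn n) :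
    ‖ρ.kernelFun z w‖ ≤ ‖ρ.kernelFun w‖ * ‖ρ.kernelFun z‖ :=
  norm_apply_le _ _

theorem norm_normKernelFun_apply_sq (z w : Cn n) :
    ‖ρ.normKernelFun z w‖ ^ 2 = (‖ρ.kernelFun z‖ ^ 2)⁻¹ * ‖ρ.kernelFun z w‖ ^ 2 := by
  have : ρ.normKernelFun z w = (‖ρ.kernelFun z‖ : ℂ)⁻¹ * ρ.kernelFun z w := rfl
  rw [this, norm_mul, norm_inv, Complex.norm_real, norm_norm, mul_pow, inv_pow]

theorem norm_normKernelFun_le_one (z : Cn n) : ‖ρ.normKernelFun z‖ ≤ 1 := by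
  rw [normKernelFun, norm_smul, norm_inv, Complex.norm_real, norm_norm]
  exact inv_mul_le_one

/-- On sufficiently small Bergman balls the normalized kernel is as large as at the center. -/
theorem InClassSStar.exists_le_norm_normKernelFun_sq (hn : 1 ≤ n) (hρ : ρ.InClassSStar) :
    ∃ α₀ : ℝ, 0 < α₀ ∧ ∃ C : ℝ, 0 < C ∧ ∀ z : Cn n, ‖z‖ < 1 → ∀ w ∈ bergmanBall z α₀,
      ρ.kernelSize z ≤ C * ‖ρ.normKernelFun z w‖ ^ 2 ∧ ρ.kernelSize z ≤ C * ρ.kernelSize w := by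
  obtain ⟨C₁, hC₁, h₁⟩ := hρ.exists_norm_kernelFun_sq_le hn
  obtain ⟨C₂, hC₂, h₂⟩ := hρ.1.exists_kernelSize_le
  obtain ⟨C₃, hC₃, h₃⟩ := hρ.1.exists_kernelSize_le_norm_kernelFun_sq hn
  set B := C₁ * (C₂ * C₃) + 1 with hB
  have hB1 : 1 ≤ B := by
    have : 0 < C₁ * (C₂ * C₃) := by positivity
    linarith
  -- Frame coordinates satisfy ‖x‖ ≤ 4τ. The first bound keeps them below 1/10. By the second, the
  -- Schwarz factor 10(B + 1)‖K_z‖² times ‖x‖ is at most ‖K_z‖²/2.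
  set τ : ℝ := min (1 / 50) (1 / (80 * (B + 1))) with hτdef
  have hτ0 : 0 < τ := lt_min (by norm_num) (by positivity)
  have hτ1 : τ ≤ 1 / 50 := min_le_left _ _
  have hτ2 : τ ≤ 1 / (80 * (B + 1)) := min_le_right _ _
  have hτ : τ ∈ Ioo (0 : ℝ) 1 := ⟨hτ0, by linarith⟩
  have hα₀ : 0 < 1 / 2 * Real.log ((1 + τ) / (1 - τ)) := by
    have := (half_log_lt_half_log_iff le_rfl zero_lt_one hτ.1.le hτ.2).2 hτ.1
    simpa using this
  refine ⟨_, hα₀, max (4 * C₃) C₂, lt_max_of_lt_right hC₂, fun z hz w hw => ?_⟩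
  obtain ⟨hw1, hwm⟩ := (mem_bergmanBall_iff hn hτ hz w).1 hw
  obtain ⟨e, he, hze⟩ := exists_unit_smul_eq hn z
  set r := ‖z‖ with hr
  have hr0 : 0 ≤ r := norm_nonneg z
  rw [hze] at hwm
  obtain ⟨x, hx, rfl⟩ := exists_nearPoint_eq he hr0 hz hw1 (by linarith) hwm
  have hx1 : ‖x‖ < 1 / 10 := by linarith
  have hdiff : Differentiable ℂ (nearPoint e r) := by unfold nearPoint; fun_prop
  have hzero : nearPoint e r 0 = z := by rw [nearPoint, map_zero, add_zero, ← hze]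
  have hball : ∀ x : Cn n, ‖x‖ ≤ 1 / 10 → ‖nearPoint e r x‖ < 1 := fun x hx => by
    have := (norm_nearPoint_bounds he hr0 hz hx).1
    linarith
  set k := ‖ρ.kernelFun z‖ with hk
  have hk0 : 0 ≤ k := norm_nonneg _
  have hbd : ∀ y : Cn n, ‖y‖ < 1 / 10 → ‖ρ.kernelFun z (nearPoint e r y)‖ ≤ B * k ^ 2 := by
    intro y hy
    have hb := norm_nearPoint_bounds he hr0 hz hy.le
    have h4 : ‖ρ.kernelFun (nearPoint e r y)‖ ^ 2 ≤ (B * k) ^ 2 := by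
      calc _ ≤ C₁ * (C₂ * (C₃ * k ^ 2)) := by
            refine (h₁ _ (hball y hy.le)).trans ?_
            gcongr
            refine (h₂ z _ hz (hball y hy.le) hb.1).trans ?_
            gcongr
            exact h₃ z hz
        _ ≤ B * k ^ 2 := by rw [hB]; nlinarith [sq_nonneg k]
        _ ≤ _ := by
          rw [mul_pow]
          gcongr
          nlinarith
    have h5 := (pow_le_pow_iff_left₀ (norm_nonneg _) (by positivity) two_ne_zero).1 h4
    calc _ ≤ _ := kernelFun_apply_le _ _
      _ ≤ B * k * k := by gcongr
      _ = _ := by ring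
  have hz0 : ‖ρ.kernelFun z z‖ = k ^ 2 := (norm_kernelFun_sq z).symm
  -- By Cauchy-Schwarz and the two-sided kernel bounds, |K_z| ≤ B‖K_z‖² on the frame. As K_z(z) =
  -- ‖K_z‖², K_z maps the frame into a ball of radius (B + 1)‖K_z‖² about that value.
  have hschwarz := Complex.dist_le_div_mul_dist_of_mapsTo_ball
    (f := fun y => ρ.kernelFun z (nearPoint e r y)) (c := 0) (R₁ := 1 / 10)
    (R₂ := (B + 1) * k ^ 2) (z := x)
    ((ρ.kernelFun z).2.1.comp hdiff.differentiableOn fun y hy => by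
      simpa using hball y (by simpa using (mem_ball_zero_iff.1 hy).le))
    (fun y hy => by
      rw [mem_closedBall, dist_eq_norm, hzero]
      refine (norm_sub_le _ _).trans ?_
      rw [hz0]
      linarith [hbd y (mem_ball_zero_iff.1 hy)]) (by simpa using hx1)
  rw [dist_eq_norm, dist_zero_right, hzero] at hschwarz
  have h6 : ‖ρ.kernelFun z (nearPoint e r x) - ρ.kernelFun z z‖ ≤ k ^ 2 / 2 := by
    refine hschwarz.trans ?_
    have h7 : ‖x‖ ≤ 4 * (1 / (80 * (B + 1))) := hx.trans (by gcongr)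
    calc (B + 1) * k ^ 2 / (1 / 10) * ‖x‖
        ≤ (B + 1) * k ^ 2 / (1 / 10) * (4 * (1 / (80 * (B + 1)))) := by gcongr
      _ = k ^ 2 / 2 := by field_simp; ring
  have h8 : k ^ 2 / 2 ≤ ‖ρ.kernelFun z (nearPoint e r x)‖ := by
    have := norm_sub_norm_le (ρ.kernelFun z z) (ρ.kernelFun z z - ρ.kernelFun z (nearPoint e r x))
    rw [sub_sub_cancel, norm_sub_rev, hz0] at this
    linarith
  have hkpos : 0 < k ^ 2 := by
    have := (kernelSize_pos (ρ := ρ) hz).trans_le (h₃ z hz)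
    exact pos_of_mul_pos_right this hC₃.le
  constructor
  · rw [norm_normKernelFun_apply_sq, ← hk]
    have h9 : k ^ 2 ≤ 4 * ((k ^ 2)⁻¹ * ‖ρ.kernelFun z (nearPoint e r x)‖ ^ 2) := by
      have : (k ^ 2 / 2) ^ 2 ≤ ‖ρ.kernelFun z (nearPoint e r x)‖ ^ 2 := by gcongr
      calc k ^ 2 = 4 * ((k ^ 2)⁻¹ * (k ^ 2 / 2) ^ 2) := by field_simp; ring
        _ ≤ _ := by gcongr
    calc _ ≤ C₃ * k ^ 2 := h₃ z hz
      _ ≤ C₃ * (4 * ((k ^ 2)⁻¹ * ‖ρ.kernelFun z (nearPoint e r x)‖ ^ 2)) := by gcongr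
      _ = 4 * C₃ * ((k ^ 2)⁻¹ * ‖ρ.kernelFun z (nearPoint e r x)‖ ^ 2) := by ring
      _ ≤ _ := by
        gcongr
        exact le_max_left _ _
  · refine (h₂ _ z hw1 hz (norm_nearPoint_bounds he hr0 hz hx1.le).2).trans ?_
    have := kernelSize_pos (ρ := ρ) hw1
    gcongr
    exact le_max_right _ _

/-! ### Measurability of the kernel, the Berezin transform and the averages -/

variable (ρ) in
theorem measurable_shell : Measurable ρ.shell := by
  classical
  -- Off the ball no index qualifies and the infimum defaults to 0. The second alternative makes
  -- `Nat.find` total with that same value.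
  have hp : ∀ z : Cn n, ∃ k, ‖z‖ < ρ.radius (k + 1) ∨ 1 ≤ ‖z‖ := fun z => by
    rcases lt_or_ge ‖z‖ 1 with h | h
    · obtain ⟨k, hk⟩ := ρ.exists_lt_radius (norm_nonneg z) h
      exact ⟨k, Or.inl hk⟩
    · exact ⟨0, Or.inr h⟩
  have h : ρ.shell = fun z => Nat.find (hp z) := by
    ext z
    rw [shell]
    rcases lt_or_ge ‖z‖ 1 with h | h
    · have hne : {k | ‖z‖ < ρ.radius (k + 1)}.Nonempty := ρ.exists_lt_radius (norm_nonneg z) h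
      refine le_antisymm (Nat.sInf_le ?_) (Nat.find_min' _ (Or.inl (Nat.sInf_mem hne)))
      exact (Nat.find_spec (hp z)).resolve_right (not_le.2 h)
    · have : {k | ‖z‖ < ρ.radius (k + 1)} = ∅ := by
        ext k
        simp only [mem_ofPred_eq, mem_empty_iff_false, iff_false, not_lt]
        exact (ρ.radius_spec (k + 1)).1.2.le.trans h
      rw [this, Nat.sInf_empty]
      exact (Nat.le_zero.1 (Nat.find_min' (hp z) (Or.inr h))).symm
  rw [h]
  refine measurable_find hp fun k => ?_
  exact (measurableSet_lt measurable_norm measurable_const).union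
    (measurableSet_le measurable_const measurable_norm)

variable (ρ) in
theorem measurable_kernelSize : Measurable ρ.kernelSize :=
  ((measurable_of_countable fun k : ℕ => (2 : ℝ) ^ k).comp ρ.measurable_shell).div
    ((measurable_norm.const_sub 1).pow_const n)

theorem measurable_measure_bergmanBall (μ : Measure (Cn n)) [SFinite μ] (α : ℝ) :
    Measurable fun z => μ (bergmanBall z α) :=
  measurable_measure_prodMk_left (measurableSet_bergmanBall_prod α)

variable (ρ) in
theorem average_eq (μ : Measure (Cn n)) (α : ℝ) (z : Cn n) :
    ρ.average μ α z = ρ.kernelSize z * μ.real (bergmanBall z α) := by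
  rw [average, kernelSize]; ring

variable (ρ) in
theorem measurable_average (μ : Measure (Cn n)) [SFinite μ] (α : ℝ) :
    Measurable (ρ.average μ α) := by
  have : ρ.average μ α = fun z => ρ.kernelSize z * μ.real (bergmanBall z α) :=
    funext (ρ.average_eq μ α)
  rw [this]
  exact ρ.measurable_kernelSize.mul (measurable_measure_bergmanBall μ α).ennreal_toReal

variable (ρ) in
-- For g = K_b - K_a the reproducing property gives ‖g‖² = g(b) - g(a), which is at most C‖g‖‖b - a‖
-- by the local derivative bound. Cancelling ‖g‖ shows that z ↦ K_z is locally Lipschitz.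
theorem continuousOn_kernelFun : ContinuousOn ρ.kernelFun (ball 0 1) := by
  intro z hz
  have hz1 : ‖z‖ < 1 := by simpa using hz
  obtain ⟨r, hr, hr1⟩ := exists_between hz1
  obtain ⟨C, hC, h⟩ := BergmanSpace.norm_fderiv_le (ρ := ρ) hr1
  have hle : ∀ a ∈ closedBall (0 : Cn n) r, ∀ b ∈ closedBall (0 : Cn n) r,
      ‖ρ.kernelFun b - ρ.kernelFun a‖ ≤ C * ‖b - a‖ := by
    intro a ha b hb
    set g := ρ.kernelFun b - ρ.kernelFun a with hg
    have h1 : ‖g b - g a‖ ≤ C * ‖g‖ * ‖b - a‖ := by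
      refine (convex_closedBall (0 : Cn n) r).norm_image_sub_le_of_norm_fderiv_le (𝕜 := ℂ)
        (f := g.1) (fun x hx => ?_) (fun x hx => h g x hx) ha hb
      refine g.2.1.differentiableAt (isOpen_ball.mem_nhds ?_)
      exact closedBall_subset_ball hr1 hx
    have h2 : inner ℂ g g = g b - g a := by
      conv_lhs => rw [hg, inner_sub_left, inner_kernelFun, inner_kernelFun]
    have h3 : ‖g‖ ^ 2 = ‖g b - g a‖ := by
      rw [← h2, inner_self_eq_norm_sq_to_K]
      simp
    rcases eq_or_ne ‖g‖ 0 with h0 | h0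
    · rw [h0]; positivity
    · have h4 : 0 < ‖g‖ := (norm_nonneg _).lt_of_ne' h0
      refine le_of_mul_le_mul_right ?_ h4
      calc ‖g‖ * ‖g‖ = ‖g‖ ^ 2 := by ring
        _ ≤ C * ‖g‖ * ‖b - a‖ := h3.trans_le h1
        _ = _ := by ring
  have hlip : LipschitzOnWith ⟨C, hC⟩ ρ.kernelFun (closedBall 0 r) :=
    LipschitzOnWith.of_dist_le_mul fun b hb a ha => by
      rw [dist_eq_norm, dist_eq_norm]
      exact hle a ha b hb
  have hnhds : closedBall (0 : Cn n) r ∈ 𝓝 z :=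
    mem_of_superset (isOpen_ball.mem_nhds (by simpa using hr)) ball_subset_closedBall
  exact (hlip.continuousOn.continuousAt hnhds).continuousWithinAt

theorem kernelFun_eq_zero {z : Cn n} (hz : z ∉ ball (0 : Cn n) 1) : ρ.kernelFun z = 0 := by
  have h : inner ℂ (ρ.kernelFun z) (ρ.kernelFun z) = 0 := by
    rw [inner_kernelFun]
    exact (ρ.kernelFun z).2.2.1 z hz
  simpa using h

variable (ρ) in
theorem measurable_kernelFun : Measurable fun p : Cn n × Cn n => ρ.kernelFun p.1 p.2 := by
  classical
  have h1 : ContinuousOn (fun p : Cn n × Cn n => ρ.kernelFun p.1 p.2) (ball 0 1 ×ˢ ball 0 1) := by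
    have : (fun p : Cn n × Cn n => ρ.kernelFun p.1 p.2) =
        fun p => inner ℂ (ρ.kernelFun p.2) (ρ.kernelFun p.1) := by
      ext p; rw [inner_kernelFun]
    rw [this]
    exact (ρ.continuousOn_kernelFun.comp continuousOn_snd fun p hp => hp.2).inner
      (ρ.continuousOn_kernelFun.comp continuousOn_fst fun p hp => hp.1)
  have h2 := h1.measurable_piecewise (g := 0) continuousOn_const
    (measurableSet_ball.prod measurableSet_ball)
  convert h2 using 1
  ext p
  by_cases hp : p ∈ ball (0 : Cn n) 1 ×ˢ ball (0 : Cn n) 1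
  · rw [piecewise_eq_of_mem _ _ _ hp]
  · rw [piecewise_eq_of_notMem _ _ _ hp, Pi.zero_apply]
    rw [mem_prod, not_and_or] at hp
    rcases hp with hp | hp
    · rw [kernelFun_eq_zero hp]; rfl
    · exact (ρ.kernelFun p.1).2.2.1 _ hp

variable (ρ) in
theorem measurable_norm_kernelFun : Measurable fun z : Cn n => ‖ρ.kernelFun z‖ := by
  have : (fun z : Cn n => ‖ρ.kernelFun z‖) = fun z => √‖ρ.kernelFun z z‖ := by
    ext z
    rw [← norm_kernelFun_sq, Real.sqrt_sq (norm_nonneg _)]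
  rw [this]
  exact Real.continuous_sqrt.measurable.comp
    (ρ.measurable_kernelFun.comp (measurable_id.prodMk measurable_id)).norm

variable (ρ) in
theorem measurable_berezin (μ : Measure (Cn n)) [SFinite μ] : Measurable (ρ.berezin μ) := by
  have h : Measurable fun p : Cn n × Cn n => ‖ρ.normKernelFun p.1 p.2‖ₑ ^ 2 := by
    have h1 : Measurable fun p : Cn n × Cn n => (‖ρ.kernelFun p.1‖ : ℂ)⁻¹ * ρ.kernelFun p.1 p.2 :=
      (Complex.measurable_ofReal.comp
        (ρ.measurable_norm_kernelFun.comp measurable_fst)).inv.mul ρ.measurable_kernelFun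
    exact h1.enorm.pow_const 2
  exact h.lintegral_prod_right'

variable (ρ) in
theorem lintegral_lambdaMeasure {g : Cn n → ℝ≥0∞} (hg : Measurable g) :
    ∫⁻ z, g z ∂ρ.lambdaMeasure = ∫⁻ z, ENNReal.ofReal (ρ.kernelSize z) * g z ∂ρ.measure := by
  have hk := ρ.measurable_kernelSize
  have heq : ∀ z ∈ ball (0 : Cn n) 1, ENNReal.ofReal (2 ^ ρ.shell z * ρ ‖z‖ / (1 - ‖z‖) ^ n) =
      ENNReal.ofReal (ρ ‖z‖) * ENNReal.ofReal (ρ.kernelSize z) := fun z hz => by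
    have hz1 : ‖z‖ < 1 := by simpa using hz
    rw [← ENNReal.ofReal_mul (ρ.pos _ ⟨norm_nonneg z, hz1⟩).le, kernelSize]
    congr 1
    ring
  have hae : AEMeasurable (fun z => ENNReal.ofReal (2 ^ ρ.shell z * ρ ‖z‖ / (1 - ‖z‖) ^ n))
      (volume.restrict (ball (0 : Cn n) 1)) :=
    ((ρ.aemeasurable_comp_norm measurableSet_ball Subset.rfl).mul
      hk.ennreal_ofReal.aemeasurable).congr
      ((ae_restrict_mem measurableSet_ball).mono fun z hz => (heq z hz).symm)
  have hae' : AEMeasurable (fun z => ENNReal.ofReal (2 ^ ρ.shell z * ρ ‖z‖ / (1 - ‖z‖) ^ n))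
      (ballVolume n) := hae.smul_measure _
  rw [lintegral_measure _ (fun z => ENNReal.ofReal (ρ.kernelSize z) * g z)
      (hk.ennreal_ofReal.mul hg), lambdaMeasure,
    lintegral_withDensity_eq_lintegral_mul₀ hae' hg.aemeasurable, ballVolume,
    lintegral_smul_measure, smul_eq_mul]
  congr 1
  refine setLIntegral_congr_fun measurableSet_ball fun z hz => ?_
  rw [Pi.mul_apply, heq z hz, mul_assoc]

variable (ρ) in
theorem ae_lambdaMeasure_mem_ball : ∀ᵐ z ∂ρ.lambdaMeasure, ‖z‖ < 1 := by
  have h : ∀ᵐ z ∂ballVolume n, ‖z‖ < 1 := by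
    refine (Measure.ae_smul_measure_le _) ?_
    filter_upwards [ae_restrict_mem measurableSet_ball] with z hz
    simpa using hz
  exact (withDensity_absolutelyContinuous _ _) h

/-! ### The implications between the Toeplitz operator, its Berezin transform and the averages -/

theorem memLp_ofReal_iff {α E : Type*} [MeasurableSpace α] [TopologicalSpace E]
    [ContinuousENorm E] {μ : Measure α} {f : α → E} (hf : AEStronglyMeasurable f μ) {p : ℝ}
    (hp : 0 < p) : MemLp f (ENNReal.ofReal p) μ ↔ ∫⁻ x, ‖f x‖ₑ ^ p ∂μ < ∞ := by
  rw [MemLp, eLpNorm_lt_top_iff_lintegral_rpow_enorm_lt_top (by simpa using hp)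
    ENNReal.ofReal_ne_top, ENNReal.toReal_ofReal hp.le]
  exact and_iff_right hf

theorem enorm_sq_eq_ofReal (c : ℂ) : ‖c‖ₑ ^ 2 = ENNReal.ofReal (‖c‖ ^ 2) := by
  rw [ENNReal.ofReal_pow (norm_nonneg _), ofReal_norm]

/-- The Berezin transform of a Toeplitz operator in `S_p` is in `L^p(λ_ρ)`. -/
theorem InClassSStar.memLp_berezin (hn : 1 ≤ n) (hρ : ρ.InClassSStar) {μ : Measure (Cn n)}
    [SFinite μ] {p : ℝ} (hp : 1 < p) {T : BergmanSpace ρ →L[ℂ] BergmanSpace ρ}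
    (hT : ρ.IsToeplitz μ T) (hS : InSchattenClass p T) :
    MemLp (ρ.berezin μ) (ENNReal.ofReal p) ρ.lambdaMeasure := by
  obtain ⟨-, ι, s, e, f, hs, he, hf, hsum, hsp⟩ := hS
  obtain ⟨C, hC, hCle⟩ := hρ.1.exists_kernelSize_le_norm_kernelFun_sq hn
  have hp0 : 0 < p := by linarith
  have hbm := ρ.measurable_berezin μ
  -- Countability, needed to exchange sum and integral, follows from summability of strictly
  -- positive terms.
  have : Countable ι := by
    have h := hsp.countable_support
    have h2 : Function.support (fun i => s i ^ p) = univ := by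
      ext i
      simpa using (Real.rpow_pos_of_pos (hs i) p).ne'
    rw [h2] at h
    exact Set.countable_univ_iff.1 h
  rw [memLp_ofReal_iff hbm.aestronglyMeasurable hp0]
  simp only [enorm_eq_self]
  rw [lintegral_lambdaMeasure ρ (hbm.pow_const p)]
  -- The factor Q(z) undoes the normalization by ‖K_z‖, leaving |g(z)|², whose integral is ‖g‖².
  have hev : ∀ (g : BergmanSpace ρ) (z : Cn n), ‖z‖ < 1 →
      ENNReal.ofReal (ρ.kernelSize z) * ‖inner ℂ g (ρ.normKernelFun z)‖ₑ ^ 2 ≤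
        ENNReal.ofReal C * ‖g z‖ₑ ^ 2 := by
    intro g z hz
    have h1 : ‖inner ℂ g (ρ.normKernelFun z)‖ = ‖ρ.kernelFun z‖⁻¹ * ‖g z‖ := by
      rw [normKernelFun, inner_smul_right, norm_mul, norm_inv, Complex.norm_real, norm_norm,
        norm_inner_symm, inner_kernelFun]
    have hk := kernelSize_pos (ρ := ρ) hz
    rw [enorm_sq_eq_ofReal, enorm_sq_eq_ofReal, ← ENNReal.ofReal_mul hk.le,
      ← ENNReal.ofReal_mul hC.le, h1]
    refine ENNReal.ofReal_le_ofReal ?_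
    have h2 := hCle z hz
    have h3 : 0 < ‖ρ.kernelFun z‖ ^ 2 := pos_of_mul_pos_right (hk.trans_le h2) hC.le
    have h4 : ‖ρ.kernelFun z‖ ≠ 0 := fun h0 => by simp [h0] at h3
    calc ρ.kernelSize z * (‖ρ.kernelFun z‖⁻¹ * ‖g z‖) ^ 2
        ≤ C * ‖ρ.kernelFun z‖ ^ 2 * (‖ρ.kernelFun z‖⁻¹ * ‖g z‖) ^ 2 := by gcongr
      _ = C * ‖g z‖ ^ 2 := by
        rw [mul_pow, inv_pow]
        field_simp
  have hpt : ∀ᵐ z ∂ρ.measure, ENNReal.ofReal (ρ.kernelSize z) * ρ.berezin μ z ^ p ≤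
      ∑' i, ENNReal.ofReal (s i ^ p) * (ENNReal.ofReal C * (‖e i z‖ₑ ^ 2 + ‖f i z‖ₑ ^ 2)) := by
    filter_upwards [ρ.ae_mem_ball] with z hz
    obtain ⟨hfin, hin⟩ := hT.inner_normKernelFun (mem_ball_zero_iff.2 hz)
    have h1 : ρ.berezin μ z = ‖inner ℂ (ρ.normKernelFun z) (T (ρ.normKernelFun z))‖ₑ := by
      rw [hin, ← ofReal_norm, Complex.norm_real, Real.norm_of_nonneg ENNReal.toReal_nonneg,
        ENNReal.ofReal_toReal hfin.ne]
    rw [h1]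
    calc _ ≤ ENNReal.ofReal (ρ.kernelSize z) * ∑' i, ENNReal.ofReal (s i ^ p) *
          (‖inner ℂ (e i) (ρ.normKernelFun z)‖ₑ ^ 2 + ‖inner ℂ (f i) (ρ.normKernelFun z)‖ₑ ^ 2) := by
          gcongr
          exact enorm_inner_rpow_le_tsum hs he hf (norm_normKernelFun_le_one z) (hsum _) hp.le
      _ = ∑' i, ENNReal.ofReal (s i ^ p) *
          (ENNReal.ofReal (ρ.kernelSize z) * ‖inner ℂ (e i) (ρ.normKernelFun z)‖ₑ ^ 2 +
            ENNReal.ofReal (ρ.kernelSize z) * ‖inner ℂ (f i) (ρ.normKernelFun z)‖ₑ ^ 2) := by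
          rw [← ENNReal.tsum_mul_left]
          refine tsum_congr fun i => ?_
          ring
      _ ≤ _ := by
          refine ENNReal.tsum_le_tsum fun i => ?_
          rw [mul_add (ENNReal.ofReal C)]
          exact mul_le_mul_right (add_le_add (hev _ z hz) (hev _ z hz)) _
  have hnorm : ∀ g : BergmanSpace ρ, ‖g‖ = 1 → ∫⁻ z, ‖g z‖ₑ ^ 2 ∂ρ.measure = 1 := fun g hg => by
    rw [BergmanSpace.lintegral_enorm_sq, ← ofReal_norm, hg]
    simp
  have hmeas : ∀ g : BergmanSpace ρ, Measurable fun z => ‖g z‖ₑ ^ 2 := fun g =>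
    g.measurable_coe.enorm.pow_const 2
  refine (lintegral_mono_ae hpt).trans_lt ?_
  have hterm_meas : ∀ i, Measurable fun z =>
      ENNReal.ofReal (s i ^ p) * (ENNReal.ofReal C * (‖e i z‖ₑ ^ 2 + ‖f i z‖ₑ ^ 2)) := fun i =>
    (((hmeas (e i)).add (hmeas (f i))).const_mul _).const_mul _
  rw [lintegral_tsum fun i => (hterm_meas i).aemeasurable]
  have hterm : ∀ i, ∫⁻ z, ENNReal.ofReal (s i ^ p) *
      (ENNReal.ofReal C * (‖e i z‖ₑ ^ 2 + ‖f i z‖ₑ ^ 2)) ∂ρ.measure =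
      ENNReal.ofReal (s i ^ p) * (ENNReal.ofReal C * 2) := fun i => by
    rw [lintegral_const_mul' _ _ ENNReal.ofReal_ne_top,
      lintegral_const_mul' _ _ ENNReal.ofReal_ne_top, lintegral_add_left (hmeas _),
      hnorm _ (he.1 i), hnorm _ (hf.1 i), one_add_one_eq_two]
  simp_rw [hterm]
  rw [ENNReal.tsum_mul_right, ← ENNReal.ofReal_tsum_of_nonneg
    (fun i => (Real.rpow_pos_of_pos (hs i) p).le) hsp]
  finiteness

/-- If `μ̂` is dominated by the Berezin transform on Bergman balls of radius `α`, integrability of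
the latter implies that of the former. -/
theorem memLp_average_of_memLp_berezin {μ : Measure (Cn n)} [IsFiniteMeasure μ] {p α C : ℝ}
    (hp : 1 < p) (hC : 0 < C) (hle : ∀ z : Cn n, ‖z‖ < 1 → ∀ w ∈ bergmanBall z α,
      ρ.kernelSize z ≤ C * ‖ρ.normKernelFun z w‖ ^ 2)
    (hb : MemLp (ρ.berezin μ) (ENNReal.ofReal p) ρ.lambdaMeasure) :
    MemLp (ρ.average μ α) (ENNReal.ofReal p) ρ.lambdaMeasure := by
  have hp0 : 0 < p := by linarith
  rw [memLp_ofReal_iff (ρ.measurable_berezin μ).aestronglyMeasurable hp0] at hb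
  rw [memLp_ofReal_iff (ρ.measurable_average μ α).aestronglyMeasurable hp0]
  have hpt : ∀ z : Cn n, ‖z‖ < 1 → ‖ρ.average μ α z‖ₑ ≤ ENNReal.ofReal C * ρ.berezin μ z := by
    intro z hz
    have hk := kernelSize_pos (ρ := ρ) hz
    rw [average_eq, enorm_mul, Real.enorm_of_nonneg hk.le, Real.enorm_of_nonneg measureReal_nonneg,
      ofReal_measureReal]
    calc ENNReal.ofReal (ρ.kernelSize z) * μ (bergmanBall z α)
        = ∫⁻ w in bergmanBall z α, ENNReal.ofReal (ρ.kernelSize z) ∂μ := by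
          rw [setLIntegral_const]
      _ ≤ ∫⁻ w in bergmanBall z α, ENNReal.ofReal C * ‖ρ.normKernelFun z w‖ₑ ^ 2 ∂μ := by
          refine setLIntegral_mono' (measurableSet_bergmanBall z α) fun w hw => ?_
          rw [enorm_sq_eq_ofReal, ← ENNReal.ofReal_mul hC.le]
          exact ENNReal.ofReal_le_ofReal (hle z hz w hw)
      _ ≤ ∫⁻ w, ENNReal.ofReal C * ‖ρ.normKernelFun z w‖ₑ ^ 2 ∂μ := setLIntegral_le_lintegral _ _
      _ = _ := lintegral_const_mul' _ _ ENNReal.ofReal_ne_top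
  calc ∫⁻ z, ‖ρ.average μ α z‖ₑ ^ p ∂ρ.lambdaMeasure
      ≤ ∫⁻ z, ENNReal.ofReal C ^ p * ‖ρ.berezin μ z‖ₑ ^ p ∂ρ.lambdaMeasure := by
        refine lintegral_mono_ae ?_
        filter_upwards [ρ.ae_lambdaMeasure_mem_ball] with z hz
        rw [← ENNReal.mul_rpow_of_nonneg _ _ hp0.le, enorm_eq_self]
        exact ENNReal.rpow_le_rpow (hpt z hz) hp0.le
    _ = ENNReal.ofReal C ^ p * ∫⁻ z, ‖ρ.berezin μ z‖ₑ ^ p ∂ρ.lambdaMeasure :=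
        lintegral_const_mul' _ _ (by finiteness)
    _ < ∞ := ENNReal.mul_lt_top (by finiteness) hb

/-- The embedding of `A²_ρ` in `L²(μ)` is dominated by that in `L²(μ̂ ρ dv)`. -/
theorem InClassSStar.exists_lintegral_enorm_sq_le (hn : 1 ≤ n) (hρ : ρ.InClassSStar)
    {μ : Measure (Cn n)} [IsFiniteMeasure μ] (hμ : μ (ball (0 : Cn n) 1)ᶜ = 0) {α C : ℝ}
    (hα : 0 < α) (hC : 0 < C) (hle : ∀ z : Cn n, ‖z‖ < 1 → ∀ w ∈ bergmanBall z α,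
      ρ.kernelSize z ≤ C * ρ.kernelSize w) :
    ∃ K : ℝ≥0∞, K ≠ ∞ ∧ ∀ f : BergmanSpace ρ, ∫⁻ z, ‖f z‖ₑ ^ 2 ∂μ ≤
      K * ∫⁻ w, ‖ρ.average μ α w‖ₑ * ‖f w‖ₑ ^ 2 ∂ρ.measure := by
  obtain ⟨A, hA, hAle⟩ := hρ.exists_enorm_sq_le hn hα
  refine ⟨A * ENNReal.ofReal C, by finiteness, fun f => ?_⟩
  have hμb : ∀ᵐ z ∂μ, ‖z‖ < 1 := by
    rw [← mem_ae_iff] at hμ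
    filter_upwards [hμ] with z hz
    simpa using hz
  have hfm : Measurable fun w => ‖f w‖ₑ ^ 2 := f.measurable_coe.enorm.pow_const 2
  have hkm : Measurable fun z => ENNReal.ofReal (ρ.kernelSize z) :=
    ρ.measurable_kernelSize.ennreal_ofReal
  set E : Set (Cn n × Cn n) := {q | q.2 ∈ bergmanBall q.1 α} with hE
  have hEm : MeasurableSet E := measurableSet_bergmanBall_prod α
  set F : Cn n → Cn n → ℝ≥0∞ := fun z w =>
    E.indicator (fun q => ENNReal.ofReal (ρ.kernelSize q.1) * ‖f q.2‖ₑ ^ 2) (z, w) with hF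
  have hFm : Measurable (Function.uncurry F) :=
    ((hkm.comp measurable_fst).mul (hfm.comp measurable_snd)).indicator hEm
  have h1 : ∀ z, ENNReal.ofReal (ρ.kernelSize z) * ∫⁻ w in bergmanBall z α, ‖f w‖ₑ ^ 2 ∂ρ.measure =
      ∫⁻ w, F z w ∂ρ.measure := by
    intro z
    rw [← lintegral_const_mul' _ _ ENNReal.ofReal_ne_top,
      ← lintegral_indicator (measurableSet_bergmanBall z α)]
    rfl
  -- By symmetry of the metric the points z with w ∈ E(z,α) form E(w,α), and there Q(z) may be
  -- replaced by C Q(w). What remains is μ̂_α(w).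
  have h2 : ∀ᵐ w ∂ρ.measure, ∫⁻ z, F z w ∂μ ≤
      ENNReal.ofReal C * (‖ρ.average μ α w‖ₑ * ‖f w‖ₑ ^ 2) := by
    filter_upwards [ρ.ae_mem_ball] with w hw
    have hkw := kernelSize_pos (ρ := ρ) hw
    have h3 : ∀ᵐ z ∂μ, F z w ≤ (bergmanBall w α).indicator
        (fun _ => ENNReal.ofReal C * (ENNReal.ofReal (ρ.kernelSize w) * ‖f w‖ₑ ^ 2)) z := by
      filter_upwards [hμb] with z hz
      by_cases h : w ∈ bergmanBall z α
      · have h' : z ∈ bergmanBall w α := (mem_bergmanBall_comm hn hz hw).1 h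
        rw [indicator_of_mem h']
        simp only [hF]
        rw [indicator_of_mem (show (z, w) ∈ E from h), ← mul_assoc, ← ENNReal.ofReal_mul hC.le]
        gcongr
        exact hle z hz w h
      · simp only [hF]
        rw [indicator_of_notMem (show (z, w) ∉ E from h)]
        exact zero_le
    refine (lintegral_mono_ae h3).trans (le_of_eq ?_)
    rw [lintegral_indicator_const (measurableSet_bergmanBall w α), average_eq, enorm_mul,
      Real.enorm_of_nonneg hkw.le, Real.enorm_of_nonneg measureReal_nonneg, ofReal_measureReal]
    ring
  have hs : SFinite ρ.measure := by
    unfold measure ballVolume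
    have : SFinite ((volume (ball (0 : Cn n) 1))⁻¹ •
        (volume : Measure (Cn n)).restrict (ball 0 1)) := inferInstance
    infer_instance
  calc ∫⁻ z, ‖f z‖ₑ ^ 2 ∂μ ≤ ∫⁻ z, A * ∫⁻ w, F z w ∂ρ.measure ∂μ := by
        refine lintegral_mono_ae ?_
        filter_upwards [hμb] with z hz
        rw [← h1]
        exact hAle f.1 f.2 z hz
    _ = A * ∫⁻ w, ∫⁻ z, F z w ∂μ ∂ρ.measure := by
        rw [lintegral_const_mul' _ _ hA, lintegral_lintegral_swap hFm.aemeasurable]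
    _ ≤ A * ∫⁻ w, ENNReal.ofReal C * (‖ρ.average μ α w‖ₑ * ‖f w‖ₑ ^ 2) ∂ρ.measure := by
        exact mul_le_mul_right (lintegral_mono_ae h2) _
    _ = _ := by rw [lintegral_const_mul' _ _ ENNReal.ofReal_ne_top, mul_assoc]

/-- Jensen's inequality for the probability measure |f|²ρ dv, in the form of Hölder's inequality
against the constant 1. -/
theorem lintegral_mul_enorm_sq_rpow_le {φ : Cn n → ℝ≥0∞} (hφ : Measurable φ) {p : ℝ} (hp : 1 < p)
    {f : BergmanSpace ρ} (hf : ‖f‖ = 1) :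
    (∫⁻ w, φ w * ‖f w‖ₑ ^ 2 ∂ρ.measure) ^ p ≤ ∫⁻ w, φ w ^ p * ‖f w‖ₑ ^ 2 ∂ρ.measure := by
  have hp0 : 0 < p := by linarith
  have hfm : Measurable fun w => ‖f w‖ₑ ^ 2 := f.measurable_coe.enorm.pow_const 2
  set m := ρ.measure.withDensity fun w => ‖f w‖ₑ ^ 2 with hm
  have hint : ∀ g : Cn n → ℝ≥0∞, Measurable g → ∫⁻ w, g w ∂m = ∫⁻ w, g w * ‖f w‖ₑ ^ 2 ∂ρ.measure := by
    intro g hg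
    rw [hm, lintegral_withDensity_eq_lintegral_mul _ hfm hg]
    simp [mul_comm]
  have hone : ∫⁻ _, 1 ∂m = 1 := by
    rw [hint _ measurable_const]
    simp only [one_mul]
    rw [BergmanSpace.lintegral_enorm_sq, ← ofReal_norm, hf]
    simp
  have hh := ENNReal.lintegral_mul_le_Lp_mul_Lq m (Real.HolderConjugate.conjExponent hp)
    hφ.aemeasurable (g := fun _ => 1) aemeasurable_const
  simp only [Pi.mul_apply, mul_one, ENNReal.one_rpow, hone] at hh
  rw [← hint _ hφ, ← hint _ (hφ.pow_const p)]
  calc _ ≤ ((∫⁻ w, φ w ^ p ∂m) ^ (1 / p)) ^ p := ENNReal.rpow_le_rpow hh hp0.le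
    _ = _ := by
      rw [← ENNReal.rpow_mul, one_div, inv_mul_cancel₀ hp0.ne', ENNReal.rpow_one]

/-- Bessel's inequality for K_w, since f(w) = ⟨f, K_w⟩. -/
theorem sum_enorm_sq_le {s : Finset (BergmanSpace ρ)}
    (hs : Orthonormal ℂ (Subtype.val : ↥(s : Set (BergmanSpace ρ)) → BergmanSpace ρ)) (w : Cn n) :
    ∑ f ∈ s, ‖f w‖ₑ ^ 2 ≤ ENNReal.ofReal (‖ρ.kernelFun w‖ ^ 2) := by
  have h := hs.sum_inner_products_le (ρ.kernelFun w) (s := Finset.univ)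
  simp only [enorm_sq_eq_ofReal]
  rw [← ENNReal.ofReal_sum_of_nonneg fun _ _ => by positivity]
  refine ENNReal.ofReal_le_ofReal (le_trans (le_of_eq ?_) h)
  rw [← Finset.sum_coe_sort]
  refine Finset.sum_congr rfl fun f _ => ?_
  rw [norm_inner_symm, inner_kernelFun]

/-- If `μ̂ ∈ L^p(λ_ρ)` then `T_μ` is bounded and in `S_p`. -/
theorem InClassSStar.exists_isToeplitz (hn : 1 ≤ n) (hρ : ρ.InClassSStar)
    {μ : Measure (Cn n)} [IsFiniteMeasure μ] (hμ : μ (ball (0 : Cn n) 1)ᶜ = 0) {p α C : ℝ}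
    (hp : 1 < p) (hα : 0 < α) (hC : 0 < C) (hle : ∀ z : Cn n, ‖z‖ < 1 → ∀ w ∈ bergmanBall z α,
      ρ.kernelSize z ≤ C * ρ.kernelSize w)
    (h : MemLp (ρ.average μ α) (ENNReal.ofReal p) ρ.lambdaMeasure) :
    ∃ T : BergmanSpace ρ →L[ℂ] BergmanSpace ρ, ρ.IsToeplitz μ T ∧ InSchattenClass p T := by
  have hp0 : 0 < p := by linarith
  obtain ⟨K, hK, hKle⟩ := hρ.exists_lintegral_enorm_sq_le hn hμ hα hC hle
  obtain ⟨A, hA, hAle⟩ := hρ.exists_norm_kernelFun_sq_le hn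
  have ham : Measurable fun w => ‖ρ.average μ α w‖ₑ := (ρ.measurable_average μ α).enorm
  rw [memLp_ofReal_iff (ρ.measurable_average μ α).aestronglyMeasurable hp0,
    lintegral_lambdaMeasure ρ (ham.pow_const p)] at h
  set I := ∫⁻ z, ENNReal.ofReal (ρ.kernelSize z) * ‖ρ.average μ α z‖ₑ ^ p ∂ρ.measure with hI
  set M : ℝ≥0∞ := K ^ p * (ENNReal.ofReal A * I) with hM
  have hM1 : M ≠ ∞ := by finiteness
  have hfm : ∀ f : BergmanSpace ρ, Measurable fun w => ‖f w‖ₑ ^ 2 := fun f =>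
    f.measurable_coe.enorm.pow_const 2
  have hsum : ∀ s : Finset (BergmanSpace ρ),
      Orthonormal ℂ (Subtype.val : ↥(s : Set (BergmanSpace ρ)) → BergmanSpace ρ) →
      ∑ f ∈ s, (∫⁻ z, ‖f z‖ₑ ^ 2 ∂μ) ^ p ≤ M := by
    intro s hs
    calc ∑ f ∈ s, (∫⁻ z, ‖f z‖ₑ ^ 2 ∂μ) ^ p
        ≤ ∑ f ∈ s, K ^ p * ∫⁻ w, ‖ρ.average μ α w‖ₑ ^ p * ‖f w‖ₑ ^ 2 ∂ρ.measure := by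
          refine Finset.sum_le_sum fun f hf => ?_
          refine (ENNReal.rpow_le_rpow (hKle f) hp0.le).trans ?_
          rw [ENNReal.mul_rpow_of_nonneg _ _ hp0.le]
          gcongr
          exact lintegral_mul_enorm_sq_rpow_le ham hp (hs.1 ⟨f, hf⟩)
      _ = K ^ p * ∫⁻ w, ‖ρ.average μ α w‖ₑ ^ p * ∑ f ∈ s, ‖f w‖ₑ ^ 2 ∂ρ.measure := by
          have hm : ∀ f ∈ s, Measurable fun w => ‖ρ.average μ α w‖ₑ ^ p * ‖f w‖ₑ ^ 2 :=
            fun f _ => (ham.pow_const p).mul (hfm f)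
          rw [← Finset.mul_sum, ← lintegral_finsetSum _ hm]
          simp_rw [Finset.mul_sum]
      _ ≤ K ^ p * ∫⁻ w, ENNReal.ofReal A *
            (ENNReal.ofReal (ρ.kernelSize w) * ‖ρ.average μ α w‖ₑ ^ p) ∂ρ.measure := by
          gcongr K ^ p * ?_
          refine lintegral_mono_ae ?_
          filter_upwards [ρ.ae_mem_ball] with w hw
          calc _ ≤ ‖ρ.average μ α w‖ₑ ^ p * ENNReal.ofReal (A * ρ.kernelSize w) := by
                gcongr
                exact (sum_enorm_sq_le hs w).trans (ENNReal.ofReal_le_ofReal (hAle w hw))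
            _ = _ := by rw [ENNReal.ofReal_mul hA.le]; ring
      _ = M := by rw [lintegral_const_mul' _ _ ENNReal.ofReal_ne_top]
  -- A single unit vector is an orthonormal system, so the summed bound already contains the
  -- Carleson estimate that makes the embedding J bounded.
  have hunit : ∀ f : BergmanSpace ρ, ‖f‖ = 1 → ∫⁻ z, ‖f z‖ₑ ^ 2 ∂μ ≤ M ^ (1 / p) := by
    intro f hf
    have h1 := hsum {f} (by
      classical
      rw [orthonormal_subtype_iff_ite]
      intro v hv w hw
      rw [Finset.coe_singleton, mem_singleton_iff] at hv hw
      subst hv; subst hw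
      rw [inner_self_eq_norm_sq_to_K, hf]
      simp)
    rw [Finset.sum_singleton] at h1
    have h2 := ENNReal.rpow_le_rpow h1 (show 0 ≤ 1 / p by positivity)
    rwa [← ENNReal.rpow_mul, mul_one_div_cancel hp0.ne', ENNReal.rpow_one] at h2
  set B := M ^ (1 / p) with hB
  have hB1 : B ≠ ∞ := ENNReal.rpow_ne_top_of_nonneg (by positivity) hM1
  have hcarl : ∀ f : BergmanSpace ρ, ∫⁻ z, ‖f z‖ₑ ^ 2 ∂μ ≤ B * ‖f‖ₑ ^ 2 := by
    intro f
    rcases eq_or_ne f 0 with rfl | hf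
    · have : ∀ z, (0 : BergmanSpace ρ) z = 0 := fun z => rfl
      simp [this]
    · have hf0 : ‖f‖ ≠ 0 := norm_ne_zero_iff.2 hf
      have h1 := hunit ((‖f‖ : ℂ)⁻¹ • f) (by
        rw [norm_smul, norm_inv, Complex.norm_real, norm_norm, inv_mul_cancel₀ hf0])
      have h2 : ∀ z, ‖f z‖ₑ ^ 2 = ‖f‖ₑ ^ 2 * ‖((‖f‖ : ℂ)⁻¹ • f) z‖ₑ ^ 2 := fun z => by
        have h3 : ((‖f‖ : ℂ)⁻¹ • f) z = (‖f‖ : ℂ)⁻¹ * f z := rfl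
        have h4 : f z = (‖f‖ : ℂ) * ((‖f‖ : ℂ)⁻¹ * f z) := by
          rw [← mul_assoc, mul_inv_cancel₀ (by exact_mod_cast hf0), one_mul]
        have h5 : ‖(‖f‖ : ℂ)‖ₑ = ‖f‖ₑ := by
          rw [← ofReal_norm, ← ofReal_norm, Complex.norm_real, norm_norm]
        rw [h3]
        nth_rewrite 1 [h4]
        rw [enorm_mul, mul_pow, h5]
      simp_rw [h2]
      rw [lintegral_const_mul' _ _ (by finiteness), mul_comm B]
      gcongr
  have hmem : ∀ f : BergmanSpace ρ, MemLp (fun z => f z) 2 μ := fun f => by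
    refine ⟨f.measurable_coe.aestronglyMeasurable, ?_⟩
    rw [eLpNorm_lt_top_iff_lintegral_rpow_enorm_lt_top (by norm_num) (by norm_num)]
    simp only [ENNReal.toReal_ofNat, ENNReal.rpow_ofNat]
    exact (hcarl f).trans_lt (by finiteness)
  have hJn : ∀ f : BergmanSpace ρ, ‖(hmem f).toLp‖ₑ ^ 2 = ∫⁻ z, ‖f z‖ₑ ^ 2 ∂μ := fun f => by
    rw [Lp.enorm_toLp, eLpNorm_eq_lintegral_rpow_enorm_toReal (by norm_num) (by norm_num)]
    simp only [ENNReal.toReal_ofNat, ENNReal.rpow_ofNat, one_div]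
    rw [← ENNReal.rpow_natCast, ← ENNReal.rpow_mul]
    simp
  let J₀ : BergmanSpace ρ →ₗ[ℂ] Lp ℂ 2 μ :=
    { toFun := fun f => (hmem f).toLp
      map_add' := fun f g => MemLp.toLp_add (hmem f) (hmem g)
      map_smul' := fun c f => MemLp.toLp_const_smul c (hmem f) }
  let J : BergmanSpace ρ →L[ℂ] Lp ℂ 2 μ := J₀.mkContinuous (√B.toReal) fun f => by
    have h1 : ‖J₀ f‖ₑ ^ 2 ≤ B * ‖f‖ₑ ^ 2 := (hJn f).trans_le (hcarl f)
    have h2 := ENNReal.toReal_mono (by finiteness) h1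
    simp only [ENNReal.toReal_mul, ENNReal.toReal_pow, toReal_enorm] at h2
    refine (pow_le_pow_iff_left₀ (norm_nonneg _) (by positivity) two_ne_zero).1 ?_
    rwa [mul_pow, Real.sq_sqrt ENNReal.toReal_nonneg]
  have hJ : ∀ f, J f = (hmem f).toLp := fun f => rfl
  refine ⟨J.adjoint ∘L J, fun f z _ => ?_, ?_⟩
  · have hker : ∀ w, ρ.kernel z w = conj (ρ.kernelFun z w) := fun w => by
      rw [kernelFun_apply, conj_kernel]
    refine ⟨?_, ?_⟩
    · have h1 : MemLp (fun w => ρ.kernel z w) 2 μ := by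
        simp_rw [hker]
        exact (hmem (ρ.kernelFun z)).star
      exact h1.integrable_mul (hmem f)
    -- (J*J f)(z) = ⟨J f, J K_z⟩ in L²(μ), which is the Toeplitz integral.
    · rw [← inner_kernelFun, ContinuousLinearMap.comp_apply, ContinuousLinearMap.adjoint_inner_right,
        hJ, hJ, L2.inner_def]
      refine integral_congr_ae ?_
      filter_upwards [MemLp.coeFn_toLp (hmem f), MemLp.coeFn_toLp (hmem (ρ.kernelFun z))] with w h1 h2
      rw [h1, h2, hker, RCLike.inner_apply, mul_comm]
  · refine inSchattenClass_adjoint_comp_self hp0 (M := M.toReal) fun s hs => ?_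
    have h1 := ENNReal.toReal_mono hM1 (hsum s hs)
    refine le_trans (le_of_eq ?_) h1
    rw [ENNReal.toReal_sum fun f _ => ENNReal.rpow_ne_top_of_nonneg hp0.le
      ((hcarl f).trans_lt (by finiteness)).ne]
    refine Finset.sum_congr rfl fun f _ => ?_
    rw [← hJn, ← hJ, ← ENNReal.toReal_rpow, ENNReal.toReal_pow, toReal_enorm]

end BergmanWeight

end

/-! ### The main theorem -/

theorem theorem3 {n : ℕ} (hn : 1 ≤ n) (ρ : BergmanWeight n) (hρ : ρ.InClassSStar) :
    ∃ α₀ : ℝ, 0 < α₀ ∧ ∀ (μ : Measure (Cn n)) [IsFiniteMeasure μ],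
      μ (ball (0 : Cn n) 1)ᶜ = 0 → ∀ p : ℝ, 1 < p →
        List.TFAE
          [∃ T : BergmanSpace ρ →L[ℂ] BergmanSpace ρ, ρ.IsToeplitz μ T ∧ InSchattenClass p T,
           MemLp (ρ.berezin μ) (ENNReal.ofReal p) ρ.lambdaMeasure,
           ∀ α ∈ Ioo 0 α₀, MemLp (ρ.average μ α) (ENNReal.ofReal p) ρ.lambdaMeasure,
           ∃ α ∈ Ioo 0 α₀, MemLp (ρ.average μ α) (ENNReal.ofReal p) ρ.lambdaMeasure] := by
  -- The radius is fixed before μ and p are introduced. Its first estimate serves (b) ⇒ (c), the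
  -- second (c') ⇒ (a), and both pass to the smaller balls.
  obtain ⟨α₀, hα₀, C, hC, hle⟩ := hρ.exists_le_norm_normKernelFun_sq hn
  refine ⟨α₀, hα₀, fun μ _ hμ p hp => ?_⟩
  have hsub : ∀ α ∈ Ioo 0 α₀, ∀ z w : Cn n, w ∈ bergmanBall z α → w ∈ bergmanBall z α₀ :=
    fun α hα z w hw => ⟨hw.1, hw.2.trans hα.2⟩
  tfae_have 1 → 2 := fun ⟨T, hT, hS⟩ => hρ.memLp_berezin hn hp hT hS
  tfae_have 2 → 3 := fun h α hα => BergmanWeight.memLp_average_of_memLp_berezin hp hC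
    (fun z hz w hw => (hle z hz w (hsub α hα z w hw)).1) h
  tfae_have 3 → 4 := fun h => ⟨α₀ / 2, ⟨half_pos hα₀, half_lt_self hα₀⟩,
    h _ ⟨half_pos hα₀, half_lt_self hα₀⟩⟩
  tfae_have 4 → 1 := fun ⟨α, hα, h⟩ => hρ.exists_isToeplitz hn hμ hp hα.1 hC
    (fun z hz w hw => (hle z hz w (hsub α hα z w hw)).2) h
  tfae_finish
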